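/- Setting. Let $p\ge 0$ be an integer and $r$ an integer with $-1\le r\le p-1$. A $p$-open knot vector is a sequence $\Xi=(\xi_1\le\dots\le\xi_{n+p+1})$ in which exactly the first $p+1$ knots equal $0$ and exactly the last $p+1$ knots equal $1$; it has regularity $r$ if every knot in $(0,1)$ has multiplicity at most $p-r$. Let $\widehat B_{j,p}$ ($1\le j\le n$) be the B-splines of degree $p$ on $\Xi$ given by the Cox–de Boor recursion (with $\widehat B_{j,0}=1_{[\xi_j,\xi_{j+1})}$ and $0/0=0$), and $S_p^r=\mathrm{span}\{\widehat B_{1,p},\dots,\widehat B_{n,p}\}$. For $k=1,2$, $S_{p-k}^{r-k}$ is the span of the B-splines of degree $p-k$ on the knot vector obtained from $\Xi$ by deleting the first $k$ and the last $k$ knots. An element is an interval $I=(\xi_i,\xi_{i+1})\neq\emptyset$, and $\tilde I=(\xi_{i-p},\xi_{i+p+1})$ is its support extension. The mesh is regular with constant $c_u$ if $\max_{J}|J|\le c_u|I|$ for all elements $I$, the maximum being over all elements $J$. $H^l$ denotes the Sobolev space of functions with weak derivatives up to order $l$ in $L^2$, and $|v|_{H^l}$ is the $L^2$-norm of the $l$-th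 weak derivative. Projections. Let $g_p(x)=\int_{-1}^{x}B^*$, where $B^*$ is the B-spline of degree $p$ on the knots $\cos\frac{(p+1-j)\pi}{p+1}$, $0\le j\le p+1$, scaled so that $\int B^*=1$, and put $$\psi_j(x)=g_p\Big(\frac{2x-\xi_j-\xi_{j+p+1}}{\xi_{j+p+1}-\xi_j}\Big)\,\frac{1}{p!}\prod_{k=1}^{p}(x-\xi_{j+k}),\qquad \lambda_j^p(v)=\int_{\xi_j}^{\xi_{j+p+1}}v\,\psi_j^{(p+1)}\,dx .$$ For $v\in L^2((0,1))$ define $\widehat\Pi_p v=\sum_{j=1}^n\lambda_j^p(v)\widehat B_{j,p}$; if $r\ge0$, $\widehat\Pi^{c,1}_{p-1}v=\frac{d}{d\zeta}\widehat\Pi_p\int_0^\zeta v(\tau)\,d\tau$; and if $r\ge1$, $\widehat\Pi^{c,2}_{p-2}v=\frac{d^2}{d\zeta^2}\widehat\Pi_p\int_0^\zeta\int_0^\tau v(s)\,ds\,d\tau=\frac{d}{d\zeta}\widehat\Pi^{c,1}_{p-1}\int_0^\zeta v(\tau)\,d\tau$. Functions on $(0,1)$ are identified if they agree almost everywhere.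 Lemma. For every $p$-open knot vector of regularity $r$: (1) $\widehat\Pi_p$ maps $L^2((0,1))$ into $S_p^r$ and $\widehat\Pi_p s=s$ for all $s\in S_p^r$. (2) If $r\ge 0$, then $\widehat\Pi^{c,1}_{p-1}$ maps $L^2((0,1))$ into $S_{p-1}^{r-1}$, $\widehat\Pi^{c,1}_{p-1}s=s$ for all $s\in S_{p-1}^{r-1}$, and $\widehat\Pi^{c,1}_{p-1}\partial_\zeta v=\partial_\zeta\widehat\Pi_p v$ for all $v\in H^1((0,1))$. (3) If $r\ge 1$, then $\widehat\Pi^{c,2}_{p-2}$ maps $L^2((0,1))$ into $S_{p-2}^{r-2}$, $\widehat\Pi^{c,2}_{p-2}s=s$ for all $s\in S_{p-2}^{r-2}$, and $\widehat\Pi^{c,2}_{p-2}\partial_\zeta^2 v=\partial_\zeta^2\widehat\Pi_p v=\partial_\zeta\widehat\Pi^{c,1}_{p-1}\partial_\zeta v$ for all $v\in H^2((0,1))$. In (2) and (3) the derivatives of the projected functions are both classical derivatives almost everywhere and weak derivatives on $(0,1)$. (4) For every $c_u$ there is a constant $C$, depending only on $p$, $r$ and $c_u$, such that for every $p$-open knot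 vector of regularity $r$ whose mesh is regular with constant $c_u$, and every element $I$, $$|\widehat\Pi_p v|_{H^l(I)}\le C|v|_{H^l(\tilde I)}\quad\text{for all }v\in H^l((0,1)),\ 0\le l\le p+1,$$ $$|\widehat\Pi^{c,1}_{p-1} v|_{H^l(I)}\le C|v|_{H^l(\tilde I)}\quad\text{for all }v\in H^l((0,1)),\ 0\le l\le p,\ \text{ if } r\ge0,$$ $$|\widehat\Pi^{c,2}_{p-2} v|_{H^l(I)}\le C|v|_{H^l(\tilde I)}\quad\text{for all }v\in H^l((0,1)),\ 0\le l\le p-1,\ \text{ if } r\ge1 .$$ -/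

import Mathlib

open MeasureTheory Set

open scoped ENNReal NNReal ContDiff

namespace UnivariateSpline

noncomputable section

/-! ### B-splines and spline spaces

Knots are indexed from `0`: a knot vector of degree `p` with `n` basis functions consists of the
`n + p + 1` values `ξ 0, …, ξ (n + p)`; the values of `ξ` beyond `n + p` are never used. -/

/-- The B-spline `B_{j,p}` by the Cox–de Boor recursion. Division by zero yields zero, which is the
usual convention `0 / 0 = 0`. -/
def bspline (ξ : ℕ → ℝ) : ℕ → ℕ → ℝ → ℝ
  | 0, j, x => (Ico (ξ j) (ξ (j + 1))).indicator (fun _ => 1) x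
  | p + 1, j, x =>
      (x - ξ j) / (ξ (j + p + 1) - ξ j) * bspline ξ p j x
        + (ξ (j + p + 2) - x) / (ξ (j + p + 2) - ξ (j + 1)) * bspline ξ p (j + 1) x

/-- The span of the B-splines `B_{0,p}, …, B_{n-1,p}`. -/
def splineSpace (ξ : ℕ → ℝ) (p n : ℕ) : Submodule ℝ (ℝ → ℝ) :=
  Submodule.span ℝ {f | ∃ j < n, f = bspline ξ p j}

/-- The spline space `S_{p-k}^{r-k}` belonging to `S_p^r`: it is generated by the B-splines of
degree `p - k` on the knot vector from which the first `k` and the last `k` knots are removed. -/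
def reducedSplineSpace (k : ℕ) (ξ : ℕ → ℝ) (p n : ℕ) : Submodule ℝ (ℝ → ℝ) :=
  splineSpace (fun j => ξ (j + k)) (p - k) (n - k)

/-- The knots `ξ 0 ≤ … ≤ ξ (n + p)` form a `p`-open knot vector of `[0,1]`: exactly the first
`p + 1` knots are `0` and exactly the last `p + 1` knots are `1`. -/
structure IsOpenKnotVector (p n : ℕ) (ξ : ℕ → ℝ) : Prop where
  mono : ∀ i j, i ≤ j → j ≤ n + p → ξ i ≤ ξ j
  eq_zero : ∀ j, j ≤ p → ξ j = 0
  pos : ∀ j, p < j → j ≤ n + p → 0 < ξ j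
  lt_one : ∀ j, j < n → ξ j < 1
  eq_one : ∀ j, n ≤ j → j ≤ n + p → ξ j = 1

/-- The multiplicity `m(x)` of the value `x` in the knot vector. -/
def multiplicity (p n : ℕ) (ξ : ℕ → ℝ) (x : ℝ) : ℕ :=
  Set.ncard {k : ℕ | k ≤ n + p ∧ ξ k = x}

/-- Regularity `r`: every internal knot has multiplicity at most `p - r`. -/
def HasRegularity (p n : ℕ) (ξ : ℕ → ℝ) (r : ℤ) : Prop :=
  ∀ j, j ≤ n + p → 0 < ξ j → ξ j < 1 → (multiplicity p n ξ (ξ j) : ℤ) ≤ (p : ℤ) - r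

/-- `i` is the index of a mesh element `(ξ i, ξ (i + 1))`. -/
def IsElement (p n : ℕ) (ξ : ℕ → ℝ) (i : ℕ) : Prop :=
  i + 1 ≤ n + p ∧ ξ i < ξ (i + 1)

/-- The element `I = (ξ i, ξ (i + 1))`. -/
def element (ξ : ℕ → ℝ) (i : ℕ) : Set ℝ := Ioo (ξ i) (ξ (i + 1))

/-- The support extension `(ξ (i - p), ξ (i + p + 1))` of the element with index `i`
(for an element of a `p`-open knot vector one always has `p ≤ i < n`). -/
def supportExtension (ξ : ℕ → ℝ) (p i : ℕ) : Set ℝ := Ioo (ξ (i - p)) (ξ (i + p + 1))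

/-- The mesh size, i.e. the maximal length of an element. -/
def meshSize (p n : ℕ) (ξ : ℕ → ℝ) : ℝ := ⨆ i : Fin (n + p), (ξ (i + 1) - ξ i)

/-- The regular mesh condition `h ≤ c * h_I` for all elements `I`. -/
def IsRegularMesh (c : ℝ) (p n : ℕ) (ξ : ℕ → ℝ) : Prop :=
  ∀ i, IsElement p n ξ i → meshSize p n ξ ≤ c * (ξ (i + 1) - ξ i)

/-! ### The dual functionals and the projections -/

/-- The Chebyshev knots `cos ((p + 1 - j) π / (p + 1))`, `0 ≤ j ≤ p + 1`, in `[-1, 1]`. -/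
def perfectKnot (p j : ℕ) : ℝ := Real.cos (((p : ℝ) + 1 - j) * Real.pi / ((p : ℝ) + 1))

/-- The transition function from `0` (left of `-1`) to `1` (right of `1`): the antiderivative of the
perfect B-spline of degree `p`, normalized to have integral one. -/
def transition (p : ℕ) (x : ℝ) : ℝ :=
  ∫ t in (-1 : ℝ)..x, ((p : ℝ) + 1) / 2 * bspline (perfectKnot p) p 0 t

/-- `ψ_j(x) = G_j(x) φ_j(x)` with `φ_j(x) = (x - ξ_{j+1}) ⋯ (x - ξ_{j+p}) / p!` and
`G_j(x) = g ((2 x - ξ_j - ξ_{j+p+1}) / (ξ_{j+p+1} - ξ_j))`, `g` the transition function. -/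
def dualKernel (ξ : ℕ → ℝ) (p j : ℕ) (x : ℝ) : ℝ :=
  transition p ((2 * x - ξ j - ξ (j + p + 1)) / (ξ (j + p + 1) - ξ j))
    * ((∏ k ∈ Finset.Icc 1 p, (x - ξ (j + k))) / (p.factorial : ℝ))

/-- The dual functional `λ_j^p(v) = ∫_{ξ_j}^{ξ_{j+p+1}} v D^{p+1} ψ_j`. The function `ψ_j` is `C^p`
and piecewise polynomial, so that its classical derivative of order `p + 1` exists off a finite
set. -/
def dualFunctional (ξ : ℕ → ℝ) (p j : ℕ) (v : ℝ → ℝ) : ℝ :=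
  ∫ x in (ξ j)..(ξ (j + p + 1)), v x * iteratedDeriv (p + 1) (dualKernel ξ p j) x

/-- The projection `Π_p v = ∑_j λ_j^p(v) B_{j,p}`. -/
def proj (ξ : ℕ → ℝ) (p n : ℕ) (v : ℝ → ℝ) : ℝ → ℝ := fun x =>
  ∑ j ∈ Finset.range n, dualFunctional ξ p j v * bspline ξ p j x

/-- The antiderivative `ζ ↦ ∫_0^ζ v`. -/
def antideriv (v : ℝ → ℝ) : ℝ → ℝ := fun x => ∫ t in (0 : ℝ)..x, v t

/-- The projection `Π^{c,1}_{p-1} v = d/dζ Π_p ∫_0^ζ v`. -/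
def projC1 (ξ : ℕ → ℝ) (p n : ℕ) (v : ℝ → ℝ) : ℝ → ℝ :=
  deriv (proj ξ p n (antideriv v))

/-- The projection `Π^{c,2}_{p-2} v = d/dζ Π^{c,1}_{p-1} ∫_0^ζ v = d²/dζ² Π_p ∫_0^ζ ∫_0^τ v`. -/
def projC2 (ξ : ℕ → ℝ) (p n : ℕ) (v : ℝ → ℝ) : ℝ → ℝ :=
  deriv (deriv (proj ξ p n (antideriv (antideriv v))))

/-! ### Sobolev spaces -/

/-- `g` is the weak derivative of order `k` of `v` on the open set `Ω`. -/
def HasWeakDeriv (Ω : Set ℝ) (k : ℕ) (v g : ℝ → ℝ) : Prop :=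
  LocallyIntegrableOn v Ω ∧ LocallyIntegrableOn g Ω ∧
    ∀ φ : ℝ → ℝ, ContDiff ℝ ∞ φ → HasCompactSupport φ → tsupport φ ⊆ Ω →
      ∫ x in Ω, v x * iteratedDeriv k φ x = (-1) ^ k * ∫ x in Ω, g x * φ x

/-- `v ∈ H^l(Ω)`: all weak derivatives of order at most `l` exist and are in `L²(Ω)`. -/
def MemSobolev (Ω : Set ℝ) (l : ℕ) (v : ℝ → ℝ) : Prop :=
  ∀ k ≤ l, ∃ g, HasWeakDeriv Ω k v g ∧ MemLp g 2 (volume.restrict Ω)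

/-- The seminorm `|v|_{H^l(Ω)}`: the `L²(Ω)`-norm of the weak derivative of order `l` (which is
unique almost everywhere), and `∞` if there is no such derivative. -/
def sobolevSeminorm (Ω : Set ℝ) (l : ℕ) (v : ℝ → ℝ) : ℝ≥0∞ :=
  ⨅ (g : ℝ → ℝ) (_ : HasWeakDeriv Ω l v g), eLpNorm g 2 (volume.restrict Ω)

end

end UnivariateSpline

namespace UnivariateSpline

/-! The functionals `λ_j` are dual to the B-splines: `ψ_j^(p+1)` is supported in
`[ξ_j, ξ_{j+p+1}]`, its integral against a B-spline of degree `p` is a multiple of a divided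
difference of `ψ_j` of order `p + 1`, and at the knots `ψ_j` agrees with `0` to the left of that
interval and with `∏ (x - ξ_{j+k}) / p!` to the right of it. Hence `Π_p` is a projection onto the
splines, and by Marsden's identity it reproduces polynomials of degree at most `p` on every element.

Locality gives everything else. On an element, `Π_p v` depends on `v` on the support extension only,
and two functions with the same weak derivative of order `l ≤ p + 1` there differ by a polynomial of
degree less than `l`, which `Π_p` reproduces; so `∂^l Π_p v` depends on the `l`-th weak derivative
of `v` only. Comparing `v` with the `k`-fold primitive of its `k`-th derivative yields commutation,
and comparing it with the `l`-fold primitive of its `l`-th derivative yields stability, since this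
primitive is smaller than the derivative by the `l`-th power of the mesh size, which compensates for
the `l` derivatives of the B-splines. -/

open Filter Topology Polynomial

/-! ### B-splines and their derivatives -/

section Knots

variable {ξ : ℕ → ℝ} {a b a' b' i k l : ℕ} {x : ℝ}

/-- The knots with indices in `[a, b]` are sorted. The values of `ξ` outside this range are
irrelevant, so that a B-spline can be studied with the knots of its own support only. -/
def SortedKnots (ξ : ℕ → ℝ) (a b : ℕ) : Prop := MonotoneOn ξ (Icc a b)

lemma SortedKnots.le (h : SortedKnots ξ a b) (hak : a ≤ k) (hkl : k ≤ l) (hlb : l ≤ b) :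
    ξ k ≤ ξ l :=
  h ⟨hak, hkl.trans hlb⟩ ⟨hak.trans hkl, hlb⟩ hkl

lemma SortedKnots.mono (h : SortedKnots ξ a b) (ha : a ≤ a') (hb : b' ≤ b) :
    SortedKnots ξ a' b' :=
  MonotoneOn.mono h (Icc_subset_Icc ha hb)

/-- `x` is different from all knots with indices in `[a, b]`. -/
def OffKnots (ξ : ℕ → ℝ) (a b : ℕ) (x : ℝ) : Prop := x ∉ ξ '' Icc a b

lemma OffKnots.ne (h : OffKnots ξ a b x) (hak : a ≤ k) (hkb : k ≤ b) : x ≠ ξ k :=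
  fun hx => h ⟨k, ⟨hak, hkb⟩, hx.symm⟩

lemma OffKnots.mono (h : OffKnots ξ a b x) (ha : a ≤ a') (hb : b' ≤ b) : OffKnots ξ a' b' x :=
  fun hx => h (image_mono (Icc_subset_Icc ha hb) hx)

lemma finite_knots (ξ : ℕ → ℝ) (a b : ℕ) : (ξ '' Icc a b).Finite := (finite_Icc a b).image ξ

lemma OffKnots.eventually (h : OffKnots ξ a b x) : ∀ᶠ y in 𝓝 x, OffKnots ξ a b y :=
  (finite_knots ξ a b).isClosed.isOpen_compl.mem_nhds h

lemma ae_offKnots (ξ : ℕ → ℝ) (a b : ℕ) : ∀ᵐ x : ℝ, OffKnots ξ a b x :=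
  (finite_knots ξ a b).countable.ae_notMem volume

lemma SortedKnots.offKnots_of_mem_Ioo (h : SortedKnots ξ a b) (hai : a ≤ i) (hib : i + 1 ≤ b)
    (hx : x ∈ Ioo (ξ i) (ξ (i + 1))) : OffKnots ξ a b x := by
  rintro ⟨k, ⟨hak, hkb⟩, rfl⟩
  rcases Nat.lt_or_ge i k with hik | hki
  · exact (h.le (by omega) hik hkb).not_gt hx.2
  · exact (h.le hak hki (by omega)).not_gt hx.1

end Knots

section BSpline

variable {ξ : ℕ → ℝ} {p j : ℕ} {x : ℝ}

lemma bspline_zero (ξ : ℕ → ℝ) (j : ℕ) (x : ℝ) :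
    bspline ξ 0 j x = (Ico (ξ j) (ξ (j + 1))).indicator (fun _ => 1) x := rfl

lemma bspline_succ (ξ : ℕ → ℝ) (p j : ℕ) (x : ℝ) :
    bspline ξ (p + 1) j x = (x - ξ j) / (ξ (j + p + 1) - ξ j) * bspline ξ p j x
      + (ξ (j + p + 2) - x) / (ξ (j + p + 2) - ξ (j + 1)) * bspline ξ p (j + 1) x := rfl

lemma bspline_shift (ξ : ℕ → ℝ) (k p j : ℕ) :
    bspline (fun i => ξ (i + k)) p j = bspline ξ p (j + k) := by
  induction p generalizing j with
  | zero =>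
    funext x
    rw [bspline_zero, bspline_zero, Nat.add_right_comm j 1 k]
  | succ p ih =>
    funext x
    rw [bspline_succ, bspline_succ, ih, ih, Nat.add_right_comm j 1 k]
    simp only [show j + p + 1 + k = j + k + p + 1 by omega,
      show j + p + 2 + k = j + k + p + 2 by omega]

lemma measurable_bspline (ξ : ℕ → ℝ) (p j : ℕ) : Measurable (bspline ξ p j) := by
  induction p generalizing j with
  | zero => exact measurable_const.indicator measurableSet_Ico
  | succ p ih =>
    exact (((measurable_id.sub_const _).div_const _).mul (ih j)).add
      (((measurable_id.const_sub _).div_const _).mul (ih (j + 1)))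

lemma bspline_eq_zero_of_lt (h : SortedKnots ξ j (j + p + 1)) (hx : x < ξ j) :
    bspline ξ p j x = 0 := by
  induction p generalizing j with
  | zero => exact indicator_of_notMem (fun hmem => hx.not_ge hmem.1) _
  | succ p ih =>
    rw [bspline_succ, ih (h.mono le_rfl (by omega)) hx, ih (h.mono (by omega) (by omega))
      (hx.trans_le (h.le le_rfl (by omega) (by omega))), mul_zero, mul_zero, add_zero]

lemma bspline_eq_zero_of_ge (h : SortedKnots ξ j (j + p + 1)) (hx : ξ (j + p + 1) ≤ x) :
    bspline ξ p j x = 0 := by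
  induction p generalizing j with
  | zero => exact indicator_of_notMem (fun hmem => hx.not_gt hmem.2) _
  | succ p ih =>
    have hright : ξ (j + 1 + p + 1) ≤ x := by rwa [show j + 1 + p + 1 = j + (p + 1) + 1 by omega]
    rw [bspline_succ, ih (h.mono le_rfl (by omega))
      ((h.le (by omega) (by omega) (by omega)).trans hx), ih (h.mono (by omega) (by omega)) hright,
      mul_zero, mul_zero, add_zero]

lemma bspline_eq_zero_of_knots_eq (h : SortedKnots ξ j (j + p + 1)) (he : ξ j = ξ (j + p + 1))
    (x : ℝ) : bspline ξ p j x = 0 :=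
  (lt_or_ge x (ξ j)).elim (bspline_eq_zero_of_lt h) fun hx => bspline_eq_zero_of_ge h (he ▸ hx)

lemma mem_Ico_of_bspline_ne_zero (h : SortedKnots ξ j (j + p + 1)) (hx : bspline ξ p j x ≠ 0) :
    x ∈ Ico (ξ j) (ξ (j + p + 1)) :=
  ⟨le_of_not_gt (mt (bspline_eq_zero_of_lt h) hx), lt_of_not_ge (mt (bspline_eq_zero_of_ge h) hx)⟩

lemma bspline_eventuallyEq_zero (h : SortedKnots ξ j (j + p + 1))
    (hx : x < ξ j ∨ ξ (j + p + 1) < x) : bspline ξ p j =ᶠ[𝓝 x] fun _ => 0 := by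
  rcases hx with hx | hx
  · filter_upwards [gt_mem_nhds hx] with y hy using bspline_eq_zero_of_lt h hy
  · filter_upwards [lt_mem_nhds hx] with y hy using bspline_eq_zero_of_ge h hy.le

lemma abs_div_mul_le {s t y : ℝ} (h : y ≠ 0 → 0 ≤ s ∧ s ≤ t) : |s / t * y| ≤ |y| := by
  rcases eq_or_ne y 0 with rfl | hy
  · simp
  · obtain ⟨hs, hst⟩ := h hy
    rw [abs_mul, abs_of_nonneg (div_nonneg hs (hs.trans hst))]
    exact mul_le_of_le_one_left (abs_nonneg y) (div_le_one_of_le₀ hst (hs.trans hst))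

lemma abs_bspline_succ_le (h : SortedKnots ξ j (j + p + 2)) (x : ℝ) :
    |bspline ξ (p + 1) j x| ≤ |bspline ξ p j x| + |bspline ξ p (j + 1) x| := by
  rw [bspline_succ]
  refine (abs_add_le _ _).trans
    (add_le_add (abs_div_mul_le fun hne => ?_) (abs_div_mul_le fun hne => ?_))
  · have hmem := mem_Ico_of_bspline_ne_zero (h.mono le_rfl (by omega)) hne
    exact ⟨by linarith [hmem.1], by linarith [hmem.2]⟩
  · have hmem := mem_Ico_of_bspline_ne_zero (h.mono (by omega) (by omega)) hne
    rw [show j + 1 + p + 1 = j + p + 2 by omega] at hmem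
    exact ⟨by linarith [hmem.2], by linarith [hmem.1]⟩

lemma abs_bspline_le (h : SortedKnots ξ j (j + p + 1)) (x : ℝ) : |bspline ξ p j x| ≤ 2 ^ p := by
  induction p generalizing j with
  | zero =>
    rw [bspline_zero]
    by_cases hx : x ∈ Ico (ξ j) (ξ (j + 1)) <;> simp [hx]
  | succ p ih =>
    calc |bspline ξ (p + 1) j x|
        ≤ |bspline ξ p j x| + |bspline ξ p (j + 1) x| := abs_bspline_succ_le h x
      _ ≤ 2 ^ p + 2 ^ p :=
          add_le_add (ih (h.mono le_rfl (by omega))) (ih (h.mono (by omega) (by omega)))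
      _ = 2 ^ (p + 1) := by ring

lemma bspline_zero_eventuallyEq (hx : OffKnots ξ j (j + 1) x) :
    bspline ξ 0 j =ᶠ[𝓝 x] fun _ => bspline ξ 0 j x := by
  have hleft : ∀ᶠ y in 𝓝 x, ξ j ≤ y ↔ ξ j ≤ x := by
    rcases lt_or_gt_of_ne (hx.ne le_rfl (by omega)) with hlt | hgt
    · filter_upwards [gt_mem_nhds hlt] with y hy using iff_of_false hy.not_ge hlt.not_ge
    · filter_upwards [lt_mem_nhds hgt] with y hy using iff_of_true hy.le hgt.le
  have hright : ∀ᶠ y in 𝓝 x, y < ξ (j + 1) ↔ x < ξ (j + 1) := by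
    rcases lt_or_gt_of_ne (hx.ne (by omega) le_rfl) with hlt | hgt
    · filter_upwards [gt_mem_nhds hlt] with y hy using iff_of_true hy hlt
    · filter_upwards [lt_mem_nhds hgt] with y hy using iff_of_false hy.not_gt hgt.not_gt
  filter_upwards [hleft, hright] with y hy₁ hy₂
  simp only [bspline_zero, indicator, mem_Ico, hy₁, hy₂]

lemma contDiffAt_bspline (hx : OffKnots ξ j (j + p + 1) x) :
    ContDiffAt ℝ ∞ (bspline ξ p j) x := by
  induction p generalizing j with
  | zero => exact contDiffAt_const.congr_of_eventuallyEq (bspline_zero_eventuallyEq hx)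
  | succ p ih =>
    have hleft := ih (hx.mono le_rfl (by omega) : OffKnots ξ j (j + p + 1) x)
    have hright := ih (hx.mono (by omega) (by omega) : OffKnots ξ (j + 1) (j + 1 + p + 1) x)
    change ContDiffAt ℝ ∞ (fun x => _) x
    simp only [bspline_succ, div_eq_mul_inv]
    fun_prop

/-- The derivative of `bspline ξ (p + 1) j` away from the knots, as a combination of B-splines of
degree `p`. -/
noncomputable def bsplineDeriv (ξ : ℕ → ℝ) (p j : ℕ) (x : ℝ) : ℝ :=
  ((p : ℝ) + 1) * (bspline ξ p j x / (ξ (j + p + 1) - ξ j)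
    - bspline ξ p (j + 1) x / (ξ (j + p + 2) - ξ (j + 1)))

lemma hasDerivAt_affine_mul_add_affine_mul {f g : ℝ → ℝ} {f' g' : ℝ} (a b c d : ℝ)
    (hf : HasDerivAt f f' x) (hg : HasDerivAt g g' x) :
    HasDerivAt (fun y => (y - a) / b * f y + (c - y) / d * g y)
      (f x / b - g x / d + ((x - a) / b * f' + (c - x) / d * g')) x := by
  refine (((((hasDerivAt_id x).sub_const a).div_const b).mul hf).add
    ((((hasDerivAt_id x).const_sub c).div_const d).mul hg)).congr_deriv ?_
  simp only [id]
  ring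

lemma div_self_mul_div_cancel {u v : ℝ} (w : ℝ) (h : v = 0 → u = 0) :
    v / v * (w / u) = w / u := by
  rcases eq_or_ne v 0 with hv | hv
  · simp [h hv]
  · rw [div_self hv, one_mul]

lemma bsplineDeriv_succ (h : SortedKnots ξ j (j + p + 3)) (x : ℝ) :
    bsplineDeriv ξ (p + 1) j x
      = bspline ξ (p + 1) j x / (ξ (j + p + 2) - ξ j)
        - bspline ξ (p + 1) (j + 1) x / (ξ (j + p + 3) - ξ (j + 1))
        + ((x - ξ j) / (ξ (j + p + 2) - ξ j) * bsplineDeriv ξ p j x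
          + (ξ (j + p + 3) - x) / (ξ (j + p + 3) - ξ (j + 1)) * bsplineDeriv ξ p (j + 1) x) := by
  have h₁ : ξ j ≤ ξ (j + 1) := h.le (by omega) (by omega) (by omega)
  have h₂ : ξ (j + 1) ≤ ξ (j + p + 2) := h.le (by omega) (by omega) (by omega)
  have h₃ : ξ (j + p + 2) ≤ ξ (j + p + 3) := h.le (by omega) (by omega) (by omega)
  have hleft := div_self_mul_div_cancel (u := ξ (j + p + 2) - ξ (j + 1))
    (v := ξ (j + p + 2) - ξ j) (bspline ξ p (j + 1) x) fun h0 => by linarith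
  have hright := div_self_mul_div_cancel (u := ξ (j + p + 2) - ξ (j + 1))
    (v := ξ (j + p + 3) - ξ (j + 1)) (bspline ξ p (j + 1) x) fun h0 => by linarith
  simp only [bsplineDeriv, bspline_succ, show j + (p + 1) + 1 = j + p + 2 by omega,
    show j + (p + 1) + 2 = j + p + 3 by omega, show j + 1 + p + 1 = j + p + 2 by omega,
    show j + 1 + p + 2 = j + p + 3 by omega, show j + 1 + 1 = j + 2 by omega]
  push_cast
  linear_combination ((p : ℝ) + 1) * hleft - ((p : ℝ) + 1) * hright

lemma hasDerivAt_bspline (h : SortedKnots ξ j (j + p + 2)) (hx : OffKnots ξ j (j + p + 2) x) :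
    HasDerivAt (bspline ξ (p + 1) j) (bsplineDeriv ξ p j x) x := by
  induction p generalizing j with
  | zero =>
    have hleft : HasDerivAt (bspline ξ 0 j) 0 x :=
      (hasDerivAt_const x _).congr_of_eventuallyEq
        (bspline_zero_eventuallyEq (hx.mono le_rfl (by omega)))
    have hright : HasDerivAt (bspline ξ 0 (j + 1)) 0 x :=
      (hasDerivAt_const x _).congr_of_eventuallyEq
        (bspline_zero_eventuallyEq (hx.mono (by omega) (by omega)))
    refine (hasDerivAt_affine_mul_add_affine_mul (ξ j) (ξ (j + 1) - ξ j) (ξ (j + 2))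
      (ξ (j + 2) - ξ (j + 1)) hleft hright).congr_deriv ?_
    simp [bsplineDeriv]
  | succ p ih =>
    have hleft := ih (h.mono le_rfl (by omega) : SortedKnots ξ j (j + p + 2))
      (hx.mono le_rfl (by omega))
    have hright := ih (h.mono (by omega) (by omega) : SortedKnots ξ (j + 1) (j + 1 + p + 2))
      (hx.mono (by omega) (by omega))
    rw [bsplineDeriv_succ h]
    exact hasDerivAt_affine_mul_add_affine_mul (ξ j) (ξ (j + p + 2) - ξ j) (ξ (j + p + 3))
      (ξ (j + p + 3) - ξ (j + 1)) hleft hright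

lemma iteratedDeriv_bsplineDeriv (hx : OffKnots ξ j (j + p + 2) x) (l : ℕ) :
    iteratedDeriv l (bsplineDeriv ξ p j) x
      = ((p : ℝ) + 1) * (iteratedDeriv l (bspline ξ p j) x / (ξ (j + p + 1) - ξ j)
        - iteratedDeriv l (bspline ξ p (j + 1)) x / (ξ (j + p + 2) - ξ (j + 1))) := by
  have hleft : ContDiffAt ℝ l (bspline ξ p j) x :=
    (contDiffAt_bspline (hx.mono le_rfl (by omega))).of_le (by exact_mod_cast le_top)
  have hright : ContDiffAt ℝ l (bspline ξ p (j + 1)) x :=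
    (contDiffAt_bspline (hx.mono (by omega) (by omega))).of_le (by exact_mod_cast le_top)
  rw [show bsplineDeriv ξ p j = fun y => ((p : ℝ) + 1) *
    ((fun y => bspline ξ p j y / (ξ (j + p + 1) - ξ j))
      - fun y => bspline ξ p (j + 1) y / (ξ (j + p + 2) - ξ (j + 1))) y from rfl,
    iteratedDeriv_const_mul_field, iteratedDeriv_sub (hleft.div_const _) (hright.div_const _),
    iteratedDeriv_div_const, iteratedDeriv_div_const]

lemma iteratedDeriv_succ_bspline (h : SortedKnots ξ j (j + p + 2))
    (hx : OffKnots ξ j (j + p + 2) x) (l : ℕ) :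
    iteratedDeriv (l + 1) (bspline ξ (p + 1) j) x
      = ((p : ℝ) + 1) * (iteratedDeriv l (bspline ξ p j) x / (ξ (j + p + 1) - ξ j)
        - iteratedDeriv l (bspline ξ p (j + 1)) x / (ξ (j + p + 2) - ξ (j + 1))) := by
  have hderiv : deriv (bspline ξ (p + 1) j) =ᶠ[𝓝 x] bsplineDeriv ξ p j := by
    filter_upwards [hx.eventually] with y hy using (hasDerivAt_bspline h hy).deriv
  rw [iteratedDeriv_succ', hderiv.iteratedDeriv_eq, iteratedDeriv_bsplineDeriv hx]

end BSpline

section DerivativeBound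

variable {ξ : ℕ → ℝ} {a b i p j : ℕ} {x : ℝ}

lemma SortedKnots.bspline_eventuallyEq_zero_of_mem_Ioo (h : SortedKnots ξ a b) (hai : a ≤ i)
    (hib : i + 1 ≤ b) (hx : x ∈ Ioo (ξ i) (ξ (i + 1))) (haj : a ≤ j) (hjb : j + p + 1 ≤ b)
    (hij : i < j ∨ j + p < i) : bspline ξ p j =ᶠ[𝓝 x] fun _ => 0 := by
  refine bspline_eventuallyEq_zero (h.mono haj hjb) (hij.imp (fun hlt => ?_) fun hlt => ?_)
  · exact hx.2.trans_le (h.le (by omega) hlt (by omega))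
  · exact (h.le (by omega) hlt (by omega)).trans_lt hx.1

lemma SortedKnots.abs_iteratedDeriv_bspline_div_mul_le (h : SortedKnots ξ a b) (hai : a ≤ i)
    (hib : i + 1 ≤ b) (hx : x ∈ Ioo (ξ i) (ξ (i + 1))) (haj : a ≤ j) (hjb : j + p + 1 ≤ b)
    (l : ℕ) :
    |iteratedDeriv l (bspline ξ p j) x / (ξ (j + p + 1) - ξ j)| * (ξ (i + 1) - ξ i)
      ≤ |iteratedDeriv l (bspline ξ p j) x| := by
  by_cases hij : i < j ∨ j + p < i
  · rw [(h.bspline_eventuallyEq_zero_of_mem_Ioo hai hib hx haj hjb hij).iteratedDeriv_eq]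
    simp
  · have hleft : ξ j ≤ ξ i := h.le haj (by omega) (by omega)
    have hright : ξ (i + 1) ≤ ξ (j + p + 1) := h.le (by omega) (by omega) hjb
    have hpos : 0 < ξ (j + p + 1) - ξ j := by linarith [hx.1, hx.2]
    rw [abs_div, abs_of_pos hpos, div_mul_eq_mul_div, div_le_iff₀ hpos]
    gcongr

lemma SortedKnots.abs_iteratedDeriv_bspline_mul_pow_le (h : SortedKnots ξ a b) (hai : a ≤ i)
    (hib : i + 1 ≤ b) (hx : x ∈ Ioo (ξ i) (ξ (i + 1))) (haj : a ≤ j) (hjb : j + p + 1 ≤ b)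
    (l : ℕ) :
    |iteratedDeriv l (bspline ξ p j) x| * (ξ (i + 1) - ξ i) ^ l ≤ 2 ^ p * (2 * (p : ℝ)) ^ l := by
  have hoff := h.offKnots_of_mem_Ioo hai hib hx
  have hδ : 0 < ξ (i + 1) - ξ i := by linarith [hx.1, hx.2]
  induction l generalizing p j with
  | zero => simpa using abs_bspline_le (h.mono haj hjb) x
  | succ l ih =>
    cases p with
    | zero =>
      rw [(bspline_zero_eventuallyEq (hoff.mono haj hjb)).iteratedDeriv_eq, iteratedDeriv_const]
      simp
    | succ p =>
      set δ := ξ (i + 1) - ξ i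
      have hterm : ∀ k, a ≤ k → k + p + 1 ≤ b →
          |iteratedDeriv l (bspline ξ p k) x / (ξ (k + p + 1) - ξ k)| * δ ^ (l + 1)
            ≤ 2 ^ p * (2 * (p : ℝ)) ^ l := by
        intro k hak hkb
        refine le_trans ?_ (ih hak hkb)
        rw [pow_succ', ← mul_assoc]
        gcongr
        exact h.abs_iteratedDeriv_bspline_div_mul_le hai hib hx hak hkb l
      have hleft := hterm j haj (by omega)
      have hright := hterm (j + 1) (by omega) (by omega)
      rw [show j + 1 + p + 1 = j + p + 2 by omega] at hright
      rw [iteratedDeriv_succ_bspline (h.mono haj hjb) (hoff.mono haj hjb), abs_mul,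
        abs_of_nonneg (by positivity)]
      set A := iteratedDeriv l (bspline ξ p j) x / (ξ (j + p + 1) - ξ j)
      set B := iteratedDeriv l (bspline ξ p (j + 1)) x / (ξ (j + p + 2) - ξ (j + 1))
      calc ((p : ℝ) + 1) * |A - B| * δ ^ (l + 1)
          ≤ ((p : ℝ) + 1) * (|A| + |B|) * δ ^ (l + 1) := by gcongr; exact abs_sub _ _
        _ = ((p : ℝ) + 1) * (|A| * δ ^ (l + 1) + |B| * δ ^ (l + 1)) := by ring
        _ ≤ ((p : ℝ) + 1) * (2 ^ p * (2 * (p : ℝ)) ^ l + 2 ^ p * (2 * (p : ℝ)) ^ l) := by gcongr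
        _ = 2 ^ (p + 1) * (2 * (p : ℝ)) ^ l * ((p : ℝ) + 1) := by ring
        _ ≤ 2 ^ (p + 1) * (2 * ((p : ℝ) + 1)) ^ l * (2 * ((p : ℝ) + 1)) := by
            gcongr <;> linarith
        _ = 2 ^ (p + 1) * (2 * ((p + 1 : ℕ) : ℝ)) ^ (l + 1) := by push_cast; ring

end DerivativeBound

/-! ### Continuity at multiple knots -/

section Continuity

variable {ξ : ℕ → ℝ} {p j : ℕ} {x : ℝ}

lemma bspline_eq_pow_of_left_eq (h : SortedKnots ξ j (j + p + 1)) (he : ξ j = ξ (j + p))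
    (hx : x ∈ Ico (ξ j) (ξ (j + p + 1))) :
    bspline ξ p j x = ((ξ (j + p + 1) - x) / (ξ (j + p + 1) - ξ j)) ^ p := by
  induction p generalizing j with
  | zero => rw [bspline_zero, indicator_of_mem hx, pow_zero]
  | succ p ih =>
    have hsucc : ξ (j + 1) = ξ j := le_antisymm
      ((h.le (by omega) (by omega) (by omega) : ξ (j + 1) ≤ ξ (j + (p + 1))).trans_eq he.symm)
      (h.le (by omega) (by omega) (by omega))
    have hright := ih (j := j + 1) (h.mono (by omega) (by omega))
      (by rw [hsucc, show j + 1 + p = j + (p + 1) by omega, he])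
      (by rw [hsucc, show j + 1 + p + 1 = j + (p + 1) + 1 by omega]; exact hx)
    rw [bspline_succ, hright, show ξ (j + p + 1) = ξ j from he.symm, hsucc,
      show j + 1 + p + 1 = j + p + 2 by omega, show j + (p + 1) + 1 = j + p + 2 by omega,
      sub_self, div_zero, zero_mul, zero_add, pow_succ']

lemma bspline_eq_pow_of_right_eq (h : SortedKnots ξ j (j + p + 1))
    (he : ξ (j + 1) = ξ (j + p + 1)) (hx : x ∈ Ico (ξ j) (ξ (j + p + 1))) :
    bspline ξ p j x = ((x - ξ j) / (ξ (j + p + 1) - ξ j)) ^ p := by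
  induction p with
  | zero => rw [bspline_zero, indicator_of_mem hx, pow_zero]
  | succ p ih =>
    have hpred : ξ (j + p + 1) = ξ (j + p + 2) := le_antisymm
      (h.le (by omega) (by omega) (by omega))
      (he.symm.trans_le (h.le (by omega) (by omega) (by omega)))
    have hleft := ih (h.mono (by omega) (by omega)) (by rw [hpred]; exact he)
      (by rw [hpred]; exact hx)
    rw [bspline_succ, hleft, hpred, show j + (p + 1) + 1 = j + p + 2 by omega,
      show ξ (j + 1) = ξ (j + p + 2) from he, sub_self, div_zero, zero_mul, add_zero, pow_succ']

lemma continuousAt_mul_of_bounded {f g : ℝ → ℝ} {C : ℝ} (hg : ∀ y, |g y| ≤ C)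
    (hf : ContinuousAt f x) (hx : f x = 0) : ContinuousAt (fun y => f y * g y) x := by
  have hlim : Tendsto (fun y => f y * g y) (𝓝 x) (𝓝 0) :=
    (hx ▸ hf.tendsto).zero_mul_isBoundedUnder_le
      (isBoundedUnder_of ⟨C, fun y => (Real.norm_eq_abs (g y)).trans_le (hg y)⟩)
  simpa [ContinuousAt, hx] using hlim

/-- If all the inner knots coincide with `x`, then near `x` the B-spline is a product of a power
rising to the value `1` on the left of `x` and a power descending from `1` on its right. -/
lemma continuousAt_bspline_of_inner_knots_eq (h : SortedKnots ξ j (j + p + 2))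
    (hfirst : ξ (j + 1) = x) (hlast : ξ (j + p + 1) = x) (hleft : ξ j < x)
    (hright : x < ξ (j + p + 2)) : ContinuousAt (bspline ξ (p + 1) j) x := by
  have hrise : SortedKnots ξ j (j + p + 1) := h.mono le_rfl (by omega)
  have hdescend : SortedKnots ξ (j + 1) (j + 1 + p + 1) := h.mono (by omega) (by omega)
  have hend : j + 1 + p + 1 = j + p + 2 := by omega
  set a := ξ j with ha
  set c := ξ (j + p + 2) with hc
  have hcont : Continuous fun y : ℝ =>
      (min ((y - a) / (x - a)) 1) ^ (p + 1) * (min ((c - y) / (c - x)) 1) ^ (p + 1) := by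
    fun_prop
  refine hcont.continuousAt.congr ?_
  filter_upwards [Ioo_mem_nhds hleft hright] with y hy
  rw [bspline_succ, hfirst, hlast, ← ha, ← hc]
  rcases lt_or_ge y x with hyx | hyx
  · rw [bspline_eq_pow_of_right_eq hrise (hfirst.trans hlast.symm) ⟨hy.1.le, by rwa [hlast]⟩,
      bspline_eq_zero_of_lt hdescend (by rwa [hfirst]), hlast, ← ha,
      min_eq_left (by rw [div_le_one (by linarith)]; linarith),
      min_eq_right (by rw [one_le_div (by linarith)]; linarith),
      one_pow, mul_one, mul_zero, add_zero, pow_succ']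
  · rw [bspline_eq_zero_of_ge hrise (by rwa [hlast]),
      bspline_eq_pow_of_left_eq hdescend
        (by rw [show j + 1 + p = j + p + 1 by omega, hfirst, hlast])
        ⟨by rwa [hfirst], by rw [hend]; exact hy.2⟩, hend, hfirst, ← hc,
      min_eq_right (by rw [one_le_div (by linarith)]; linarith),
      min_eq_left (by rw [div_le_one (by linarith)]; linarith),
      one_pow, one_mul, mul_zero, zero_add, pow_succ']

lemma continuousAt_bspline (h : SortedKnots ξ j (j + p + 1))
    (hleft : ¬ (ξ j = x ∧ ξ (j + p) = x)) (hright : ¬ (ξ (j + 1) = x ∧ ξ (j + p + 1) = x)) :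
    ContinuousAt (bspline ξ p j) x := by
  induction p generalizing j with
  | zero =>
    have hoff : OffKnots ξ j (j + 1) x := by
      rintro ⟨k, ⟨hjk, hkj⟩, hk⟩
      obtain rfl | rfl : k = j ∨ k = j + 1 := by omega
      exacts [hleft ⟨hk, hk⟩, hright ⟨hk, hk⟩]
    exact continuousAt_const.congr (bspline_zero_eventuallyEq hoff).symm
  | succ p ih =>
    have hS₁ : SortedKnots ξ j (j + p + 1) := h.mono le_rfl (by omega)
    have hS₂ : SortedKnots ξ (j + 1) (j + 1 + p + 1) := h.mono (by omega) (by omega)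
    by_cases hinner : ξ (j + 1) = x ∧ ξ (j + p + 1) = x
    · have hjx : ξ j ≤ x := (h.le le_rfl (by omega) (by omega)).trans_eq hinner.1
      have hxj : x ≤ ξ (j + p + 2) :=
        hinner.2.symm.trans_le (h.le (by omega) (by omega) (by omega))
      exact continuousAt_bspline_of_inner_knots_eq h hinner.1 hinner.2
        (hjx.lt_of_ne fun he => hleft ⟨he, hinner.2⟩)
        (hxj.lt_of_ne fun he => hright ⟨hinner.1, he.symm⟩)
    · have hterm₁ :
          ContinuousAt (fun y => (y - ξ j) / (ξ (j + p + 1) - ξ j) * bspline ξ p j y) x := by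
        by_cases hl : ξ j = x ∧ ξ (j + p) = x
        · exact continuousAt_mul_of_bounded (abs_bspline_le hS₁) (by fun_prop) (by simp [hl.1])
        · exact ContinuousAt.mul (by fun_prop) (ih hS₁ hl hinner)
      have hterm₂ : ContinuousAt (fun y => (ξ (j + p + 2) - y) / (ξ (j + p + 2) - ξ (j + 1))
          * bspline ξ p (j + 1) y) x := by
        by_cases hl : ξ (j + 1 + 1) = x ∧ ξ (j + 1 + p + 1) = x
        · exact continuousAt_mul_of_bounded (abs_bspline_le hS₂) (by fun_prop)
            (by rw [← hl.2, show j + 1 + p + 1 = j + p + 2 by omega, sub_self, zero_div])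
        · exact ContinuousAt.mul (by fun_prop)
            (ih hS₂ (by rwa [show j + 1 + p = j + p + 1 by omega]) hl)
      exact hterm₁.add hterm₂

end Continuity

/-! ### Marsden's identity -/

section Marsden

variable {ξ : ℕ → ℝ} {p n j : ℕ} {x : ℝ}

/-- The polynomial `(X - ξ_{j+1}) ⋯ (X - ξ_{j+p})`, whose roots are the inner knots of
`bspline ξ p j`. -/
noncomputable def innerKnotPoly (ξ : ℕ → ℝ) (p j : ℕ) : ℝ[X] :=
  ∏ k ∈ Finset.Icc 1 p, (X - C (ξ (j + k)))

lemma monic_innerKnotPoly (ξ : ℕ → ℝ) (p j : ℕ) : (innerKnotPoly ξ p j).Monic :=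
  monic_prod_of_monic _ _ fun _ _ => monic_X_sub_C _

lemma natDegree_innerKnotPoly (ξ : ℕ → ℝ) (p j : ℕ) : (innerKnotPoly ξ p j).natDegree = p := by
  rw [innerKnotPoly, natDegree_prod_of_monic _ _ fun _ _ => monic_X_sub_C _]
  simp

lemma innerKnotPoly_succ (ξ : ℕ → ℝ) (p j : ℕ) :
    innerKnotPoly ξ (p + 1) j = innerKnotPoly ξ p j * (X - C (ξ (j + p + 1))) :=
  Finset.prod_Icc_succ_top (by omega) _

lemma innerKnotPoly_succ' (ξ : ℕ → ℝ) (p j : ℕ) :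
    innerKnotPoly ξ (p + 1) j = (X - C (ξ (j + 1))) * innerKnotPoly ξ p (j + 1) := by
  induction p with
  | zero => simp [innerKnotPoly]
  | succ p ih =>
    rw [innerKnotPoly_succ, ih, innerKnotPoly_succ ξ p (j + 1), mul_assoc,
      show j + 1 + p + 1 = j + (p + 1) + 1 by omega]

lemma sum_bspline_zero (h : SortedKnots ξ 0 n) (hx : x ∈ Ico (ξ 0) (ξ n)) :
    ∑ j ∈ Finset.range n, bspline ξ 0 j x = 1 := by
  induction n with
  | zero => simp at hx
  | succ n ih =>
    rw [Finset.sum_range_succ]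
    rcases lt_or_ge x (ξ n) with hn | hn
    · rw [ih (h.mono le_rfl (by omega)) ⟨hx.1, hn⟩, bspline_zero,
        indicator_of_notMem (fun hmem => hn.not_ge hmem.1), add_zero]
    · rw [Finset.sum_eq_zero, bspline_zero, indicator_of_mem (mem_Ico.2 ⟨hn, hx.2⟩), zero_add]
      intro j hj
      rw [Finset.mem_range] at hj
      exact bspline_eq_zero_of_ge (h.mono (by omega) (by omega))
        ((h.le (by omega) (by omega) (by omega) : ξ (j + 0 + 1) ≤ ξ n).trans hn)

lemma affine_interpolation_mul {a b : ℝ} (x y β : ℝ) (hβ : β ≠ 0 → a < b) :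
    (y - b) * ((x - a) / (b - a) * β) + (y - a) * ((b - x) / (b - a) * β) = (y - x) * β := by
  rcases eq_or_ne β 0 with rfl | hne
  · simp
  · have hab : b - a ≠ 0 := (sub_pos.2 (hβ hne)).ne'
    field_simp
    ring

/-- Marsden's identity: expanding the B-splines of degree `p + 1` by the recursion, the two
multiples of each B-spline of degree `p` combine by linear interpolation. -/
theorem marsden_identity (h : SortedKnots ξ 0 (n + p)) (hx : x ∈ Ico (ξ p) (ξ n)) (y : ℝ) :
    ∑ j ∈ Finset.range n, (innerKnotPoly ξ p j).eval y * bspline ξ p j x = (y - x) ^ p := by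
  induction p generalizing n with
  | zero => simpa [innerKnotPoly] using sum_bspline_zero h hx
  | succ p ih =>
    have hn : ξ n ≤ ξ (n + 1) := h.le (by omega) (by omega) (by omega)
    have hp : ξ p ≤ ξ (p + 1) := h.le (by omega) (by omega) (by omega)
    have hfirst : bspline ξ p 0 x = 0 :=
      bspline_eq_zero_of_ge (h.mono (by omega) (by omega)) (by simpa using hx.1)
    have hlast : bspline ξ p n x = 0 := bspline_eq_zero_of_lt (h.mono (by omega) (by omega)) hx.2
    set P : ℕ → ℝ := fun j => (innerKnotPoly ξ p j).eval y with hP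
    set s : ℕ → ℝ := fun j => P j * ((y - ξ (j + p + 1)) *
      ((x - ξ j) / (ξ (j + p + 1) - ξ j) * bspline ξ p j x)) with hs
    set t : ℕ → ℝ := fun j => P j * ((y - ξ j) *
      ((ξ (j + p + 1) - x) / (ξ (j + p + 1) - ξ j) * bspline ξ p j x)) with ht
    have hrec : ∀ j, (innerKnotPoly ξ (p + 1) j).eval y * bspline ξ (p + 1) j x
        = s j + t (j + 1) := by
      intro j
      rw [bspline_succ, mul_add]
      congr 1
      · simp only [innerKnotPoly_succ, hs, hP, eval_mul, eval_sub, eval_X, eval_C]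
        ring
      · simp only [innerKnotPoly_succ', ht, hP, eval_mul, eval_sub, eval_X, eval_C,
          show j + 1 + p + 1 = j + p + 2 by omega]
        ring
    have hcombine : ∀ j ∈ Finset.range (n + 1), s j + t j = (y - x) * (P j * bspline ξ p j x) := by
      intro j hj
      rw [Finset.mem_range] at hj
      have hsupp : bspline ξ p j x ≠ 0 → ξ j < ξ (j + p + 1) := fun hne =>
        have hmem := mem_Ico_of_bspline_ne_zero (h.mono (by omega) (by omega)) hne
        hmem.1.trans_lt hmem.2
      rw [hs, ht, ← mul_add, affine_interpolation_mul x y _ hsupp]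
      ring
    calc ∑ j ∈ Finset.range n, (innerKnotPoly ξ (p + 1) j).eval y * bspline ξ (p + 1) j x
        = ∑ j ∈ Finset.range n, s j + ∑ j ∈ Finset.range n, t (j + 1) := by
          rw [← Finset.sum_add_distrib]
          exact Finset.sum_congr rfl fun j _ => hrec j
      _ = ∑ j ∈ Finset.range (n + 1), s j + ∑ j ∈ Finset.range (n + 1), t j := by
          rw [Finset.sum_range_succ s, Finset.sum_range_succ' t]
          simp [hs, ht, hfirst, hlast]
      _ = (y - x) * ∑ j ∈ Finset.range (n + 1), P j * bspline ξ p j x := by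
          rw [← Finset.sum_add_distrib, Finset.mul_sum]
          exact Finset.sum_congr rfl hcombine
      _ = (y - x) ^ (p + 1) := by
          rw [ih (h.mono le_rfl (by omega)) ⟨hp.trans hx.1, hx.2.trans_le hn⟩, pow_succ']

lemma sum_coeff_innerKnotPoly_mul_bspline (h : SortedKnots ξ 0 (n + p))
    (hx : x ∈ Ico (ξ p) (ξ n)) (m : ℕ) :
    ∑ j ∈ Finset.range n, (innerKnotPoly ξ p j).coeff m * bspline ξ p j x
      = (-x) ^ (p - m) * (p.choose m : ℝ) := by
  have hpoly : ∑ j ∈ Finset.range n, innerKnotPoly ξ p j * C (bspline ξ p j x)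
      = (X + C (-x)) ^ p := by
    refine Polynomial.funext fun y => ?_
    simpa [eval_finsetSum, ← sub_eq_add_neg] using marsden_identity h hx y
  have hcoeff := congrArg (coeff · m) hpoly
  simpa only [finsetSum_coeff, coeff_mul_C, coeff_X_add_C_pow] using hcoeff

lemma sum_bspline (h : SortedKnots ξ 0 (n + p)) (hx : x ∈ Ico (ξ p) (ξ n)) :
    ∑ j ∈ Finset.range n, bspline ξ p j x = 1 := by
  have hlead : ∀ j, (innerKnotPoly ξ p j).coeff p = 1 := fun j => by
    simpa [natDegree_innerKnotPoly] using (monic_innerKnotPoly ξ p j).coeff_natDegree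
  simpa [hlead] using sum_coeff_innerKnotPoly_mul_bspline h hx p

/-- The spline of degree `p` on the knots `ξ` with the B-spline coefficients `c 0, …, c (n - 1)`;
the other values of `c` do not matter. -/
noncomputable def spline (ξ : ℕ → ℝ) (p n : ℕ) (c : ℕ → ℝ) : ℝ → ℝ :=
  fun x => ∑ i ∈ Finset.range n, c i * bspline ξ p i x

lemma exists_spline_eq_pow (h : SortedKnots ξ 0 (n + p)) {m : ℕ} (hm : m ≤ p) :
    ∃ c : ℕ → ℝ, ∀ x ∈ Ico (ξ p) (ξ n), spline ξ p n c x = x ^ m := by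
  refine ⟨fun j => ((-1) ^ m / (p.choose m : ℝ)) * (innerKnotPoly ξ p j).coeff (p - m),
    fun x hx => ?_⟩
  have hchoose : (p.choose m : ℝ) ≠ 0 := by exact_mod_cast (Nat.choose_pos hm).ne'
  simp only [spline, mul_assoc]
  rw [← Finset.mul_sum, sum_coeff_innerKnotPoly_mul_bspline h hx, Nat.sub_sub_self hm,
    Nat.choose_symm hm, div_mul_eq_mul_div, div_eq_iff hchoose, ← mul_assoc, ← mul_pow,
    neg_one_mul, neg_neg]

lemma exists_spline_eq_eval (h : SortedKnots ξ 0 (n + p)) {q : ℝ[X]} (hq : q.natDegree ≤ p) :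
    ∃ c : ℕ → ℝ, ∀ x ∈ Ico (ξ p) (ξ n), spline ξ p n c x = q.eval x := by
  choose! c hc using fun m (hm : m ≤ p) => exists_spline_eq_pow h hm
  refine ⟨fun j => ∑ m ∈ Finset.range (p + 1), q.coeff m * c m j, fun x hx => ?_⟩
  simp only [spline, eval_eq_sum_range' (Nat.lt_succ_of_le hq), Finset.sum_mul, mul_assoc]
  rw [Finset.sum_comm]
  refine Finset.sum_congr rfl fun m hm => ?_
  rw [← Finset.mul_sum, ← hc m (Nat.lt_succ_iff.1 (Finset.mem_range.1 hm)) x hx, spline]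

end Marsden

/-! ### Integrals against B-splines -/

section Integration

variable {ξ : ℕ → ℝ} {p j : ℕ} {a b x : ℝ}

lemma integral_eq_intervalIntegral_of_eq_zero {f : ℝ → ℝ} (hab : a ≤ b)
    (hf : ∀ x ∉ Icc a b, f x = 0) : ∫ x, f x = ∫ x in a..b, f x := by
  rw [intervalIntegral.integral_of_le hab, ← integral_Icc_eq_integral_Ioc,
    setIntegral_eq_integral_of_forall_compl_eq_zero hf]

lemma integral_mul_eq_sub_of_hasDerivAt_off_countable {u u' v v' : ℝ → ℝ} (hab : a ≤ b)
    {s : Set ℝ} (hs : s.Countable) (hu : ContinuousOn u (Icc a b)) (hv : ContinuousOn v (Icc a b))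
    (huu' : ∀ x ∈ Ioo a b \ s, HasDerivAt u (u' x) x)
    (hvv' : ∀ x ∈ Ioo a b \ s, HasDerivAt v (v' x) x)
    (hu' : IntervalIntegrable u' volume a b) (hv' : IntervalIntegrable v' volume a b) :
    ∫ x in a..b, u x * v' x = u b * v b - u a * v a - ∫ x in a..b, u' x * v x := by
  have hu'v : IntervalIntegrable (fun x => u' x * v x) volume a b :=
    hu'.mul_continuousOn (by rwa [uIcc_of_le hab])
  have huv' : IntervalIntegrable (fun x => u x * v' x) volume a b :=
    hv'.continuousOn_mul (by rwa [uIcc_of_le hab])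
  have hFTC := integral_eq_of_hasDerivAt_off_countable_of_le (fun x => u x * v x)
    (fun x => u' x * v x + u x * v' x) hab hs (hu.mul hv)
    (fun x hx => (huu' x hx).mul (hvv' x hx)) (hu'v.add huv')
  rw [intervalIntegral.integral_add hu'v huv'] at hFTC
  linarith

lemma bspline_eq_zero_of_notMem_Icc (h : SortedKnots ξ j (j + p + 1))
    (hx : x ∉ Icc (ξ j) (ξ (j + p + 1))) : bspline ξ p j x = 0 := by
  by_contra hne
  exact hx (Ico_subset_Icc_self (mem_Ico_of_bspline_ne_zero h hne))

lemma bsplineDeriv_eq_zero_of_notMem_Icc (h : SortedKnots ξ j (j + p + 2))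
    (hx : x ∉ Icc (ξ j) (ξ (j + p + 2))) : bsplineDeriv ξ p j x = 0 := by
  have hleft : ξ j ≤ ξ (j + 1) := h.le (by omega) (by omega) (by omega)
  have hright : ξ (j + p + 1) ≤ ξ (j + p + 2) := h.le (by omega) (by omega) (by omega)
  rw [bsplineDeriv,
    bspline_eq_zero_of_notMem_Icc (h.mono le_rfl (by omega))
      (mt (fun hmem => Icc_subset_Icc_right hright hmem) hx),
    bspline_eq_zero_of_notMem_Icc (h.mono (by omega) (by omega))
      (mt (fun hmem => by
        rw [show j + 1 + p + 1 = j + p + 2 by omega] at hmem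
        exact Icc_subset_Icc_left hleft hmem) hx)]
  simp

lemma integrable_bspline_mul (h : SortedKnots ξ j (j + p + 1)) {f : ℝ → ℝ} (hf : Continuous f) :
    Integrable fun x => bspline ξ p j x * f x := by
  have hon : IntegrableOn (fun x => f x * bspline ξ p j x) (Icc (ξ j) (ξ (j + p + 1))) :=
    (hf.integrableOn_Icc).mul_bdd (measurable_bspline ξ p j).aestronglyMeasurable
      (ae_of_all _ fun x => (Real.norm_eq_abs _).trans_le (abs_bspline_le h x))
  simp only [mul_comm]
  refine (integrableOn_iff_integrable_of_support_subset fun x hx => ?_).1 hon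
  by_contra hmem
  exact hx (by simp [bspline_eq_zero_of_notMem_Icc h hmem])

lemma integrable_bspline (h : SortedKnots ξ j (j + p + 1)) : Integrable (bspline ξ p j) := by
  simpa using integrable_bspline_mul h (continuous_const (y := (1 : ℝ)))

lemma integrable_bsplineDeriv (h : SortedKnots ξ j (j + p + 2)) :
    Integrable (bsplineDeriv ξ p j) :=
  (((integrable_bspline (h.mono le_rfl (by omega))).div_const _).sub
    ((integrable_bspline (h.mono (by omega) (by omega))).div_const _)).const_mul _

lemma bspline_left_endpoint (h : SortedKnots ξ j (j + p + 1)) (hlt : ξ j < ξ (j + p)) :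
    bspline ξ p j (ξ j) = 0 := by
  induction p generalizing j with
  | zero => simp at hlt
  | succ p ih =>
    have hright : SortedKnots ξ (j + 1) (j + 1 + p + 1) := h.mono (by omega) (by omega)
    rw [bspline_succ, sub_self, zero_div, zero_mul, zero_add]
    rcases (h.le (by omega) (by omega) (by omega) : ξ j ≤ ξ (j + 1)).eq_or_lt with heq | hlt'
    · rw [heq, ih hright (by rwa [← heq, show j + 1 + p = j + (p + 1) by omega]), mul_zero]
    · rw [bspline_eq_zero_of_lt hright hlt', mul_zero]

/-- A B-spline jumps at an end point of its support precisely where that knot has full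
multiplicity; `u` is its continuous extension from the inside. -/
lemma exists_continuousOn_eqOn_bspline (h : SortedKnots ξ j (j + p + 2))
    (hlt : ξ j < ξ (j + p + 2)) :
    ∃ u : ℝ → ℝ, ContinuousOn u (Icc (ξ j) (ξ (j + p + 2))) ∧
      EqOn u (bspline ξ (p + 1) j) (Ioo (ξ j) (ξ (j + p + 2))) ∧
      u (ξ j) = (if ξ j = ξ (j + p + 1) then 1 else 0) ∧
      u (ξ (j + p + 2)) = (if ξ (j + 1) = ξ (j + p + 2) then 1 else 0) := by
  have hinner : ξ (j + 1) ≤ ξ (j + p + 1) := h.le (by omega) (by omega) (by omega)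
  have hne : ξ (j + p + 2) - ξ j ≠ 0 := (sub_pos.2 hlt).ne'
  by_cases hleft : ξ j = ξ (j + p + 1)
  · refine ⟨fun x => ((ξ (j + p + 2) - x) / (ξ (j + p + 2) - ξ j)) ^ (p + 1),
      by fun_prop, fun x hx => (bspline_eq_pow_of_left_eq h hleft ⟨hx.1.le, hx.2⟩).symm, ?_, ?_⟩
    · simp [hleft.symm, hne]
    · rw [if_neg (by linarith)]
      simp
  by_cases hright : ξ (j + 1) = ξ (j + p + 2)
  · refine ⟨fun x => ((x - ξ j) / (ξ (j + p + 2) - ξ j)) ^ (p + 1),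
      by fun_prop, fun x hx => (bspline_eq_pow_of_right_eq h hright ⟨hx.1.le, hx.2⟩).symm, ?_, ?_⟩
    · simp [hleft]
    · simp [hright, hne]
  · have hfirst : ξ j ≤ ξ (j + p + 1) := h.le (by omega) (by omega) (by omega)
    refine ⟨bspline ξ (p + 1) j, fun x _ => ContinuousAt.continuousWithinAt ?_, fun x _ => rfl,
      ?_, ?_⟩
    · exact continuousAt_bspline h (fun hx => hleft (hx.1.trans hx.2.symm))
        (fun hx => hright (hx.1.trans hx.2.symm))
    · rw [if_neg hleft, bspline_left_endpoint h (hfirst.lt_of_ne hleft)]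
    · rw [if_neg hright]
      exact bspline_eq_zero_of_ge h le_rfl

lemma integral_bspline_mul_deriv (h : SortedKnots ξ j (j + p + 2)) (hlt : ξ j < ξ (j + p + 2))
    {F F' : ℝ → ℝ} (hF : Continuous F) {S : Set ℝ} (hS : S.Finite)
    (hderiv : ∀ x ∉ S, HasDerivAt F (F' x) x) (hF' : ∀ a b, IntervalIntegrable F' volume a b) :
    ∫ x, bspline ξ (p + 1) j x * F' x
      = (if ξ (j + 1) = ξ (j + p + 2) then F (ξ (j + p + 2)) else 0)
        - (if ξ j = ξ (j + p + 1) then F (ξ j) else 0) - ∫ x, bsplineDeriv ξ p j x * F x := by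
  obtain ⟨u, hu, heq, hua, hub⟩ := exists_continuousOn_eqOn_bspline h hlt
  have hu' : ∀ x ∈ Ioo (ξ j) (ξ (j + p + 2)) \ (S ∪ ξ '' Icc j (j + p + 2)),
      HasDerivAt u (bsplineDeriv ξ p j x) x := fun x hx =>
    (hasDerivAt_bspline h fun hmem => hx.2 (Or.inr hmem)).congr_of_eventuallyEq
      (eventuallyEq_of_mem (Ioo_mem_nhds hx.1.1 hx.1.2) heq)
  have hparts := integral_mul_eq_sub_of_hasDerivAt_off_countable hlt.le
    (hS.union (finite_knots ξ j (j + p + 2))).countable hu hF.continuousOn hu'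
    (fun x hx => hderiv x fun hmem => hx.2 (Or.inl hmem))
    (integrable_bsplineDeriv h).intervalIntegrable (hF' _ _)
  simp only [hua, hub, ite_mul, one_mul, zero_mul] at hparts
  rw [integral_eq_intervalIntegral_of_eq_zero hlt.le fun x hx => by
      rw [bspline_eq_zero_of_notMem_Icc h hx, zero_mul],
    integral_eq_intervalIntegral_of_eq_zero hlt.le fun x hx => by
      rw [bsplineDeriv_eq_zero_of_notMem_Icc h hx, zero_mul], ← hparts]
  exact intervalIntegral.integral_congr_Ioo_of_le hlt.le fun x hx => by simp only [heq hx]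

lemma integral_bsplineDeriv_mul (h : SortedKnots ξ j (j + p + 2)) {F : ℝ → ℝ}
    (hF : Continuous F) :
    ∫ x, bsplineDeriv ξ p j x * F x = ((p : ℝ) + 1) *
      ((∫ x, bspline ξ p j x * F x) / (ξ (j + p + 1) - ξ j)
        - (∫ x, bspline ξ p (j + 1) x * F x) / (ξ (j + p + 2) - ξ (j + 1))) := by
  have hleft := integrable_bspline_mul (h.mono le_rfl (by omega) : SortedKnots ξ j (j + p + 1)) hF
  have hright := integrable_bspline_mul
    (h.mono (by omega) (by omega) : SortedKnots ξ (j + 1) (j + 1 + p + 1)) hF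
  rw [← integral_div, ← integral_div, ← integral_sub (hleft.div_const _) (hright.div_const _),
    ← integral_const_mul]
  refine integral_congr_ae (ae_of_all _ fun x => ?_)
  simp only [bsplineDeriv]
  ring

lemma integral_bsplineDeriv_mul_sub (h : SortedKnots ξ j (j + p + 2)) :
    ∫ x, bsplineDeriv ξ p j x * (x - ξ j) = ((p : ℝ) + 1) * ((∫ x, bspline ξ (p + 1) j x)
      - (ξ (j + p + 2) - ξ j) / (ξ (j + p + 2) - ξ (j + 1)) * ∫ x, bspline ξ p (j + 1) x) := by
  have hright : SortedKnots ξ (j + 1) (j + 1 + p + 1) := h.mono (by omega) (by omega)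
  rw [← integral_const_mul ((ξ (j + p + 2) - ξ j) / _),
    ← integral_sub (integrable_bspline h) ((integrable_bspline hright).const_mul _),
    ← integral_const_mul]
  refine integral_congr_ae (ae_of_all _ fun x => ?_)
  simp only [bsplineDeriv, bspline_succ]
  ring

lemma integral_bspline (h : SortedKnots ξ j (j + p + 1)) :
    ∫ x, bspline ξ p j x = (ξ (j + p + 1) - ξ j) / ((p : ℝ) + 1) := by
  induction p generalizing j with
  | zero =>
    have hle : ξ j ≤ ξ (j + 1) := h.le le_rfl (by omega) le_rfl
    simp only [bspline_zero]
    rw [integral_indicator measurableSet_Ico]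
    simp [hle]
  | succ p ih =>
    rw [show j + (p + 1) + 1 = j + p + 2 by omega]
    rcases (h.le le_rfl (by omega) le_rfl : ξ j ≤ ξ (j + p + 2)).eq_or_lt with heq | hlt
    · simp [bspline_eq_zero_of_knots_eq h heq, heq]
    have hright := ih (j := j + 1) (h.mono (by omega) (by omega))
    rw [show j + 1 + p + 1 = j + p + 2 by omega] at hright
    have hparts := integral_bspline_mul_deriv h hlt (F := fun x => x - ξ j) (F' := fun _ => 1)
      (by fun_prop) finite_empty (fun x _ => (hasDerivAt_id x).sub_const _)
      (fun _ _ => intervalIntegrable_const)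
    simp only [sub_self, ite_self, sub_zero, mul_one] at hparts
    rw [integral_bsplineDeriv_mul_sub h, hright] at hparts
    push_cast
    rw [eq_div_iff (by positivity : (p : ℝ) + 1 + 1 ≠ 0)]
    by_cases hlast : ξ (j + 1) = ξ (j + p + 2)
    · simp only [hlast, if_true, sub_self, div_zero, zero_mul, sub_zero] at hparts
      linarith
    · have hne : ξ (j + p + 2) - ξ (j + 1) ≠ 0 := sub_ne_zero.2 (Ne.symm hlast)
      rw [if_neg hlast] at hparts
      field_simp at hparts
      linarith

end Integration

/-! ### Divided differences -/

section DividedDifference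

variable {ξ : ℕ → ℝ} {p i : ℕ} {f : ℝ → ℝ}

/-- `f` is of class `C^p`, and of class `C^(p+1)` off a finite set, with a locally integrable
derivative of order `p + 1`: the regularity of the kernels `ψ_j`, sufficient to integrate `p + 1`
times by parts against a B-spline of degree `p`. -/
structure PiecewiseSmooth (p : ℕ) (f : ℝ → ℝ) : Prop where
  contDiff : ContDiff ℝ p f
  exists_finite : ∃ S : Set ℝ, S.Finite ∧ ∀ x ∉ S, ContDiffAt ℝ (p + 1 : ℕ) f x
  intervalIntegrable : ∀ a b, IntervalIntegrable (iteratedDeriv (p + 1) f) volume a b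

lemma piecewiseSmooth_of_contDiff (hf : ContDiff ℝ (p + 1 : ℕ) f) : PiecewiseSmooth p f where
  contDiff := hf.of_le (by exact_mod_cast Nat.le_succ p)
  exists_finite := ⟨∅, finite_empty, fun _ _ => hf.contDiffAt⟩
  intervalIntegrable a b := (hf.continuous_iteratedDeriv (p + 1) le_rfl).intervalIntegrable a b

lemma PiecewiseSmooth.sub {g : ℝ → ℝ} (hf : PiecewiseSmooth p f) (hg : PiecewiseSmooth p g) :
    PiecewiseSmooth p (f - g) := by
  obtain ⟨S, hS, hfS⟩ := hf.exists_finite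
  obtain ⟨T, hT, hgT⟩ := hg.exists_finite
  refine ⟨hf.contDiff.sub hg.contDiff, ⟨S ∪ T, hS.union hT, fun x hx =>
    (hfS x fun h => hx (Or.inl h)).sub (hgT x fun h => hx (Or.inr h))⟩, fun a b => ?_⟩
  refine ((hf.intervalIntegrable a b).sub (hg.intervalIntegrable a b)).congr_ae
    (ae_restrict_of_ae ?_)
  filter_upwards [hS.countable.ae_notMem volume, hT.countable.ae_notMem volume] with x hxS hxT
  exact (iteratedDeriv_sub (hfS x hxS) (hgT x hxT)).symm

lemma hasDerivAt_iteratedDeriv {x : ℝ} (hf : ContDiffAt ℝ (p + 1 : ℕ) f x) :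
    HasDerivAt (iteratedDeriv p f) (iteratedDeriv (p + 1) f x) x := by
  have hdiff := (contDiffWithinAt_univ.2 hf).differentiableWithinAt_iteratedDerivWithin
    (m := p) (by exact_mod_cast Nat.lt_succ_self p) (by simp [uniqueDiffOn_univ])
  rw [iteratedDerivWithin_univ, differentiableWithinAt_univ] at hdiff
  rw [iteratedDeriv_succ]
  exact hdiff.hasDerivAt

lemma PiecewiseSmooth.exists_finite_hasDerivAt (hf : PiecewiseSmooth p f) :
    ∃ S : Set ℝ, S.Finite ∧
      ∀ x ∉ S, HasDerivAt (iteratedDeriv p f) (iteratedDeriv (p + 1) f x) x :=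
  let ⟨S, hS, hfS⟩ := hf.exists_finite
  ⟨S, hS, fun x hx => hasDerivAt_iteratedDeriv (hfS x hx)⟩

lemma integral_bspline_zero_mul_deriv (h : SortedKnots ξ i (i + 1)) (hf : PiecewiseSmooth 0 f) :
    ∫ x, bspline ξ 0 i x * iteratedDeriv 1 f x = f (ξ (i + 1)) - f (ξ i) := by
  have hle : ξ i ≤ ξ (i + 1) := h.le le_rfl (by omega) le_rfl
  obtain ⟨S, hS, hderiv⟩ := hf.exists_finite_hasDerivAt
  rw [iteratedDeriv_zero] at hderiv
  rw [integral_eq_intervalIntegral_of_eq_zero hle fun x hx => by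
      rw [bspline_eq_zero_of_notMem_Icc h hx, zero_mul],
    ← integral_eq_of_hasDerivAt_off_countable_of_le f _ hle hS.countable
      hf.contDiff.continuous.continuousOn (fun x hx => hderiv x hx.2) (hf.intervalIntegrable _ _)]
  refine intervalIntegral.integral_congr_Ioo_of_le hle fun x hx => ?_
  simp only [bspline_zero, indicator_of_mem (Ioo_subset_Ico_self hx), one_mul, zero_add]

/-- The integral is a multiple of the divided difference of `f` at `ξ_i, …, ξ_{i+p+1}`. -/
lemma integral_bspline_mul_iteratedDeriv_eq_zero (h : SortedKnots ξ i (i + p + 1))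
    (hf : PiecewiseSmooth p f)
    (hzero : ∀ a m, i ≤ a → a + m ≤ i + p + 1 → m ≤ p → ξ a = ξ (a + m) →
      iteratedDeriv m f (ξ a) = 0) :
    ∫ x, bspline ξ p i x * iteratedDeriv (p + 1) f x = 0 := by
  induction p generalizing i with
  | zero =>
    have hleft := hzero i 0 le_rfl (by omega) le_rfl rfl
    have hright := hzero (i + 1) 0 (by omega) (by omega) le_rfl rfl
    rw [iteratedDeriv_zero] at hleft hright
    rw [zero_add, integral_bspline_zero_mul_deriv h hf, hleft, hright, sub_zero]
  | succ p ih =>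
    rcases (h.le le_rfl (by omega) le_rfl : ξ i ≤ ξ (i + p + 2)).eq_or_lt with heq | hlt
    · simp [bspline_eq_zero_of_knots_eq h heq]
    obtain ⟨S, hS, hderiv⟩ := hf.exists_finite_hasDerivAt
    have hcont := hf.contDiff.continuous_iteratedDeriv (p + 1) le_rfl
    have hleft : ∫ x, bspline ξ p i x * iteratedDeriv (p + 1) f x = 0 :=
      ih (h.mono le_rfl (by omega)) (piecewiseSmooth_of_contDiff hf.contDiff)
        fun a m ha ham hm => hzero a m ha (by omega) (by omega)
    have hright : ∫ x, bspline ξ p (i + 1) x * iteratedDeriv (p + 1) f x = 0 :=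
      ih (h.mono (by omega) (by omega)) (piecewiseSmooth_of_contDiff hf.contDiff)
        fun a m ha ham hm => hzero a m (by omega) (by omega) (by omega)
    have hfirst : ξ i = ξ (i + p + 1) → iteratedDeriv (p + 1) f (ξ i) = 0 :=
      hzero i (p + 1) le_rfl (by omega) le_rfl
    have hlast : ξ (i + 1) = ξ (i + p + 2) → iteratedDeriv (p + 1) f (ξ (i + p + 2)) = 0 :=
      fun he => he ▸ hzero (i + 1) (p + 1) (by omega) (by omega) le_rfl
        (by rw [he, show i + 1 + (p + 1) = i + p + 2 by omega])
    rw [integral_bspline_mul_deriv h hlt hcont hS hderiv hf.intervalIntegrable,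
      integral_bsplineDeriv_mul h hcont, hleft, hright, ite_eq_right_iff.2 hlast,
      ite_eq_right_iff.2 hfirst]
    simp

end DividedDifference

/-! ### Smoothness across simple knots -/

section SimpleKnots

variable {ξ : ℕ → ℝ} {p j : ℕ} {x : ℝ}

lemma hasDerivAt_of_eventually_ne {f g : ℝ → ℝ} (hderiv : ∀ᶠ y in 𝓝[≠] x, HasDerivAt f (g y) y)
    (hf : ContinuousAt f x) (hg : ContinuousAt g x) : HasDerivAt f (g x) x := by
  have hdiff : DifferentiableOn ℝ f {y | HasDerivAt f (g y) y} := fun y hy =>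
    (HasDerivAt.differentiableAt hy).differentiableWithinAt
  have hlim : Tendsto (deriv f) (𝓝[≠] x) (𝓝 (g x)) :=
    (hg.tendsto.mono_left nhdsWithin_le_nhds).congr' (hderiv.mono fun y hy => hy.deriv.symm)
  have hright := hasDerivWithinAt_Ici_of_tendsto_deriv hdiff hf.continuousWithinAt
    (nhdsGT_le_nhdsNE x hderiv) (hlim.mono_left (nhdsGT_le_nhdsNE x))
  have hleft := hasDerivWithinAt_Iic_of_tendsto_deriv hdiff hf.continuousWithinAt
    (nhdsLT_le_nhdsNE x hderiv) (hlim.mono_left (nhdsLT_le_nhdsNE x))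
  simpa using hleft.union hright

lemma eventually_nhdsNE_offKnots (ξ : ℕ → ℝ) (a b : ℕ) (x : ℝ) :
    ∀ᶠ y in 𝓝[≠] x, OffKnots ξ a b y :=
  nhdsNE_le_cofinite x (finite_knots ξ a b).eventually_cofinite_notMem

lemma hasDerivAt_bspline_of_continuousAt (h : SortedKnots ξ j (j + p + 2))
    (hcont : ContinuousAt (bspline ξ (p + 1) j) x) (hleft : ContinuousAt (bspline ξ p j) x)
    (hright : ContinuousAt (bspline ξ p (j + 1)) x) :
    HasDerivAt (bspline ξ (p + 1) j) (bsplineDeriv ξ p j x) x :=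
  hasDerivAt_of_eventually_ne
    ((eventually_nhdsNE_offKnots ξ j (j + p + 2) x).mono fun _ hy => hasDerivAt_bspline h hy)
    hcont (continuousAt_const.mul ((hleft.div_const _).sub (hright.div_const _)))

lemma continuous_bspline_of_strictMonoOn (h : StrictMonoOn ξ (Icc j (j + p + 2))) :
    Continuous (bspline ξ (p + 1) j) := by
  refine continuous_iff_continuousAt.2 fun x => continuousAt_bspline h.monotoneOn ?_ ?_
  · rintro ⟨hfirst, hlast⟩
    exact (h ⟨le_rfl, by omega⟩ ⟨by omega, by omega⟩ (by omega : j < j + (p + 1))).ne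
      (hfirst.trans hlast.symm)
  · rintro ⟨hfirst, hlast⟩
    exact (h ⟨by omega, by omega⟩ ⟨by omega, le_rfl⟩ (by omega : j + 1 < j + (p + 1) + 1)).ne
      (hfirst.trans hlast.symm)

lemma contDiff_bspline_of_strictMonoOn (h : StrictMonoOn ξ (Icc j (j + p + 2))) :
    ContDiff ℝ p (bspline ξ (p + 1) j) := by
  induction p generalizing j with
  | zero => exact_mod_cast contDiff_zero.2 (continuous_bspline_of_strictMonoOn h)
  | succ p ih =>
    have hleft : StrictMonoOn ξ (Icc j (j + p + 2)) :=
      h.mono (Icc_subset_Icc le_rfl (by omega))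
    have hright : StrictMonoOn ξ (Icc (j + 1) (j + 1 + p + 2)) :=
      h.mono (Icc_subset_Icc (by omega) (by omega))
    have hderiv : ∀ x, HasDerivAt (bspline ξ (p + 2) j) (bsplineDeriv ξ (p + 1) j x) x :=
      fun x => hasDerivAt_bspline_of_continuousAt h.monotoneOn
        (continuous_bspline_of_strictMonoOn h).continuousAt
        (continuous_bspline_of_strictMonoOn hleft).continuousAt
        (continuous_bspline_of_strictMonoOn hright).continuousAt
    push_cast
    refine contDiff_succ_iff_deriv.2 ⟨fun x => (hderiv x).differentiableAt, by simp, ?_⟩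
    rw [funext fun x => (hderiv x).deriv]
    exact contDiff_const.mul (((ih hleft).div_const _).sub ((ih hright).div_const _))

lemma exists_abs_iteratedDeriv_bspline_le (h : SortedKnots ξ j (j + p + 1)) (l : ℕ) :
    ∃ C, ∀ x, OffKnots ξ j (j + p + 1) x → |iteratedDeriv l (bspline ξ p j) x| ≤ C := by
  induction l generalizing p j with
  | zero => exact ⟨2 ^ p, fun x _ => by rw [iteratedDeriv_zero]; exact abs_bspline_le h x⟩
  | succ l ih =>
    cases p with
    | zero =>
      refine ⟨0, fun x hx => ?_⟩
      rw [(bspline_zero_eventuallyEq hx).iteratedDeriv_eq, iteratedDeriv_const,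
        if_neg l.succ_ne_zero, abs_zero]
    | succ p =>
      obtain ⟨C, hC⟩ := ih (h.mono le_rfl (by omega) : SortedKnots ξ j (j + p + 1))
      obtain ⟨D, hD⟩ := ih (h.mono (by omega) (by omega) : SortedKnots ξ (j + 1) (j + 1 + p + 1))
      refine ⟨(p + 1) * (C / |ξ (j + p + 1) - ξ j| + D / |ξ (j + p + 2) - ξ (j + 1)|),
        fun x hx => ?_⟩
      have hCx := hC x (hx.mono le_rfl (by omega))
      have hDx := hD x (hx.mono (by omega) (by omega))
      rw [iteratedDeriv_succ_bspline h hx, abs_mul, abs_of_nonneg (by positivity : (0 : ℝ) ≤ p + 1)]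
      gcongr
      refine (abs_sub _ _).trans ?_
      rw [abs_div, abs_div]
      gcongr

end SimpleKnots

/-! ### The transition function -/

section Transition

variable {p : ℕ} {x : ℝ}

lemma strictMonoOn_perfectKnot (p : ℕ) : StrictMonoOn (perfectKnot p) (Icc 0 (p + 1)) := by
  have hp : (0 : ℝ) < p + 1 := by positivity
  have hangle : ∀ k ∈ Icc 0 (p + 1), ((p : ℝ) + 1 - k) * Real.pi / (p + 1) ∈ Icc 0 Real.pi := by
    intro k hk
    have hk' : (0 : ℝ) ≤ p + 1 - k := sub_nonneg.2 (by exact_mod_cast hk.2)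
    refine ⟨by positivity, ?_⟩
    rw [div_le_iff₀ hp, mul_comm Real.pi]
    gcongr
    linarith [(k.cast_nonneg : (0 : ℝ) ≤ k)]
  intro k hk l hl hkl
  refine Real.strictAntiOn_cos (hangle l hl) (hangle k hk) ?_
  have := Real.pi_pos
  gcongr

lemma sortedKnots_perfectKnot (p : ℕ) : SortedKnots (perfectKnot p) 0 (0 + p + 1) := by
  rw [zero_add]
  exact (strictMonoOn_perfectKnot p).monotoneOn

lemma perfectKnot_zero (p : ℕ) : perfectKnot p 0 = -1 := by
  have hp : (p : ℝ) + 1 ≠ 0 := by positivity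
  simp [perfectKnot, hp]

lemma perfectKnot_last (p : ℕ) : perfectKnot p (p + 1) = 1 := by
  simp [perfectKnot]

lemma bspline_perfectKnot_eq_zero (hx : x ∉ Icc (-1) 1) : bspline (perfectKnot p) p 0 x = 0 :=
  bspline_eq_zero_of_notMem_Icc (sortedKnots_perfectKnot p) (by
    rwa [zero_add, perfectKnot_zero, perfectKnot_last])

lemma transition_of_le (hx : x ≤ -1) : transition p x = 0 := by
  rw [transition, intervalIntegral.integral_symm, neg_eq_zero,
    intervalIntegral.integral_congr_Ioo_of_le (g := fun _ => 0) hx fun t ht => by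
      simp only [bspline_perfectKnot_eq_zero (p := p) fun hmem => ht.2.not_ge hmem.1, mul_zero],
    intervalIntegral.integral_zero]

lemma transition_of_ge (hx : 1 ≤ x) : transition p x = 1 := by
  rw [transition, intervalIntegral.integral_const_mul, ← integral_eq_intervalIntegral_of_eq_zero
      (by linarith) fun t ht =>
        bspline_perfectKnot_eq_zero fun hmem => ht ⟨hmem.1, hmem.2.trans hx⟩,
    integral_bspline (sortedKnots_perfectKnot p), zero_add, perfectKnot_last, perfectKnot_zero]
  have hp : (p : ℝ) + 1 ≠ 0 := by positivity
  field_simp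
  norm_num

lemma continuous_transition (p : ℕ) : Continuous (transition p) :=
  intervalIntegral.continuous_primitive
    (fun _ _ => ((integrable_bspline (sortedKnots_perfectKnot p)).const_mul _).intervalIntegrable) _

lemma hasDerivAt_transition (hx : ContinuousAt (bspline (perfectKnot p) p 0) x) :
    HasDerivAt (transition p) (((p : ℝ) + 1) / 2 * bspline (perfectKnot p) p 0 x) x :=
  intervalIntegral.integral_hasDerivAt_right
    ((integrable_bspline (sortedKnots_perfectKnot p)).const_mul _).intervalIntegrable
    ((measurable_bspline _ _ _).const_mul _).stronglyMeasurable.stronglyMeasurableAtFilter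
    (continuousAt_const.mul hx)

lemma contDiff_transition (p : ℕ) : ContDiff ℝ p (transition p) := by
  cases p with
  | zero => exact_mod_cast contDiff_zero.2 (continuous_transition 0)
  | succ p =>
    have hknots : StrictMonoOn (perfectKnot (p + 1)) (Icc 0 (0 + p + 2)) := by
      rw [zero_add]
      exact strictMonoOn_perfectKnot (p + 1)
    have hderiv := fun x =>
      hasDerivAt_transition ((continuous_bspline_of_strictMonoOn hknots).continuousAt (x := x))
    push_cast
    refine contDiff_succ_iff_deriv.2 ⟨fun x => (hderiv x).differentiableAt, by simp, ?_⟩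
    rw [funext fun x => (hderiv x).deriv]
    exact contDiff_const.mul (contDiff_bspline_of_strictMonoOn hknots)

lemma hasDerivAt_transition_of_offKnots (hx : OffKnots (perfectKnot p) 0 (p + 1) x) :
    HasDerivAt (transition p) (((p : ℝ) + 1) / 2 * bspline (perfectKnot p) p 0 x) x :=
  hasDerivAt_transition (contDiffAt_bspline (by rwa [zero_add])).continuousAt

lemma contDiffAt_transition (hx : OffKnots (perfectKnot p) 0 (p + 1) x) :
    ContDiffAt ℝ ∞ (transition p) x := by
  have hopen : IsOpen {y | OffKnots (perfectKnot p) 0 (p + 1) y} :=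
    (finite_knots (perfectKnot p) 0 (p + 1)).isClosed.isOpen_compl
  refine ((contDiffOn_infty_iff_deriv_of_isOpen hopen).2 ⟨fun y hy =>
    (hasDerivAt_transition_of_offKnots hy).differentiableAt.differentiableWithinAt, fun y hy => ?_⟩)
    |>.contDiffAt (hopen.mem_nhds hx)
  have hbspline : ContDiffAt ℝ ∞ (bspline (perfectKnot p) p 0) y :=
    contDiffAt_bspline (by rwa [zero_add])
  exact ((contDiffAt_const.mul hbspline).congr_of_eventuallyEq ((hopen.eventually_mem hy).mono
    fun _ hz => (hasDerivAt_transition_of_offKnots hz).deriv)).contDiffWithinAt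

lemma iteratedDeriv_succ_transition (hx : OffKnots (perfectKnot p) 0 (p + 1) x) (k : ℕ) :
    iteratedDeriv (k + 1) (transition p) x
      = ((p : ℝ) + 1) / 2 * iteratedDeriv k (bspline (perfectKnot p) p 0) x := by
  have hderiv : deriv (transition p) =ᶠ[𝓝 x] fun y =>
      ((p : ℝ) + 1) / 2 * bspline (perfectKnot p) p 0 y :=
    hx.eventually.mono fun _ hy => (hasDerivAt_transition_of_offKnots hy).deriv
  rw [iteratedDeriv_succ', hderiv.iteratedDeriv_eq, iteratedDeriv_const_mul_field]

lemma exists_abs_transition_le (p : ℕ) : ∃ C, ∀ x, |transition p x| ≤ C := by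
  have hint : Integrable fun t => ((p : ℝ) + 1) / 2 * bspline (perfectKnot p) p 0 t :=
    (integrable_bspline (sortedKnots_perfectKnot p)).const_mul _
  exact ⟨_, fun x => (intervalIntegral.norm_integral_le_integral_norm_uIoc).trans
    (setIntegral_le_integral hint.norm (ae_of_all _ fun _ => norm_nonneg _))⟩

lemma exists_abs_iteratedDeriv_transition_le (p m : ℕ) : ∃ C, ∀ k ≤ m, ∀ x,
    OffKnots (perfectKnot p) 0 (p + 1) x → |iteratedDeriv k (transition p) x| ≤ C := by
  induction m with
  | zero =>
    obtain ⟨C, hC⟩ := exists_abs_transition_le p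
    exact ⟨C, fun k hk x _ => by rw [Nat.le_zero.1 hk, iteratedDeriv_zero]; exact hC x⟩
  | succ m ih =>
    obtain ⟨C, hC⟩ := ih
    obtain ⟨D, hD⟩ := exists_abs_iteratedDeriv_bspline_le (sortedKnots_perfectKnot p) m
    refine ⟨max C (((p : ℝ) + 1) / 2 * D), fun k hk x hx => ?_⟩
    rcases Nat.le_succ_iff.1 hk with hkm | rfl
    · exact (hC k hkm x hx).trans (le_max_left _ _)
    · rw [iteratedDeriv_succ_transition hx, abs_mul, abs_of_nonneg (by positivity)]
      exact (mul_le_mul_of_nonneg_left (hD x (by rwa [zero_add])) (by positivity)).trans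
        (le_max_right _ _)

end Transition

/-! ### The dual kernels -/

section Leibniz

variable {f g : ℝ → ℝ} {x A B H : ℝ} {m : ℕ}

lemma iteratedDeriv_polynomial_eval (q : ℝ[X]) (m : ℕ) :
    iteratedDeriv m (fun x => q.eval x) = fun x => (derivative^[m] q).eval x := by
  induction m generalizing q with
  | zero => simp
  | succ m ih =>
    have hderiv : deriv (fun x => q.eval x) = fun x => q.derivative.eval x :=
      funext fun _ => q.deriv
    rw [iteratedDeriv_succ', Function.iterate_succ_apply, ← ih, hderiv]

lemma contDiff_polynomial_eval (q : ℝ[X]) {n : WithTop ℕ∞} : ContDiff ℝ n fun x => q.eval x := by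
  simpa using q.contDiff_aeval (R := ℝ) (𝕜 := ℝ) n

lemma iteratedDeriv_comp_affine (g : ℝ → ℝ) (α β : ℝ) (k : ℕ) :
    iteratedDeriv k (fun x => g (α * x + β)) = fun x => α ^ k * iteratedDeriv k g (α * x + β) := by
  induction k with
  | zero => simp
  | succ k ih =>
    funext x
    rw [iteratedDeriv_succ, ih, deriv_const_mul_field,
      deriv_comp_mul_left α (fun y => iteratedDeriv k g (y + β)) x, deriv_comp_add_const,
      smul_eq_mul, iteratedDeriv_succ]
    ring

lemma abs_iteratedDeriv_mul_mul_pow_le (hf : ContDiffAt ℝ m f x) (hg : ContDiffAt ℝ m g x)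
    (hH : 0 ≤ H) (hA : ∀ k ≤ m, |iteratedDeriv k f x| * H ^ k ≤ A)
    (hB : ∀ k ≤ m, |iteratedDeriv k g x| * H ^ k ≤ B) :
    |iteratedDeriv m (fun y => f y * g y) x| * H ^ m ≤ 2 ^ m * (A * B) := by
  have hA0 : 0 ≤ A := le_trans (by positivity) (hA 0 m.zero_le)
  rw [iteratedDeriv_fun_mul hf hg]
  calc |∑ i ∈ Finset.range (m + 1),
          (m.choose i : ℝ) * iteratedDeriv i f x * iteratedDeriv (m - i) g x| * H ^ m
      ≤ (∑ i ∈ Finset.range (m + 1),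
          |(m.choose i : ℝ) * iteratedDeriv i f x * iteratedDeriv (m - i) g x|) * H ^ m := by
        gcongr
        exact Finset.abs_sum_le_sum_abs _ _
    _ = ∑ i ∈ Finset.range (m + 1), (m.choose i : ℝ) *
          ((|iteratedDeriv i f x| * H ^ i) * (|iteratedDeriv (m - i) g x| * H ^ (m - i))) := by
        rw [Finset.sum_mul]
        refine Finset.sum_congr rfl fun i hi => ?_
        rw [abs_mul, abs_mul, Nat.abs_cast,
          ← pow_mul_pow_sub H (Nat.le_of_lt_succ (Finset.mem_range.1 hi))]
        ring
    _ ≤ ∑ i ∈ Finset.range (m + 1), (m.choose i : ℝ) * (A * B) := by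
        refine Finset.sum_le_sum fun i hi => ?_
        gcongr
        · exact hA i (Nat.le_of_lt_succ (Finset.mem_range.1 hi))
        · exact hB (m - i) (Nat.sub_le m i)
    _ = 2 ^ m * (A * B) := by
        rw [← Finset.sum_mul]
        exact_mod_cast congrArg (fun N : ℕ => (N : ℝ) * (A * B)) (Nat.sum_range_choose m)

lemma abs_iteratedDeriv_sub_const_mul_pow_le {c : ℝ} (hc : |x - c| ≤ H) (k : ℕ) :
    |iteratedDeriv k (fun y => y - c) x| * H ^ k ≤ H := by
  have hH : 0 ≤ H := (abs_nonneg _).trans hc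
  match k with
  | 0 => simpa using hc
  | 1 => simp [iteratedDeriv_one]
  | k + 2 =>
    have hderiv : deriv (fun y => y - c) = fun _ => (1 : ℝ) := by
      funext y
      simp
    simpa [iteratedDeriv_succ', hderiv] using hH

lemma abs_iteratedDeriv_prod_sub_const_mul_pow_le {ι : Type*} (T : Finset ι) (c : ι → ℝ)
    (hH : 0 ≤ H) (hc : ∀ i ∈ T, |x - c i| ≤ H) (m : ℕ) :
    |iteratedDeriv m (fun y => ∏ i ∈ T, (y - c i)) x| * H ^ m ≤ (2 ^ m * H) ^ T.card := by
  classical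
  induction T using Finset.induction_on generalizing m with
  | empty => cases m <;> simp [iteratedDeriv_const]
  | insert i T hi ih =>
    simp only [Finset.prod_insert hi, Finset.card_insert_of_notMem hi]
    have hT : ∀ k ≤ m, |iteratedDeriv k (fun y => ∏ i ∈ T, (y - c i)) x| * H ^ k
        ≤ (2 ^ m * H) ^ T.card := fun k hk => by
      refine (ih (fun i hi => hc i (Finset.mem_insert_of_mem hi)) k).trans ?_
      gcongr
      norm_num
    refine (abs_iteratedDeriv_mul_mul_pow_le (by fun_prop)
      (ContDiff.contDiffAt (contDiff_prod fun i _ => by fun_prop)) hH (fun k _ =>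
      abs_iteratedDeriv_sub_const_mul_pow_le (hc i (Finset.mem_insert_self i T)) k) hT).trans_eq ?_
    ring

end Leibniz

section DualKernel

variable {ξ : ℕ → ℝ} {p j : ℕ} {x : ℝ}

/-- The polynomial factor `φ_j = (X - ξ_{j+1}) ⋯ (X - ξ_{j+p}) / p!` of the dual kernel `ψ_j`. -/
noncomputable def dualPoly (ξ : ℕ → ℝ) (p j : ℕ) : ℝ[X] :=
  C ((p.factorial : ℝ)⁻¹) * innerKnotPoly ξ p j

/-- The affine map from the support of `B_{j,p}` onto `[-1, 1]`. -/
noncomputable def toReference (ξ : ℕ → ℝ) (p j : ℕ) (x : ℝ) : ℝ :=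
  (2 * x - ξ j - ξ (j + p + 1)) / (ξ (j + p + 1) - ξ j)

/-- The factor `G_j` of the dual kernel `ψ_j`: the transition function, transported to the support
of `B_{j,p}`. -/
noncomputable def cutoff (ξ : ℕ → ℝ) (p j : ℕ) (x : ℝ) : ℝ :=
  transition p (toReference ξ p j x)

lemma natDegree_dualPoly_le (ξ : ℕ → ℝ) (p j : ℕ) : (dualPoly ξ p j).natDegree ≤ p :=
  (natDegree_C_mul_le _ _).trans (natDegree_innerKnotPoly ξ p j).le

lemma iterate_succ_derivative_dualPoly (ξ : ℕ → ℝ) (p j : ℕ) :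
    derivative^[p + 1] (dualPoly ξ p j) = 0 :=
  iterate_derivative_eq_zero (Nat.lt_succ_of_le (natDegree_dualPoly_le ξ p j))

lemma eval_iterate_derivative_dualPoly (ξ : ℕ → ℝ) (p j : ℕ) (x : ℝ) :
    (derivative^[p] (dualPoly ξ p j)).eval x = 1 := by
  have hdegree : (derivative^[p] (dualPoly ξ p j)).natDegree = 0 := by
    have := natDegree_iterate_derivative (dualPoly ξ p j) p
    have := natDegree_dualPoly_le ξ p j
    omega
  have hlead : (innerKnotPoly ξ p j).coeff p = 1 := by
    simpa [natDegree_innerKnotPoly] using (monic_innerKnotPoly ξ p j).coeff_natDegree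
  rw [eq_C_of_natDegree_eq_zero hdegree, eval_C, coeff_iterate_derivative, zero_add,
    Nat.descFactorial_self, dualPoly, coeff_C_mul, hlead, nsmul_eq_mul, mul_one]
  exact mul_inv_cancel₀ (by exact_mod_cast p.factorial_ne_zero)

lemma eval_iterate_derivative_dualPoly_eq_zero {a m s : ℕ} (h : SortedKnots ξ a (a + m))
    (ha : j + 1 ≤ a) (ham : a + m ≤ j + p) (heq : ξ a = ξ (a + m)) (hs : s ≤ m) :
    (derivative^[s] (dualPoly ξ p j)).eval (ξ a) = 0 := by
  have hknot : ∀ k ∈ Finset.Icc (a - j) (a + m - j), X - C (ξ (j + k)) = X - C (ξ a) := by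
    intro k hk
    rw [Finset.mem_Icc] at hk
    have hle : ξ a ≤ ξ (j + k) := h.le (by omega) (by omega) (by omega)
    have hge : ξ (j + k) ≤ ξ (a + m) := h.le (by omega) (by omega) (by omega)
    rw [le_antisymm (hge.trans heq.ge) hle]
  have hdvd : (X - C (ξ a)) ^ (m + 1) ∣ dualPoly ξ p j := by
    have hsub : Finset.Icc (a - j) (a + m - j) ⊆ Finset.Icc 1 p :=
      Finset.Icc_subset_Icc (by omega) (by omega)
    refine Dvd.dvd.mul_left (dvd_trans (dvd_of_eq ?_) (Finset.prod_dvd_prod_of_subset _ _ _ hsub)) _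
    rw [Finset.prod_congr rfl hknot, Finset.prod_const, Nat.card_Icc]
    congr 1
    omega
  exact dvd_iff_isRoot.1 ((dvd_pow_self _ (by omega)).trans
    (pow_sub_dvd_iterate_derivative_of_pow_dvd s hdvd))

lemma abs_iteratedDeriv_dualPoly_mul_pow_le (h : SortedKnots ξ j (j + p + 1))
    (hx : x ∈ Icc (ξ j) (ξ (j + p + 1))) (m : ℕ) :
    |iteratedDeriv m (fun y => (dualPoly ξ p j).eval y) x| * (ξ (j + p + 1) - ξ j) ^ m
      ≤ (2 ^ m * (ξ (j + p + 1) - ξ j)) ^ p := by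
  have hH : 0 ≤ ξ (j + p + 1) - ξ j := sub_nonneg.2 (hx.1.trans hx.2)
  have hprod := abs_iteratedDeriv_prod_sub_const_mul_pow_le (x := x) (Finset.Icc 1 p)
    (fun k => ξ (j + k)) hH (fun k hk => by
      rw [Finset.mem_Icc] at hk
      have hleft : ξ j ≤ ξ (j + k) := h.le le_rfl (by omega) (by omega)
      have hright : ξ (j + k) ≤ ξ (j + p + 1) := h.le (by omega) (by omega) le_rfl
      exact abs_le.2 ⟨by linarith [hx.1], by linarith [hx.2]⟩) m
  have heval : (fun y => (dualPoly ξ p j).eval y)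
      = fun y => (p.factorial : ℝ)⁻¹ * ∏ k ∈ Finset.Icc 1 p, (y - ξ (j + k)) := by
    funext y
    simp [dualPoly, innerKnotPoly, eval_prod]
  rw [Nat.card_Icc, Nat.add_sub_cancel] at hprod
  rw [heval, iteratedDeriv_const_mul_field, abs_mul, mul_assoc]
  refine (mul_le_of_le_one_left (by positivity) ?_).trans hprod
  rw [abs_of_nonneg (by positivity)]
  exact inv_le_one_of_one_le₀ (by exact_mod_cast p.factorial_pos)

lemma toReference_eq_affine (ξ : ℕ → ℝ) (p j : ℕ) : toReference ξ p j = fun x =>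
    2 / (ξ (j + p + 1) - ξ j) * x + -(ξ j + ξ (j + p + 1)) / (ξ (j + p + 1) - ξ j) := by
  funext x
  rw [toReference]
  ring

lemma contDiff_toReference {n : WithTop ℕ∞} : ContDiff ℝ n (toReference ξ p j) := by
  rw [toReference_eq_affine]
  fun_prop

lemma toReference_injective (h : ξ j < ξ (j + p + 1)) : (toReference ξ p j).Injective := by
  have hne : ξ (j + p + 1) - ξ j ≠ 0 := (sub_pos.2 h).ne'
  intro x y hxy
  simp only [toReference, div_left_inj' hne] at hxy
  linarith

lemma finite_preimage_perfectKnot (h : ξ j < ξ (j + p + 1)) :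
    (toReference ξ p j ⁻¹' (perfectKnot p '' Icc 0 (p + 1))).Finite :=
  (finite_knots _ _ _).preimage (toReference_injective h).injOn

lemma contDiff_cutoff : ContDiff ℝ p (cutoff ξ p j) :=
  (contDiff_transition p).comp contDiff_toReference

lemma contDiffAt_cutoff (hx : OffKnots (perfectKnot p) 0 (p + 1) (toReference ξ p j x)) :
    ContDiffAt ℝ ∞ (cutoff ξ p j) x :=
  (contDiffAt_transition hx).comp x contDiff_toReference.contDiffAt

lemma abs_iteratedDeriv_cutoff_mul_pow (h : ξ j < ξ (j + p + 1)) (k : ℕ) :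
    |iteratedDeriv k (cutoff ξ p j) x| * (ξ (j + p + 1) - ξ j) ^ k
      = 2 ^ k * |iteratedDeriv k (transition p) (toReference ξ p j x)| := by
  have hH : 0 < ξ (j + p + 1) - ξ j := sub_pos.2 h
  have hderiv : iteratedDeriv k (cutoff ξ p j) x
      = (2 / (ξ (j + p + 1) - ξ j)) ^ k
        * iteratedDeriv k (transition p) (toReference ξ p j x) := by
    unfold cutoff
    rw [toReference_eq_affine, iteratedDeriv_comp_affine]
  rw [hderiv, abs_mul, abs_of_pos (by positivity), mul_right_comm, ← mul_pow,
    div_mul_cancel₀ _ hH.ne']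

lemma dualKernel_eq_mul (ξ : ℕ → ℝ) (p j : ℕ) :
    dualKernel ξ p j = fun x => cutoff ξ p j x * (dualPoly ξ p j).eval x := by
  funext x
  simp only [dualKernel, cutoff, toReference, dualPoly, innerKnotPoly, eval_mul, eval_C, eval_prod,
    eval_sub, eval_X]
  ring

lemma dualKernel_of_le (h : ξ j < ξ (j + p + 1)) (hx : x ≤ ξ j) : dualKernel ξ p j x = 0 := by
  rw [dualKernel, transition_of_le, zero_mul]
  rw [div_le_iff₀ (sub_pos.2 h)]
  linarith

lemma dualKernel_of_ge (h : ξ j < ξ (j + p + 1)) (hx : ξ (j + p + 1) ≤ x) :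
    dualKernel ξ p j x = (dualPoly ξ p j).eval x := by
  rw [dualKernel_eq_mul]
  simp only [cutoff, toReference]
  rw [transition_of_ge, one_mul]
  rw [le_div_iff₀ (sub_pos.2 h)]
  linarith

lemma contDiff_dualKernel : ContDiff ℝ p (dualKernel ξ p j) := by
  rw [dualKernel_eq_mul]
  exact contDiff_cutoff.mul (contDiff_polynomial_eval _)

lemma iteratedDeriv_dualKernel_of_le (h : ξ j < ξ (j + p + 1)) (hx : x ≤ ξ j) {m : ℕ}
    (hm : m ≤ p) : iteratedDeriv m (dualKernel ξ p j) x = 0 := by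
  have heq : EqOn (dualKernel ξ p j) (fun _ => 0) (Iio (ξ j)) :=
    fun y hy => dualKernel_of_le h (le_of_lt hy)
  have hclosure := (heq.iteratedDeriv_of_isOpen isOpen_Iio m).closure
    (contDiff_dualKernel.continuous_iteratedDeriv m (by exact_mod_cast hm))
    (contDiff_const.continuous_iteratedDeriv' m)
  rw [closure_Iio] at hclosure
  rw [hclosure hx, iteratedDeriv_fun_const_zero]

lemma iteratedDeriv_dualKernel_of_ge (h : ξ j < ξ (j + p + 1)) (hx : ξ (j + p + 1) ≤ x) {m : ℕ}
    (hm : m ≤ p) :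
    iteratedDeriv m (dualKernel ξ p j) x = (derivative^[m] (dualPoly ξ p j)).eval x := by
  have heq : EqOn (dualKernel ξ p j) (fun y => (dualPoly ξ p j).eval y) (Ioi (ξ (j + p + 1))) :=
    fun y hy => dualKernel_of_ge h (le_of_lt hy)
  have hclosure := (heq.iteratedDeriv_of_isOpen isOpen_Ioi m).closure
    (contDiff_dualKernel.continuous_iteratedDeriv m (by exact_mod_cast hm))
    ((contDiff_polynomial_eval _).continuous_iteratedDeriv' m)
  rw [closure_Ioi] at hclosure
  rw [hclosure hx, iteratedDeriv_polynomial_eval]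

lemma iteratedDeriv_succ_dualKernel_eq_zero (h : ξ j < ξ (j + p + 1))
    (hx : x ∉ Icc (ξ j) (ξ (j + p + 1))) : iteratedDeriv (p + 1) (dualKernel ξ p j) x = 0 := by
  rcases lt_or_ge x (ξ j) with hlt | hge
  · have hev : dualKernel ξ p j =ᶠ[𝓝 x] fun _ => 0 := by
      filter_upwards [gt_mem_nhds hlt] with y hy using dualKernel_of_le h (le_of_lt hy)
    rw [hev.iteratedDeriv_eq, iteratedDeriv_fun_const_zero]
  · have hgt : ξ (j + p + 1) < x := not_le.1 fun hle => hx ⟨hge, hle⟩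
    have hev : dualKernel ξ p j =ᶠ[𝓝 x] fun y => (dualPoly ξ p j).eval y := by
      filter_upwards [lt_mem_nhds hgt] with y hy using dualKernel_of_ge h (le_of_lt hy)
    rw [hev.iteratedDeriv_eq, iteratedDeriv_polynomial_eval, iterate_succ_derivative_dualPoly]
    exact eval_zero

lemma iteratedDeriv_dualKernel_knot_eq_zero {a m : ℕ} (h : SortedKnots ξ a (a + m))
    (ha : j + 1 ≤ a) (ham : a + m ≤ j + p) (heq : ξ a = ξ (a + m)) :
    iteratedDeriv m (dualKernel ξ p j) (ξ a) = 0 := by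
  rw [dualKernel_eq_mul, iteratedDeriv_fun_mul
    (contDiff_cutoff.of_le (by exact_mod_cast (by omega : m ≤ p))).contDiffAt
    (contDiff_polynomial_eval _).contDiffAt]
  refine Finset.sum_eq_zero fun i _ => ?_
  rw [iteratedDeriv_polynomial_eval]
  exact mul_eq_zero_of_right _
    (eval_iterate_derivative_dualPoly_eq_zero h ha ham heq (Nat.sub_le m i))

lemma exists_abs_iteratedDeriv_dualKernel_le (p : ℕ) : ∃ C, ∀ (ξ : ℕ → ℝ) (j : ℕ),
    SortedKnots ξ j (j + p + 1) → ξ j < ξ (j + p + 1) →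
      ∀ᵐ x, |iteratedDeriv (p + 1) (dualKernel ξ p j) x| ≤ C / (ξ (j + p + 1) - ξ j) := by
  obtain ⟨M, hM⟩ := exists_abs_iteratedDeriv_transition_le p (p + 1)
  refine ⟨2 ^ (p + 1) * (2 ^ (p + 1) * |M| * (2 ^ (p + 1)) ^ p), fun ξ j hsorted h => ?_⟩
  have hH : 0 < ξ (j + p + 1) - ξ j := sub_pos.2 h
  filter_upwards [(finite_preimage_perfectKnot h).countable.ae_notMem volume] with x hx
  by_cases hmem : x ∈ Icc (ξ j) (ξ (j + p + 1))
  swap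
  · rw [iteratedDeriv_succ_dualKernel_eq_zero h hmem, abs_zero]
    positivity
  have hcutoff : ∀ k ≤ p + 1, |iteratedDeriv k (cutoff ξ p j) x| * (ξ (j + p + 1) - ξ j) ^ k
      ≤ 2 ^ (p + 1) * |M| := fun k hk => by
    rw [abs_iteratedDeriv_cutoff_mul_pow h]
    refine mul_le_mul ?_ ((hM k hk _ hx).trans (le_abs_self M)) (abs_nonneg _) (by positivity)
    gcongr
    norm_num
  have hpoly : ∀ k ≤ p + 1,
      |iteratedDeriv k (fun y => (dualPoly ξ p j).eval y) x| * (ξ (j + p + 1) - ξ j) ^ k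
        ≤ (2 ^ (p + 1) * (ξ (j + p + 1) - ξ j)) ^ p := fun k hk => by
    refine (abs_iteratedDeriv_dualPoly_mul_pow_le hsorted hmem k).trans ?_
    gcongr
    norm_num
  have hmul := abs_iteratedDeriv_mul_mul_pow_le
    ((contDiffAt_cutoff hx).of_le (by exact_mod_cast le_top))
    (contDiff_polynomial_eval _).contDiffAt hH.le hcutoff hpoly
  rw [dualKernel_eq_mul, le_div_iff₀ hH]
  refine le_of_mul_le_mul_right (?_ : _ * _ ≤ _ * _) (pow_pos hH p)
  calc _ = _ := by rw [mul_assoc, ← pow_succ']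
    _ ≤ _ := hmul
    _ = _ := by rw [mul_pow]; ring

lemma piecewiseSmooth_dualKernel (hsorted : SortedKnots ξ j (j + p + 1))
    (h : ξ j < ξ (j + p + 1)) : PiecewiseSmooth p (dualKernel ξ p j) := by
  refine ⟨contDiff_dualKernel, ⟨_, finite_preimage_perfectKnot h, fun x hx => ?_⟩, fun a b => ?_⟩
  · rw [dualKernel_eq_mul]
    exact ((contDiffAt_cutoff hx).of_le (by exact_mod_cast le_top)).mul
      (contDiff_polynomial_eval _).contDiffAt
  · obtain ⟨M, hM⟩ := exists_abs_iteratedDeriv_dualKernel_le p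
    have hmeas : Measurable (iteratedDeriv (p + 1) (dualKernel ξ p j)) := by
      rw [iteratedDeriv_succ]
      exact measurable_deriv _
    exact (intervalIntegrable_const (c := M / (ξ (j + p + 1) - ξ j))).mono_fun'
      hmeas.aestronglyMeasurable (ae_restrict_of_ae (hM ξ j hsorted h))

end DualKernel

/-! ### Biorthogonality -/

section Biorthogonality

variable {ξ : ℕ → ℝ} {p n i j : ℕ} {v w : ℝ → ℝ}

lemma intervalIntegrable_mul_iteratedDeriv_dualKernel (hsorted : SortedKnots ξ j (j + p + 1))
    (h : ξ j < ξ (j + p + 1)) {a b : ℝ} (hv : IntervalIntegrable v volume a b) :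
    IntervalIntegrable (fun x => v x * iteratedDeriv (p + 1) (dualKernel ξ p j) x) volume a b := by
  obtain ⟨M, hM⟩ := exists_abs_iteratedDeriv_dualKernel_le p
  have hmeas : Measurable (iteratedDeriv (p + 1) (dualKernel ξ p j)) := by
    rw [iteratedDeriv_succ]
    exact measurable_deriv _
  rw [intervalIntegrable_iff] at hv ⊢
  exact hv.mul_bdd hmeas.aestronglyMeasurable (ae_restrict_of_ae (hM ξ j hsorted h))

lemma dualFunctional_eq_integral (h : ξ j < ξ (j + p + 1)) (v : ℝ → ℝ) :
    dualFunctional ξ p j v = ∫ x, v x * iteratedDeriv (p + 1) (dualKernel ξ p j) x :=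
  (integral_eq_intervalIntegral_of_eq_zero h.le fun x hx => by
    rw [iteratedDeriv_succ_dualKernel_eq_zero h hx, mul_zero]).symm

lemma dualFunctional_congr (h : ξ j ≤ ξ (j + p + 1))
    (hvw : ∀ᵐ x, x ∈ Ioo (ξ j) (ξ (j + p + 1)) → v x = w x) :
    dualFunctional ξ p j v = dualFunctional ξ p j w := by
  refine intervalIntegral.integral_congr_ae ?_
  filter_upwards [hvw, (countable_singleton (ξ (j + p + 1))).ae_notMem volume] with x hx hne hmem
  rw [uIoc_of_le h] at hmem
  rw [hx ⟨hmem.1, hmem.2.lt_of_ne hne⟩]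

lemma dualFunctional_add (hsorted : SortedKnots ξ j (j + p + 1)) (h : ξ j < ξ (j + p + 1))
    (hv : IntervalIntegrable v volume (ξ j) (ξ (j + p + 1)))
    (hw : IntervalIntegrable w volume (ξ j) (ξ (j + p + 1))) :
    dualFunctional ξ p j (fun x => v x + w x)
      = dualFunctional ξ p j v + dualFunctional ξ p j w := by
  simp only [dualFunctional, add_mul]
  exact intervalIntegral.integral_add
    (intervalIntegrable_mul_iteratedDeriv_dualKernel hsorted h hv)
    (intervalIntegrable_mul_iteratedDeriv_dualKernel hsorted h hw)

lemma dualFunctional_spline_eq_sum (hsorted : SortedKnots ξ 0 (n + p)) (hj : j < n)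
    (h : ξ j < ξ (j + p + 1)) (c : ℕ → ℝ) :
    dualFunctional ξ p j (spline ξ p n c)
      = ∑ i ∈ Finset.range n, c i * dualFunctional ξ p j (bspline ξ p i) := by
  simp only [dualFunctional, spline, Finset.sum_mul, ← intervalIntegral.integral_const_mul,
    ← mul_assoc]
  refine intervalIntegral.integral_finsetSum fun i hi => ?_
  rw [Finset.mem_range] at hi
  exact intervalIntegrable_mul_iteratedDeriv_dualKernel (hsorted.mono (by omega) (by omega)) h
    ((integrable_bspline (hsorted.mono (by omega) (by omega))).const_mul _).intervalIntegrable

lemma dualFunctional_one (hsorted : SortedKnots ξ j (j + p + 1)) (h : ξ j < ξ (j + p + 1)) :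
    dualFunctional ξ p j (fun _ => 1) = 1 := by
  have hψ := piecewiseSmooth_dualKernel hsorted h
  obtain ⟨S, hS, hderiv⟩ := hψ.exists_finite_hasDerivAt
  simp only [dualFunctional, one_mul]
  rw [integral_eq_of_hasDerivAt_off_countable_of_le (iteratedDeriv p (dualKernel ξ p j)) _ h.le
      hS.countable (hψ.contDiff.continuous_iteratedDeriv p le_rfl).continuousOn
      (fun x hx => hderiv x hx.2) (hψ.intervalIntegrable _ _),
    iteratedDeriv_dualKernel_of_le h le_rfl le_rfl, iteratedDeriv_dualKernel_of_ge h le_rfl le_rfl,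
    eval_iterate_derivative_dualPoly, sub_zero]

lemma dualFunctional_bspline_of_lt (hsorted : SortedKnots ξ i (j + p + 1)) (hij : i < j)
    (h : ξ j < ξ (j + p + 1)) : dualFunctional ξ p j (bspline ξ p i) = 0 := by
  rw [dualFunctional_eq_integral h]
  refine integral_bspline_mul_iteratedDeriv_eq_zero (hsorted.mono le_rfl (by omega))
    (piecewiseSmooth_dualKernel (hsorted.mono hij.le le_rfl) h) fun a m ha ham hm heq => ?_
  rcases le_or_gt (ξ a) (ξ j) with hle | hgt
  · exact iteratedDeriv_dualKernel_of_le h hle hm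
  · have hja : j < a := not_le.1 fun haj => hgt.not_ge (hsorted.le ha haj (by omega))
    exact iteratedDeriv_dualKernel_knot_eq_zero (hsorted.mono ha (by omega)) hja (by omega) heq

lemma dualFunctional_bspline_of_gt (hsorted : SortedKnots ξ j (i + p + 1)) (hij : j < i)
    (h : ξ j < ξ (j + p + 1)) : dualFunctional ξ p j (bspline ξ p i) = 0 := by
  have hψ := piecewiseSmooth_dualKernel (hsorted.mono le_rfl (by omega)) h
  have hφ : ContDiff ℝ ∞ fun x => (dualPoly ξ p j).eval x := contDiff_polynomial_eval _
  have hdiff := hψ.sub (piecewiseSmooth_of_contDiff (hφ.of_le (by exact_mod_cast le_top)))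
  obtain ⟨S, hS, hsmooth⟩ := hψ.exists_finite
  -- Subtracting `φ_j`, whose derivative of order `p + 1` vanishes, moves the zeros of the kernel
  -- from the left of the support to the right.
  have hsub : (fun x => bspline ξ p i x * iteratedDeriv (p + 1) (dualKernel ξ p j) x) =ᵐ[volume]
      fun x => bspline ξ p i x
        * iteratedDeriv (p + 1) (dualKernel ξ p j - fun x => (dualPoly ξ p j).eval x) x := by
    filter_upwards [hS.countable.ae_notMem volume] with x hx
    rw [iteratedDeriv_sub (hsmooth x hx) (hφ.of_le (by exact_mod_cast le_top)).contDiffAt,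
      iteratedDeriv_polynomial_eval, iterate_succ_derivative_dualPoly]
    simp only [eval_zero, sub_zero]
  rw [dualFunctional_eq_integral h, integral_congr_ae hsub]
  refine integral_bspline_mul_iteratedDeriv_eq_zero (hsorted.mono hij.le le_rfl) hdiff
    fun a m ha ham hm heq => ?_
  rw [iteratedDeriv_sub (hψ.contDiff.of_le (by exact_mod_cast hm)).contDiffAt
    (hφ.of_le (by exact_mod_cast le_top)).contDiffAt, iteratedDeriv_polynomial_eval, sub_eq_zero]
  rcases le_or_gt (ξ (j + p + 1)) (ξ a) with hge | hlt
  · exact iteratedDeriv_dualKernel_of_ge h hge hm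
  · have hsub_knots : SortedKnots ξ a (a + m) := hsorted.mono (by omega) (by omega)
    have hmj : a + m < j + p + 1 := not_le.1 fun hle =>
      (heq ▸ hlt).not_ge (hsorted.le (by omega) hle (by omega))
    rw [iteratedDeriv_dualKernel_knot_eq_zero hsub_knots (by omega) (by omega) heq]
    exact (eval_iterate_derivative_dualPoly_eq_zero hsub_knots (by omega) (by omega) heq
      le_rfl).symm

end Biorthogonality

/-! ### Open knot vectors -/

section OpenKnotVector

variable {ξ : ℕ → ℝ} {p n i j : ℕ} {r : ℤ}

lemma IsOpenKnotVector.sorted (h : IsOpenKnotVector p n ξ) {a b : ℕ} (hb : b ≤ n + p) :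
    SortedKnots ξ a b :=
  fun k _ l hl hkl => h.mono k l hkl (hl.2.trans hb)

lemma IsOpenKnotVector.lt (h : IsOpenKnotVector p n ξ) : p < n := by
  by_contra! hle
  linarith [h.eq_zero n hle, h.eq_one n le_rfl (by omega)]

lemma IsOpenKnotVector.nonneg (h : IsOpenKnotVector p n ξ) (hj : j ≤ n + p) : 0 ≤ ξ j :=
  (h.eq_zero 0 p.zero_le).ge.trans (h.mono 0 j j.zero_le hj)

lemma IsOpenKnotVector.le_one (h : IsOpenKnotVector p n ξ) (hj : j ≤ n + p) : ξ j ≤ 1 :=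
  (h.mono j (n + p) hj le_rfl).trans (h.eq_one (n + p) (by omega) le_rfl).le

lemma IsOpenKnotVector.lt_of_hasRegularity (h : IsOpenKnotVector p n ξ)
    (hr : HasRegularity p n ξ r) {m : ℕ} (hjm : j + m ≤ n + p) (hpos : 0 < ξ j) (hone : ξ j < 1)
    (hm : (p : ℤ) - r ≤ m) : ξ j < ξ (j + m) := by
  refine (h.mono j (j + m) (by omega) hjm).lt_of_ne fun heq => ?_
  have hsub : Icc j (j + m) ⊆ {k : ℕ | k ≤ n + p ∧ ξ k = ξ j} := fun k hk =>
    ⟨hk.2.trans hjm, le_antisymm (heq ▸ h.mono k (j + m) hk.2 hjm)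
      (h.mono j k hk.1 (hk.2.trans hjm))⟩
  have hcard := ncard_le_ncard hsub ((finite_Iic (n + p)).subset fun k hk => hk.1)
  have hmult := hr j (by omega) hpos hone
  rw [← Finset.coe_Icc, ncard_coe_finset, Nat.card_Icc] at hcard
  rw [multiplicity] at hmult
  omega

lemma IsOpenKnotVector.lt_support (h : IsOpenKnotVector p n ξ) (hr : HasRegularity p n ξ r)
    (hr1 : -1 ≤ r) (hj : j < n) : ξ j < ξ (j + p + 1) := by
  rcases (h.nonneg (by omega : j ≤ n + p)).eq_or_lt with hzero | hpos
  · exact hzero ▸ h.pos _ (by omega) (by omega)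
  · exact h.lt_of_hasRegularity hr (by omega : j + (p + 1) ≤ n + p) hpos (h.lt_one j hj)
      (by push_cast; omega)

lemma IsOpenKnotVector.dualFunctional_bspline_of_ne (h : IsOpenKnotVector p n ξ) (hi : i < n)
    (hj : j < n) (hlt : ξ j < ξ (j + p + 1)) (hij : i ≠ j) :
    dualFunctional ξ p j (bspline ξ p i) = 0 :=
  hij.lt_or_gt.elim (dualFunctional_bspline_of_lt (h.sorted (by omega)) · hlt)
    (dualFunctional_bspline_of_gt (h.sorted (by omega)) · hlt)

lemma IsOpenKnotVector.dualFunctional_spline_eq_mul (h : IsOpenKnotVector p n ξ) (hj : j < n)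
    (hlt : ξ j < ξ (j + p + 1)) (c : ℕ → ℝ) :
    dualFunctional ξ p j (spline ξ p n c) = c j * dualFunctional ξ p j (bspline ξ p j) := by
  rw [dualFunctional_spline_eq_sum (h.sorted le_rfl) hj hlt]
  refine Finset.sum_eq_single j (fun i hi hij => ?_) fun hj' => absurd (Finset.mem_range.2 hj) hj'
  rw [h.dualFunctional_bspline_of_ne (Finset.mem_range.1 hi) hj hlt hij, mul_zero]

lemma IsOpenKnotVector.dualFunctional_bspline_self (h : IsOpenKnotVector p n ξ) (hj : j < n)
    (hlt : ξ j < ξ (j + p + 1)) : dualFunctional ξ p j (bspline ξ p j) = 1 := by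
  calc dualFunctional ξ p j (bspline ξ p j)
      = dualFunctional ξ p j (spline ξ p n fun _ => 1) := by
        rw [h.dualFunctional_spline_eq_mul hj hlt, one_mul]
    _ = dualFunctional ξ p j fun _ => 1 := dualFunctional_congr hlt.le <| ae_of_all _ fun x hx => by
        have hleft : ξ p ≤ x := (h.eq_zero p le_rfl).trans_le ((h.nonneg (by omega)).trans hx.1.le)
        have hright : x < ξ n :=
          (hx.2.trans_le (h.le_one (by omega))).trans_eq (h.eq_one n le_rfl (by omega)).symm
        simp only [spline, one_mul]
        exact sum_bspline (h.sorted le_rfl) ⟨hleft, hright⟩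
    _ = 1 := dualFunctional_one (h.sorted (by omega)) hlt

lemma IsOpenKnotVector.proj_spline (h : IsOpenKnotVector p n ξ) (hr : HasRegularity p n ξ r)
    (hr1 : -1 ≤ r) (c : ℕ → ℝ) : proj ξ p n (spline ξ p n c) = spline ξ p n c := by
  funext x
  refine Finset.sum_congr rfl fun j hj => ?_
  rw [Finset.mem_range] at hj
  have hlt := h.lt_support hr hr1 hj
  rw [h.dualFunctional_spline_eq_mul hj hlt, h.dualFunctional_bspline_self hj hlt, mul_one]

lemma mem_splineSpace_iff {s : ℝ → ℝ} :
    s ∈ splineSpace ξ p n ↔ ∃ c : ℕ → ℝ, spline ξ p n c = s := by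
  have himage : {f | ∃ j < n, f = bspline ξ p j} = bspline ξ p '' ↑(Finset.range n) := by
    ext f
    simp [eq_comm]
  rw [splineSpace, himage, Submodule.mem_span_image_finset_iff_exists_fun']
  refine exists_congr fun c => Eq.congr_left ?_
  funext x
  simp [spline]

lemma spline_mem_splineSpace (c : ℕ → ℝ) : spline ξ p n c ∈ splineSpace ξ p n :=
  mem_splineSpace_iff.2 ⟨c, rfl⟩

lemma IsOpenKnotVector.proj_eq_self (h : IsOpenKnotVector p n ξ) (hr : HasRegularity p n ξ r)
    (hr1 : -1 ≤ r) {s : ℝ → ℝ} (hs : s ∈ splineSpace ξ p n) : proj ξ p n s = s := by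
  obtain ⟨c, rfl⟩ := mem_splineSpace_iff.1 hs
  exact h.proj_spline hr hr1 c

end OpenKnotVector

/-! ### Weak derivatives -/

section TestFunction

variable {Ω Ω' : Set ℝ} {v w φ : ℝ → ℝ} {a b : ℝ}

lemma tsupport_iteratedDeriv_subset (f : ℝ → ℝ) (k : ℕ) :
    tsupport (iteratedDeriv k f) ⊆ tsupport f := by
  induction k with
  | zero => rw [iteratedDeriv_zero]
  | succ k ih => exact iteratedDeriv_succ (f := f) ▸ tsupport_deriv_subset.trans ih

/-- `φ` is a test function on `Ω`: the class of functions against which `HasWeakDeriv` tests. -/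
structure IsTestFunction (Ω : Set ℝ) (φ : ℝ → ℝ) : Prop where
  contDiff : ContDiff ℝ ∞ φ
  hasCompactSupport : HasCompactSupport φ
  tsupport_subset : tsupport φ ⊆ Ω

namespace IsTestFunction

lemma mono (hφ : IsTestFunction Ω' φ) (h : Ω' ⊆ Ω) : IsTestFunction Ω φ :=
  ⟨hφ.contDiff, hφ.hasCompactSupport, hφ.tsupport_subset.trans h⟩

lemma iteratedDeriv (hφ : IsTestFunction Ω φ) (k : ℕ) :
    IsTestFunction Ω (iteratedDeriv k φ) where
  contDiff := by
    rw [iteratedDeriv_eq_iterate]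
    exact hφ.contDiff.iterate_deriv k
  hasCompactSupport := hφ.hasCompactSupport.mono'
    ((subset_tsupport _).trans (tsupport_iteratedDeriv_subset φ k))
  tsupport_subset := (tsupport_iteratedDeriv_subset φ k).trans hφ.tsupport_subset

lemma sub (hv : IsTestFunction Ω v) (hw : IsTestFunction Ω w) : IsTestFunction Ω (v - w) where
  contDiff := hv.contDiff.sub hw.contDiff
  hasCompactSupport := hv.hasCompactSupport.sub hw.hasCompactSupport
  tsupport_subset := (tsupport_sub v w).trans (union_subset hv.tsupport_subset hw.tsupport_subset)

lemma const_mul (hv : IsTestFunction Ω v) (c : ℝ) : IsTestFunction Ω (fun x => c * v x) where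
  contDiff := contDiff_const.mul hv.contDiff
  hasCompactSupport := hv.hasCompactSupport.mul_left
  tsupport_subset := (tsupport_mul_subset_right (f := fun _ => c)).trans hv.tsupport_subset

lemma eq_zero_of_notMem (hφ : IsTestFunction Ω φ) {x : ℝ} (hx : x ∉ Ω) : φ x = 0 :=
  image_eq_zero_of_notMem_tsupport fun hmem => hx (hφ.tsupport_subset hmem)

lemma setIntegral_mul (hφ : IsTestFunction Ω φ) (v : ℝ → ℝ) :
    ∫ x in Ω, v x * φ x = ∫ x, v x * φ x :=
  setIntegral_eq_integral_of_forall_compl_eq_zero fun x hx => by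
    rw [hφ.eq_zero_of_notMem hx, mul_zero]

lemma integrable_mul (hφ : IsTestFunction Ω φ) (hv : LocallyIntegrableOn v Ω) :
    Integrable fun x => v x * φ x := by
  have hon : IntegrableOn (fun x => v x * φ x) (tsupport φ) :=
    (hv.integrableOn_compact_subset hφ.tsupport_subset hφ.hasCompactSupport).mul_continuousOn
      hφ.contDiff.continuous.continuousOn hφ.hasCompactSupport
  refine (integrableOn_iff_integrable_of_support_subset ?_).1 hon
  exact (Function.support_mul_subset_right v φ).trans (subset_tsupport φ)

lemma integrable (hφ : IsTestFunction Ω φ) : Integrable φ :=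
  hφ.contDiff.continuous.integrable_of_hasCompactSupport hφ.hasCompactSupport

end IsTestFunction

lemma exists_Icc_superset_of_isCompact {K : Set ℝ} (hK : IsCompact K) (hab : a < b)
    (hsub : K ⊆ Ioo a b) : ∃ α β, a < α ∧ β < b ∧ K ⊆ Icc α β := by
  rcases K.eq_empty_or_nonempty with rfl | hne
  · obtain ⟨c, hac, hcb⟩ := exists_between hab
    exact ⟨c, c, hac, hcb, empty_subset _⟩
  · exact ⟨sInf K, sSup K, (hsub (hK.sInf_mem hne)).1, (hsub (hK.sSup_mem hne)).2,
      fun x hx => ⟨csInf_le hK.bddBelow hx, le_csSup hK.bddAbove hx⟩⟩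

lemma IsTestFunction.exists_deriv_eq (hφ : IsTestFunction (Ioo a b) φ) (hab : a < b)
    (hint : ∫ x, φ x = 0) : ∃ θ, IsTestFunction (Ioo a b) θ ∧ deriv θ = φ := by
  obtain ⟨α, β, hα, hβ, hsub⟩ :=
    exists_Icc_superset_of_isCompact hφ.hasCompactSupport hab hφ.tsupport_subset
  have hzero : ∀ x ∉ Icc α β, φ x = 0 := fun x hx =>
    image_eq_zero_of_notMem_tsupport fun hmem => hx (hsub hmem)
  have hderiv : ∀ x, HasDerivAt (fun x => ∫ t in a..x, φ t) (φ x) x :=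
    fun x => hφ.contDiff.continuous.integral_hasStrictDerivAt a x |>.hasDerivAt
  have hderiv_eq : deriv (fun x => ∫ t in a..x, φ t) = φ := funext fun x => (hderiv x).deriv
  have htsupport : tsupport (fun x => ∫ t in a..x, φ t) ⊆ Icc α β := by
    refine closure_minimal (fun x hx => ?_) isClosed_Icc
    by_contra hmem
    refine hx ?_
    rcases lt_or_ge x α with hxα | hαx
    · exact intervalIntegral.integral_zero_ae (ae_of_all _ fun t ht =>
        hzero t fun hmem => (ht.2.trans_lt (max_lt hα hxα)).not_ge hmem.1)
    · have hβx : β < x := not_le.1 fun hxβ => hmem ⟨hαx, hxβ⟩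
      refine (integral_eq_intervalIntegral_of_eq_zero (hα.le.trans hαx) fun t ht => ?_).symm.trans
        hint
      exact hzero t fun hmem => ht ⟨hα.le.trans hmem.1, hmem.2.trans hβx.le⟩
  refine ⟨_, ⟨?_, ?_, ?_⟩, hderiv_eq⟩
  · rw [contDiff_infty_iff_deriv, hderiv_eq]
    exact ⟨fun x => (hderiv x).differentiableAt, hφ.contDiff⟩
  · exact isCompact_Icc.of_isClosed_subset (isClosed_tsupport _) htsupport
  · exact htsupport.trans (Icc_subset_Ioo hα hβ)

lemma exists_isTestFunction_integral_eq_one (hab : a < b) :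
    ∃ η, IsTestFunction (Ioo a b) η ∧ ∫ x, η x = 1 := by
  let f : ContDiffBump ((a + b) / 2) := ⟨(b - a) / 8, (b - a) / 4, by linarith, by linarith⟩
  refine ⟨f.normed volume, ⟨f.contDiff_normed, f.hasCompactSupport_normed, ?_⟩, f.integral_normed⟩
  rw [f.tsupport_normed_eq, Real.closedBall_eq_Icc]
  exact Icc_subset_Ioo (by change a < (a + b) / 2 - (b - a) / 4; linarith)
    (by change (a + b) / 2 + (b - a) / 4 < b; linarith)

lemma ae_eq_of_forall_integral_mul_eq (hΩ : IsOpen Ω) (hv : LocallyIntegrableOn v Ω)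
    (hw : LocallyIntegrableOn w Ω)
    (h : ∀ φ, IsTestFunction Ω φ → ∫ x in Ω, v x * φ x = ∫ x in Ω, w x * φ x) :
    v =ᵐ[volume.restrict Ω] w := by
  rw [Filter.EventuallyEq, ae_restrict_iff' hΩ.measurableSet]
  have hzero := hΩ.ae_eq_zero_of_integral_contDiff_smul_eq_zero (μ := volume) (hv.sub hw)
    fun φ hsmooth hcompact hsub => by
      have hφ : IsTestFunction Ω φ := ⟨hsmooth, hcompact, hsub⟩
      have heq := h φ hφ
      rw [hφ.setIntegral_mul, hφ.setIntegral_mul] at heq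
      simp only [Pi.sub_apply, smul_eq_mul, mul_comm (φ _), sub_mul]
      rw [integral_sub (hφ.integrable_mul hv) (hφ.integrable_mul hw), heq, sub_self]
  filter_upwards [hzero] with x hx hmem
  exact sub_eq_zero.1 (hx hmem)

end TestFunction

section WeakDerivative

variable {Ω Ω' : Set ℝ} {v v' w g f : ℝ → ℝ} {k l : ℕ} {a b : ℝ}

lemma hasWeakDeriv_zero (hv : LocallyIntegrableOn v Ω) : HasWeakDeriv Ω 0 v v :=
  ⟨hv, hv, fun φ _ _ _ => by rw [iteratedDeriv_zero, pow_zero, one_mul]⟩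

lemma HasWeakDeriv.integral_eq (h : HasWeakDeriv Ω k v g) {φ : ℝ → ℝ} (hφ : IsTestFunction Ω φ) :
    ∫ x in Ω, v x * iteratedDeriv k φ x = (-1) ^ k * ∫ x in Ω, g x * φ x :=
  h.2.2 φ hφ.contDiff hφ.hasCompactSupport hφ.tsupport_subset

lemma HasWeakDeriv.mono (h : HasWeakDeriv Ω k v g) (hsub : Ω' ⊆ Ω) : HasWeakDeriv Ω' k v g := by
  refine ⟨h.1.mono_set hsub, h.2.1.mono_set hsub, fun φ hsmooth hcompact htsupport => ?_⟩
  have hφ : IsTestFunction Ω' φ := ⟨hsmooth, hcompact, htsupport⟩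
  rw [(hφ.iteratedDeriv k).setIntegral_mul, hφ.setIntegral_mul,
    ← ((hφ.mono hsub).iteratedDeriv k).setIntegral_mul, ← (hφ.mono hsub).setIntegral_mul,
    h.integral_eq (hφ.mono hsub)]

lemma HasWeakDeriv.congr (h : HasWeakDeriv Ω k v g) (hv : v =ᵐ[volume.restrict Ω] v')
    (hg : g =ᵐ[volume.restrict Ω] w) : HasWeakDeriv Ω k v' w := by
  refine ⟨h.1.congr hv, h.2.1.congr hg, fun φ hsmooth hcompact htsupport => ?_⟩
  have hleft := integral_congr_ae (hv.mul (ae_eq_refl (iteratedDeriv k φ)))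
  have hright := integral_congr_ae (hg.mul (ae_eq_refl φ))
  simp only [Pi.mul_apply] at hleft hright
  rw [← hleft, ← hright]
  exact h.2.2 φ hsmooth hcompact htsupport

lemma HasWeakDeriv.unique (hΩ : IsOpen Ω) (hg : HasWeakDeriv Ω k v g) (hw : HasWeakDeriv Ω k v w) :
    g =ᵐ[volume.restrict Ω] w :=
  ae_eq_of_forall_integral_mul_eq hΩ hg.2.1 hw.2.1 fun _ hφ => mul_left_cancel₀
    (pow_ne_zero k (neg_ne_zero.2 one_ne_zero))
    ((hg.integral_eq hφ).symm.trans (hw.integral_eq hφ))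

lemma HasWeakDeriv.sobolevSeminorm_eq (hΩ : IsOpen Ω) (h : HasWeakDeriv Ω k v g) :
    sobolevSeminorm Ω k v = eLpNorm g 2 (volume.restrict Ω) :=
  le_antisymm (iInf₂_le g h) (le_iInf₂ fun _ hw => (eLpNorm_congr_ae (h.unique hΩ hw)).le)

lemma HasWeakDeriv.comp (h : HasWeakDeriv Ω 1 v v') (h' : HasWeakDeriv Ω l v' g) :
    HasWeakDeriv Ω (l + 1) v g := by
  refine ⟨h.1, h'.2.1, fun φ hsmooth hcompact htsupport => ?_⟩
  have hφ : IsTestFunction Ω φ := ⟨hsmooth, hcompact, htsupport⟩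
  have hfirst := h.integral_eq (hφ.iteratedDeriv l)
  rw [iteratedDeriv_one, ← iteratedDeriv_succ, h'.integral_eq hφ] at hfirst
  rw [hfirst]
  ring

lemma HasWeakDeriv.sub (h : HasWeakDeriv Ω k v v') (h' : HasWeakDeriv Ω k w g) :
    HasWeakDeriv Ω k (v - w) (v' - g) := by
  refine ⟨h.1.sub h'.1, h.2.1.sub h'.2.1, fun φ hsmooth hcompact htsupport => ?_⟩
  have hφ : IsTestFunction Ω φ := ⟨hsmooth, hcompact, htsupport⟩
  simp only [Pi.sub_apply, sub_mul]
  rw [integral_sub ((hφ.iteratedDeriv k).integrable_mul h.1).integrableOn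
      ((hφ.iteratedDeriv k).integrable_mul h'.1).integrableOn,
    integral_sub (hφ.integrable_mul h.2.1).integrableOn (hφ.integrable_mul h'.2.1).integrableOn,
    h.integral_eq hφ, h'.integral_eq hφ, mul_sub]

lemma integral_eq_zero_of_hasDerivAt_off_countable {f f' : ℝ → ℝ} (hf : Continuous f)
    (hcompact : HasCompactSupport f) {S : Set ℝ} (hS : S.Countable)
    (hderiv : ∀ x ∉ S, HasDerivAt f (f' x) x) (hf' : Integrable f') : ∫ x, f' x = 0 := by
  have hlim : Tendsto f (cocompact ℝ) (𝓝 0) := hcompact.is_zero_at_infty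
  have hsub : Tendsto (fun R => f R - f (-R)) atTop (𝓝 (0 - 0)) :=
    (hlim.mono_left atTop_le_cocompact).sub
      ((hlim.mono_left atBot_le_cocompact).comp tendsto_neg_atTop_atBot)
  rw [sub_zero] at hsub
  refine tendsto_nhds_unique
    (intervalIntegral_tendsto_integral hf' tendsto_neg_atTop_atBot tendsto_id) (hsub.congr' ?_)
  filter_upwards [eventually_ge_atTop 0] with R hR
  exact (integral_eq_of_hasDerivAt_off_countable_of_le f f' (neg_le_self hR) hS hf.continuousOn
    (fun x hx => hderiv x hx.2) hf'.intervalIntegrable).symm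

lemma hasWeakDeriv_one_of_hasDerivAt (hΩ : IsOpen Ω) (hv : ContinuousOn v Ω) {S : Set ℝ}
    (hS : S.Countable) (hderiv : ∀ x ∈ Ω \ S, HasDerivAt v (v' x) x)
    (hv' : LocallyIntegrableOn v' Ω) : HasWeakDeriv Ω 1 v v' := by
  have hv_loc : LocallyIntegrableOn v Ω := hv.locallyIntegrableOn hΩ.measurableSet
  refine ⟨hv_loc, hv', fun φ hsmooth hcompact htsupport => ?_⟩
  have hφ : IsTestFunction Ω φ := ⟨hsmooth, hcompact, htsupport⟩
  have hsub : tsupport (fun x => v x * φ x) ⊆ Ω := tsupport_mul_subset_right.trans htsupport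
  have hcont : Continuous fun x => v x * φ x :=
    (hv.mul hsmooth.continuous.continuousOn).continuous_of_tsupport_subset hΩ hsub
  have hprod : ∀ x ∉ S, HasDerivAt (fun x => v x * φ x)
      (v' x * φ x + v x * iteratedDeriv 1 φ x) x := by
    intro x hxS
    rw [iteratedDeriv_one]
    by_cases hx : x ∈ tsupport φ
    · exact (hderiv x ⟨htsupport hx, hxS⟩).mul
        (hsmooth.differentiable (by simp) x).hasDerivAt
    · have hφ_zero : φ =ᶠ[𝓝 x] 0 := notMem_tsupport_iff_eventuallyEq.1 hx
      simp only [hφ_zero.deriv_eq, hφ_zero.eq_of_nhds, Pi.zero_def, deriv_const, mul_zero, add_zero]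
      refine (hasDerivAt_const x (0 : ℝ)).congr_of_eventuallyEq ?_
      filter_upwards [hφ_zero] with y hy
      rw [hy, Pi.zero_apply, mul_zero]
  have hint' := hφ.integrable_mul hv'
  have hint := (hφ.iteratedDeriv 1).integrable_mul hv_loc
  have hzero := integral_eq_zero_of_hasDerivAt_off_countable hcont hcompact.mul_left hS hprod
    (hint'.add hint)
  rw [integral_add hint' hint] at hzero
  rw [(hφ.iteratedDeriv 1).setIntegral_mul, hφ.setIntegral_mul]
  linarith

lemma hasWeakDeriv_iteratedDeriv (hΩ : IsOpen Ω) (hf : ∀ x ∈ Ω, ContDiffAt ℝ ∞ f x) (l : ℕ) :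
    HasWeakDeriv Ω l f (iteratedDeriv l f) := by
  have hcont : ∀ {u : ℝ → ℝ}, (∀ x ∈ Ω, ContDiffAt ℝ ∞ u x) → ContinuousOn u Ω :=
    fun hu x hx => (hu x hx).continuousAt.continuousWithinAt
  induction l generalizing f with
  | zero =>
    rw [iteratedDeriv_zero]
    exact hasWeakDeriv_zero ((hcont hf).locallyIntegrableOn hΩ.measurableSet)
  | succ l ih =>
    have hf' : ∀ x ∈ Ω, ContDiffAt ℝ ∞ (deriv f) x := fun x hx =>
      ((hf x hx).fderiv_right (m := ∞) le_rfl).clm_apply contDiffAt_const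
    rw [iteratedDeriv_succ']
    exact (hasWeakDeriv_one_of_hasDerivAt hΩ (hcont hf) countable_empty
      (fun x hx => ((hf x hx.1).differentiableAt (by simp)).hasDerivAt)
      ((hcont hf').locallyIntegrableOn hΩ.measurableSet)).comp (ih hf')

lemma hasWeakDeriv_intervalIntegral (hab : a ≤ b) (hg : IntegrableOn g (Ioo a b)) :
    HasWeakDeriv (Ioo a b) 1 (fun x => ∫ t in a..x, g t) g := by
  have hgi : IntervalIntegrable g volume a b :=
    (intervalIntegrable_iff_integrableOn_Ioo_of_le hab).2 hg
  have hAC := hgi.absolutelyContinuousOnInterval_intervalIntegral (c := a) left_mem_uIcc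
  have hcont : ContinuousOn (fun x => ∫ t in a..x, g t) (Ioo a b) :=
    hAC.continuousOn.mono (Ioo_subset_Icc_self.trans Icc_subset_uIcc)
  refine ⟨hcont.locallyIntegrableOn measurableSet_Ioo, hg.locallyIntegrableOn,
    fun φ hsmooth hcompact htsupport => ?_⟩
  have hφ : IsTestFunction (Ioo a b) φ := ⟨hsmooth, hcompact, htsupport⟩
  have hderiv : ∫ x in a..b, deriv (fun x => ∫ t in a..x, g t) x * φ x
      = ∫ x in a..b, g x * φ x := by
    refine intervalIntegral.integral_congr_ae ?_
    filter_upwards [hgi.ae_hasDerivAt_integral] with x hx hmem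
    rw [(hx (uIoc_subset_uIcc hmem) a left_mem_uIcc).deriv]
  have hparts := hAC.integral_mul_deriv_eq_deriv_mul (g := φ)
    (ContDiffOn.absolutelyContinuousOnInterval (hsmooth.of_le (by simp)).contDiffOn)
  rw [hφ.eq_zero_of_notMem left_notMem_Ioo, hφ.eq_zero_of_notMem right_notMem_Ioo, mul_zero,
    mul_zero, sub_zero, zero_sub, hderiv] at hparts
  rwa [← integral_Ioc_eq_integral_Ioo, ← integral_Ioc_eq_integral_Ioo,
    ← intervalIntegral.integral_of_le hab, ← intervalIntegral.integral_of_le hab, iteratedDeriv_one,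
    pow_one, neg_one_mul]

lemma HasWeakDeriv.exists_const_of_succ_zero (hab : a < b)
    (h : HasWeakDeriv (Ioo a b) (l + 1) w 0) :
    ∃ c : ℝ, HasWeakDeriv (Ioo a b) l w fun _ => c := by
  obtain ⟨η, hη, hη_one⟩ := exists_isTestFunction_integral_eq_one hab
  refine ⟨(-1) ^ l * ∫ x in Ioo a b, w x * iteratedDeriv l η x, h.1,
    locallyIntegrableOn_const _, fun φ hsmooth hcompact htsupport => ?_⟩
  have hφ : IsTestFunction (Ioo a b) φ := ⟨hsmooth, hcompact, htsupport⟩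
  obtain ⟨θ, hθ, hθ_deriv⟩ := (hφ.sub (hη.const_mul (∫ x, φ x))).exists_deriv_eq hab <| by
    simp only [Pi.sub_apply]
    rw [integral_sub hφ.integrable (hη.integrable.const_mul _), integral_const_mul, hη_one, mul_one,
      sub_self]
  have hderiv : ∀ x, iteratedDeriv (l + 1) θ x
      = iteratedDeriv l φ x - (∫ x, φ x) * iteratedDeriv l η x := fun x => by
    rw [iteratedDeriv_succ', hθ_deriv,
      iteratedDeriv_sub (hφ.contDiff.of_le (by exact_mod_cast le_top)).contDiffAt
        ((hη.const_mul _).contDiff.of_le (by exact_mod_cast le_top)).contDiffAt,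
      iteratedDeriv_const_mul_field]
  have hzero := h.integral_eq hθ
  simp only [hderiv, mul_sub, mul_left_comm (w _), Pi.zero_apply, zero_mul, integral_zero, mul_zero]
    at hzero
  rw [integral_sub ((hφ.iteratedDeriv l).integrable_mul h.1).integrableOn
    (((hη.iteratedDeriv l).integrable_mul h.1).integrableOn.const_mul _), integral_const_mul,
    sub_eq_zero] at hzero
  have hφ_int : ∫ x in Ioo a b, φ x = ∫ x, φ x := by simpa using hφ.setIntegral_mul fun _ => 1
  have hsign : ((-1 : ℝ) ^ l) * (-1) ^ l = 1 := by rw [← mul_pow]; simp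
  rw [hzero, integral_const_mul, hφ_int, ← mul_assoc, ← mul_assoc, hsign, one_mul, mul_comm]

lemma HasWeakDeriv.exists_polynomial (hab : a < b) (h : HasWeakDeriv (Ioo a b) l w 0) :
    ∃ q : ℝ[X], q.degree < l ∧ w =ᵐ[volume.restrict (Ioo a b)] fun x => q.eval x := by
  induction l generalizing w with
  | zero =>
    refine ⟨0, by simp, ?_⟩
    simp only [eval_zero]
    exact ae_eq_of_forall_integral_mul_eq isOpen_Ioo h.1 h.2.1 fun φ hφ => by
      simpa using h.integral_eq hφ
  | succ l ih =>
    obtain ⟨c, hc⟩ := h.exists_const_of_succ_zero hab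
    set q₀ : ℝ[X] := C (c / l.factorial) * X ^ l with hq₀
    have hq₀_deriv : iteratedDeriv l (fun x => q₀.eval x) = fun _ => c := by
      rw [iteratedDeriv_polynomial_eval]
      funext x
      rw [hq₀, iterate_derivative_C_mul, iterate_derivative_X_pow_eq_natCast_mul,
        Nat.descFactorial_self, Nat.sub_self, pow_zero, mul_one, eval_mul, eval_C, eval_natCast,
        div_mul_cancel₀ _ (by exact_mod_cast l.factorial_ne_zero)]
    have hq₀_weak : HasWeakDeriv (Ioo a b) l (fun x => q₀.eval x) fun _ => c :=
      hq₀_deriv ▸ hasWeakDeriv_iteratedDeriv isOpen_Ioo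
        (fun _ _ => (contDiff_polynomial_eval q₀).contDiffAt) l
    obtain ⟨q₁, hq₁, hae⟩ := ih (sub_self (fun _ : ℝ => c) ▸ hc.sub hq₀_weak)
    have hlt : (l : WithBot ℕ) < (l + 1 : ℕ) := by exact_mod_cast l.lt_succ_self
    refine ⟨q₁ + q₀, (degree_add_le _ _).trans_lt (max_lt (hq₁.trans hlt) ?_), ?_⟩
    · exact (degree_C_mul_X_pow_le l _).trans_lt hlt
    · filter_upwards [hae] with x hx
      rw [eval_add, ← hx, Pi.sub_apply, sub_add_cancel]

end WeakDerivative

/-! ### Derivatives of splines -/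

section SplineDerivative

variable {ξ : ℕ → ℝ} {p n k : ℕ} {r : ℤ} {x : ℝ}

lemma contDiffAt_spline (c : ℕ → ℝ) (hx : OffKnots ξ 0 (n + p) x) :
    ContDiffAt ℝ ∞ (spline ξ p n c) x :=
  ContDiffAt.sum fun i hi => contDiffAt_const.mul <| contDiffAt_bspline <|
    hx.mono i.zero_le (by have := Finset.mem_range.1 hi; omega)

lemma integrable_spline (h : SortedKnots ξ 0 (n + p)) (c : ℕ → ℝ) :
    Integrable (spline ξ p n c) :=
  integrable_finsetSum _ fun i hi => (integrable_bspline (h.mono i.zero_le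
    (by have := Finset.mem_range.1 hi; omega))).const_mul _

/-- The B-spline coefficients of the derivative of the spline of degree `p` with the coefficients
`c`, with respect to the knots `ξ 1, ξ 2, …`. -/
noncomputable def derivCoeff (ξ : ℕ → ℝ) (p : ℕ) (c : ℕ → ℝ) (i : ℕ) : ℝ :=
  p * (c (i + 1) - c i) / (ξ (i + p + 1) - ξ (i + 1))

lemma IsOpenKnotVector.hasDerivAt_spline (h : IsOpenKnotVector p n ξ) (hp : 1 ≤ p) (c : ℕ → ℝ)
    (hx : OffKnots ξ 0 (n + p) x) :
    HasDerivAt (spline ξ p n c)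
      (spline (fun j => ξ (j + 1)) (p - 1) (n - 1) (derivCoeff ξ p c) x) x := by
  obtain ⟨q, rfl⟩ : ∃ q, p = q + 1 := ⟨p - 1, by omega⟩
  obtain ⟨m, rfl⟩ : ∃ m, n = m + 1 := ⟨n - 1, by have := h.lt; omega⟩
  have hderiv : HasDerivAt (spline ξ (q + 1) (m + 1) c)
      (∑ i ∈ Finset.range (m + 1), c i * bsplineDeriv ξ q i x) x :=
    HasDerivAt.fun_sum fun i hi => by
      rw [Finset.mem_range] at hi
      exact (hasDerivAt_bspline (h.sorted (by omega)) (hx.mono i.zero_le (by omega))).const_mul _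
  refine hderiv.congr_deriv ?_
  set b : ℕ → ℝ := fun i => bspline ξ q i x / (ξ (i + q + 1) - ξ i) with hb
  have hfirst : b 0 = 0 := by
    simp only [hb]
    rw [bspline_eq_zero_of_knots_eq (h.sorted (by omega))
      (by rw [h.eq_zero _ (by omega), h.eq_zero _ (by omega)]), zero_div]
  have hlast : b (m + 1) = 0 := by
    simp only [hb]
    rw [bspline_eq_zero_of_knots_eq (h.sorted (by omega))
      (by rw [h.eq_one _ (by omega) (by omega), h.eq_one _ (by omega) (by omega)]), zero_div]
  have hleft : ∀ i, c i * bsplineDeriv ξ q i x = (q + 1) * (c i * b i - c i * b (i + 1)) := by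
    intro i
    simp only [bsplineDeriv, hb, show i + 1 + q + 1 = i + q + 2 by omega]
    ring
  have hright : ∀ i, derivCoeff ξ (q + 1) c i * bspline (fun j => ξ (j + 1)) q i x
      = (q + 1) * (c (i + 1) * b (i + 1) - c i * b (i + 1)) := by
    intro i
    simp only [derivCoeff, hb, bspline_shift, Nat.cast_add_one,
      show i + 1 + q + 1 = i + (q + 1) + 1 by omega]
    ring
  simp only [spline, Nat.add_sub_cancel, hleft, hright]
  rw [← Finset.mul_sum, ← Finset.mul_sum, Finset.sum_sub_distrib, Finset.sum_sub_distrib,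
    Finset.sum_range_succ' (fun i => c i * b i), Finset.sum_range_succ (fun i => c i * b (i + 1)),
    hfirst, hlast]
  ring

lemma IsOpenKnotVector.shift (h : IsOpenKnotVector p n ξ) (hk : k ≤ p) :
    IsOpenKnotVector (p - k) (n - k) (fun j => ξ (j + k)) where
  mono i j hij hj := h.mono _ _ (by omega) (by have := h.lt; omega)
  eq_zero j hj := h.eq_zero _ (by omega)
  pos j hj hj' := h.pos _ (by omega) (by have := h.lt; omega)
  lt_one j hj := h.lt_one _ (by omega)
  eq_one j hj hj' := h.eq_one _ (by omega) (by have := h.lt; omega)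

lemma HasRegularity.shift (hr : HasRegularity p n ξ r) (hkp : k ≤ p) (hkn : k ≤ n) :
    HasRegularity (p - k) (n - k) (fun j => ξ (j + k)) (r - k) := by
  intro j hj hpos hone
  have hmult := hr (j + k) (by omega) hpos hone
  have hle : multiplicity (p - k) (n - k) (fun j => ξ (j + k)) (ξ (j + k))
      ≤ multiplicity p n ξ (ξ (j + k)) :=
    Set.ncard_le_ncard_of_injOn (· + k) (fun i hi => ⟨by have := hi.1; omega, hi.2⟩)
      (add_left_injective k).injOn ((finite_Iic (n + p)).subset fun i hi => hi.1)
  change (multiplicity _ _ _ (ξ (j + k)) : ℤ) ≤ _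
  omega

lemma OffKnots.shift {a b a' b' : ℕ} (h : OffKnots ξ a b x) (ha : a ≤ a' + k) (hb : b' + k ≤ b) :
    OffKnots (fun j => ξ (j + k)) a' b' x := by
  rintro ⟨i, hi, rfl⟩
  exact h ⟨i + k, ⟨by have := hi.1; omega, by have := hi.2; omega⟩, rfl⟩

lemma reducedSplineSpace_succ (k : ℕ) (ξ : ℕ → ℝ) (p n : ℕ) :
    reducedSplineSpace (k + 1) ξ p n
      = reducedSplineSpace 1 (fun j => ξ (j + k)) (p - k) (n - k) := by
  simp only [reducedSplineSpace, Nat.sub_sub, add_assoc, add_comm 1 k]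

lemma mem_reducedSplineSpace_iff {s : ℝ → ℝ} : s ∈ reducedSplineSpace k ξ p n ↔
    ∃ c : ℕ → ℝ, spline (fun j => ξ (j + k)) (p - k) (n - k) c = s :=
  mem_splineSpace_iff

lemma IsOpenKnotVector.exists_deriv_eq (h : IsOpenKnotVector p n ξ) (hp : 1 ≤ p) {s : ℝ → ℝ}
    (hs : s ∈ splineSpace ξ p n) :
    ∃ t ∈ reducedSplineSpace 1 ξ p n, ∀ x, OffKnots ξ 0 (n + p) x → HasDerivAt s (t x) x := by
  obtain ⟨c, rfl⟩ := mem_splineSpace_iff.1 hs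
  exact ⟨_, mem_reducedSplineSpace_iff.2 ⟨derivCoeff ξ p c, rfl⟩,
    fun x hx => h.hasDerivAt_spline hp c hx⟩

lemma IsOpenKnotVector.exists_iteratedDeriv_eq (h : IsOpenKnotVector p n ξ) (hk : k ≤ p)
    {s : ℝ → ℝ} (hs : s ∈ splineSpace ξ p n) : ∃ t ∈ reducedSplineSpace k ξ p n,
      ∀ x, OffKnots ξ 0 (n + p) x → iteratedDeriv k s x = t x := by
  induction k with
  | zero => exact ⟨s, hs, fun x _ => by rw [iteratedDeriv_zero]⟩
  | succ k ih =>
    obtain ⟨t, ht, hst⟩ := ih (by omega)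
    obtain ⟨u, hu, htu⟩ := (h.shift (by omega : k ≤ p)).exists_deriv_eq (by omega) ht
    refine ⟨u, (reducedSplineSpace_succ k ξ p n).symm ▸ hu, fun x hx => ?_⟩
    have heq : iteratedDeriv k s =ᶠ[𝓝 x] t := hx.eventually.mono hst
    have hlt := h.lt
    rw [iteratedDeriv_succ, heq.deriv_eq, (htu x (hx.shift (by omega) (by omega))).deriv]

lemma IsOpenKnotVector.lt_support_succ (h : IsOpenKnotVector p n ξ) (hr : HasRegularity p n ξ r)
    (hr0 : 0 ≤ r) (hp : 1 ≤ p) {i : ℕ} (hi : i < n - 1) : ξ (i + 1) < ξ (i + p + 1) := by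
  have hlt := (h.shift hp).lt_support (hr.shift hp (hp.trans h.lt.le)) (by omega) hi
  rwa [show i + (p - 1) + 1 + 1 = i + p + 1 by omega] at hlt

lemma IsOpenKnotVector.exists_eq_deriv (h : IsOpenKnotVector p n ξ) (hr : HasRegularity p n ξ r)
    (hr0 : 0 ≤ r) (hp : 1 ≤ p) {t : ℝ → ℝ} (ht : t ∈ reducedSplineSpace 1 ξ p n) :
    ∃ s ∈ splineSpace ξ p n, ∀ x, OffKnots ξ 0 (n + p) x → HasDerivAt s (t x) x := by
  obtain ⟨d, rfl⟩ := mem_reducedSplineSpace_iff.1 ht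
  set c : ℕ → ℝ := fun i => ∑ k ∈ Finset.range i, d k * (ξ (k + p + 1) - ξ (k + 1)) / p
  have hcoeff : ∀ i < n - 1, derivCoeff ξ p c i = d i := by
    intro i hi
    have hknots := sub_ne_zero.2 (h.lt_support_succ hr hr0 hp hi).ne'
    have hp0 : (p : ℝ) ≠ 0 := by exact_mod_cast (by omega : p ≠ 0)
    simp only [derivCoeff, c, Finset.sum_range_succ, add_sub_cancel_left]
    field_simp
  refine ⟨_, spline_mem_splineSpace c, fun x hx => (h.hasDerivAt_spline hp c hx).congr_deriv ?_⟩
  exact Finset.sum_congr rfl fun i hi => by rw [hcoeff i (Finset.mem_range.1 hi)]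

lemma IsOpenKnotVector.exists_eq_iteratedDeriv (h : IsOpenKnotVector p n ξ)
    (hr : HasRegularity p n ξ r) (hkr : (k : ℤ) ≤ r + 1) (hk : k ≤ p) {t : ℝ → ℝ}
    (ht : t ∈ reducedSplineSpace k ξ p n) :
    ∃ s ∈ splineSpace ξ p n, ∀ x, OffKnots ξ 0 (n + p) x → iteratedDeriv k s x = t x := by
  induction k generalizing t with
  | zero => exact ⟨t, ht, fun x _ => by rw [iteratedDeriv_zero]⟩
  | succ k ih =>
    have hlt := h.lt
    rw [reducedSplineSpace_succ] at ht
    obtain ⟨u, hu, hut⟩ := (h.shift (by omega : k ≤ p)).exists_eq_deriv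
      (hr.shift (by omega) (by omega)) (by push_cast at hkr; omega) (by omega) ht
    obtain ⟨s, hs, hsu⟩ := ih (by push_cast at hkr; omega) (by omega) hu
    refine ⟨s, hs, fun x hx => ?_⟩
    have heq : iteratedDeriv k s =ᶠ[𝓝 x] u := hx.eventually.mono hsu
    rw [iteratedDeriv_succ, heq.deriv_eq, (hut x (hx.shift (by omega) (by omega))).deriv]

lemma IsOpenKnotVector.continuousOn_spline (h : IsOpenKnotVector p n ξ)
    (hr : HasRegularity p n ξ r) (hr0 : 0 ≤ r) (c : ℕ → ℝ) :
    ContinuousOn (spline ξ p n c) (Ioo 0 1) := by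
  refine continuousOn_finsetSum _ fun i hi x hx => ?_
  rw [Finset.mem_range] at hi
  have hsimple : ∀ j, j + p ≤ n + p → ξ j = x → ξ (j + p) ≠ x := fun j hj hjx =>
    hjx ▸ (h.lt_of_hasRegularity hr hj (hjx ▸ hx.1) (hjx ▸ hx.2) (by omega)).ne'
  have hcont : ContinuousAt (bspline ξ p i) x := continuousAt_bspline (h.sorted (by omega))
    (fun hknots => hsimple i (by omega) hknots.1 hknots.2)
    (fun hknots => hsimple (i + 1) (by omega) hknots.1 (by rw [add_right_comm]; exact hknots.2))
  exact (continuousAt_const.mul hcont).continuousWithinAt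

lemma ae_restrict_of_offKnots {P : ℝ → Prop} {a b : ℕ} {Ω : Set ℝ} (hΩ : MeasurableSet Ω)
    (hP : ∀ x ∈ Ω, OffKnots ξ a b x → P x) : ∀ᵐ x ∂(volume.restrict Ω), P x := by
  rw [ae_restrict_iff' hΩ]
  filter_upwards [ae_offKnots ξ a b] with x hx hmem using hP x hmem hx

lemma IsOpenKnotVector.hasWeakDeriv_deriv (h : IsOpenKnotVector p n ξ) (hr : HasRegularity p n ξ r)
    (hr0 : 0 ≤ r) (hp : 1 ≤ p) {s : ℝ → ℝ} (hs : s ∈ splineSpace ξ p n) :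
    HasWeakDeriv (Ioo 0 1) 1 s (deriv s) := by
  obtain ⟨c, rfl⟩ := mem_splineSpace_iff.1 hs
  have hderiv : ∀ x, OffKnots ξ 0 (n + p) x → HasDerivAt (spline ξ p n c) _ x :=
    fun _ hx => h.hasDerivAt_spline hp c hx
  refine hasWeakDeriv_one_of_hasDerivAt isOpen_Ioo (h.continuousOn_spline hr hr0 c)
    (finite_knots ξ 0 (n + p)).countable
    (fun x hx => (hderiv x hx.2).differentiableAt.hasDerivAt) ?_
  exact ((integrable_spline ((h.shift hp).sorted le_rfl) _).locallyIntegrable.locallyIntegrableOn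
    _).congr (ae_restrict_of_offKnots measurableSet_Ioo fun x _ hx => (hderiv x hx).deriv.symm)

lemma IsOpenKnotVector.hasWeakDeriv_iteratedDeriv (h : IsOpenKnotVector p n ξ)
    (hr : HasRegularity p n ξ r) {l : ℕ} (hklr : (k : ℤ) + l ≤ r + 1) (hkl : k + l ≤ p) {s : ℝ → ℝ}
    (hs : s ∈ splineSpace ξ p n) :
    HasWeakDeriv (Ioo 0 1) l (iteratedDeriv k s) (iteratedDeriv (k + l) s) := by
  induction l generalizing k with
  | zero =>
    obtain ⟨t, ht, hst⟩ := h.exists_iteratedDeriv_eq (by omega : k ≤ p) hs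
    obtain ⟨c, rfl⟩ := mem_reducedSplineSpace_iff.1 ht
    refine hasWeakDeriv_zero (((integrable_spline ((h.shift (by omega)).sorted le_rfl)
      c).locallyIntegrable.locallyIntegrableOn _).congr ?_)
    exact ae_restrict_of_offKnots measurableSet_Ioo fun x _ hx => (hst x hx).symm
  | succ l ih =>
    have hlt := h.lt
    obtain ⟨t, ht, hst⟩ := h.exists_iteratedDeriv_eq (by omega : k ≤ p) hs
    have hst_near : ∀ x, OffKnots ξ 0 (n + p) x → t =ᶠ[𝓝 x] iteratedDeriv k s :=
      fun x hx => hx.eventually.mono fun y hy => (hst y hy).symm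
    have hone : HasWeakDeriv (Ioo 0 1) 1 (iteratedDeriv k s) (iteratedDeriv (k + 1) s) := by
      refine ((h.shift (by omega : k ≤ p)).hasWeakDeriv_deriv (hr.shift (by omega) (by omega))
        (by push_cast at hklr; omega) (by omega) ht).congr ?_ ?_
      · exact ae_restrict_of_offKnots measurableSet_Ioo fun x _ hx => (hst_near x hx).eq_of_nhds
      · refine ae_restrict_of_offKnots measurableSet_Ioo
          fun x _ (hx : OffKnots ξ 0 (n + p) x) => ?_
        rw [iteratedDeriv_succ, (hst_near x hx).deriv_eq]
    rw [show k + (l + 1) = k + 1 + l by omega]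
    exact hone.comp (ih (by push_cast at hklr ⊢; omega) (by omega))

end SplineDerivative

/-! ### Iterated primitives -/

section Primitive

variable {v w g : ℝ → ℝ} {l : ℕ} {a b : ℝ}

/-- The primitive of `g` with base point `a`. Its iterates produce functions with prescribed weak
derivative of any order. -/
noncomputable def primitive (a : ℝ) (g : ℝ → ℝ) (x : ℝ) : ℝ := ∫ t in a..x, g t

lemma integrableOn_primitive (hab : a ≤ b) (hg : IntegrableOn g (Ioo a b)) :
    IntegrableOn (primitive a g) (Ioo a b) := by
  rw [← intervalIntegrable_iff_integrableOn_Ioo_of_le hab] at hg ⊢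
  exact (hg.absolutelyContinuousOnInterval_intervalIntegral
    left_mem_uIcc).continuousOn.intervalIntegrable

lemma integrableOn_iterate_primitive (hab : a ≤ b) (hg : IntegrableOn g (Ioo a b)) (l : ℕ) :
    IntegrableOn ((primitive a)^[l] g) (Ioo a b) := by
  induction l with
  | zero => exact hg
  | succ l ih =>
    rw [Function.iterate_succ_apply']
    exact integrableOn_primitive hab ih

lemma HasWeakDeriv.iterate_primitive (hab : a ≤ b) (h : HasWeakDeriv (Ioo a b) l v g)
    (hv : IntegrableOn v (Ioo a b)) (k : ℕ) :
    HasWeakDeriv (Ioo a b) (l + k) ((primitive a)^[k] v) g := by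
  induction k with
  | zero => exact h
  | succ k ih =>
    rw [Function.iterate_succ_apply']
    exact (hasWeakDeriv_intervalIntegral hab (integrableOn_iterate_primitive hab hv k)).comp ih

lemma hasWeakDeriv_iterate_primitive (hab : a ≤ b) (hg : IntegrableOn g (Ioo a b)) (l : ℕ) :
    HasWeakDeriv (Ioo a b) l ((primitive a)^[l] g) g := by
  simpa only [zero_add] using
    (hasWeakDeriv_zero hg.locallyIntegrableOn).iterate_primitive hab hg l

lemma abs_primitive_le (hg : IntegrableOn g (Ioo a b)) {x : ℝ} (hx : x ∈ Ioo a b) :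
    |primitive a g x| ≤ ∫ t in Ioo a b, |g t| := by
  have hsub : Ioo a x ⊆ Ioo a b := Ioo_subset_Ioo_right hx.2.le
  rw [primitive, intervalIntegral.integral_of_le hx.1.le, integral_Ioc_eq_integral_Ioo]
  exact abs_integral_le_integral_abs.trans
    (setIntegral_mono_set hg.abs (ae_of_all _ fun t => abs_nonneg (g t)) hsub.eventuallyLE)

lemma integral_abs_iterate_primitive_le (hab : a ≤ b) (hg : IntegrableOn g (Ioo a b)) (l : ℕ) :
    ∫ x in Ioo a b, |(primitive a)^[l] g x| ≤ (b - a) ^ l * ∫ x in Ioo a b, |g x| := by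
  induction l with
  | zero => rw [pow_zero, one_mul, Function.iterate_zero_apply]
  | succ l ih =>
    have hl := integrableOn_iterate_primitive hab hg l
    simp only [Function.iterate_succ_apply']
    calc ∫ x in Ioo a b, |primitive a ((primitive a)^[l] g) x|
        ≤ ∫ _ in Ioo a b, ∫ t in Ioo a b, |(primitive a)^[l] g t| :=
          setIntegral_mono_on (integrableOn_primitive hab hl).abs
            (integrableOn_const measure_Ioo_lt_top.ne) measurableSet_Ioo
            fun _ hx => abs_primitive_le hl hx
      _ = (b - a) * ∫ t in Ioo a b, |(primitive a)^[l] g t| := by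
          rw [setIntegral_const, smul_eq_mul, Real.volume_real_Ioo_of_le hab]
      _ ≤ (b - a) * ((b - a) ^ l * ∫ x in Ioo a b, |g x|) :=
          mul_le_mul_of_nonneg_left ih (sub_nonneg.2 hab)
      _ = (b - a) ^ (l + 1) * ∫ x in Ioo a b, |g x| := by ring

lemma HasWeakDeriv.exists_eq_add_polynomial (hab : a < b) (hv : HasWeakDeriv (Ioo a b) l v g)
    (hw : HasWeakDeriv (Ioo a b) l w g) :
    ∃ q : ℝ[X], q.degree < l ∧ ∀ᵐ x, x ∈ Ioo a b → v x = w x + q.eval x := by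
  obtain ⟨q, hq, heq⟩ := (sub_self g ▸ hv.sub hw).exists_polynomial hab
  rw [EventuallyEq, ae_restrict_iff' measurableSet_Ioo] at heq
  exact ⟨q, hq, heq.mono fun x hx hmem => sub_eq_iff_eq_add'.1 (hx hmem)⟩

end Primitive

/-! ### Locality of the projection -/

section Element

variable {ξ : ℕ → ℝ} {p n i j l : ℕ} {r : ℤ} {v w g : ℝ → ℝ} {x : ℝ}

lemma IsElement.le (hi : IsElement p n ξ i) (h : IsOpenKnotVector p n ξ) : p ≤ i := by
  by_contra! hlt
  exact hi.2.ne (by rw [h.eq_zero i hlt.le, h.eq_zero (i + 1) hlt])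

lemma IsElement.lt (hi : IsElement p n ξ i) (h : IsOpenKnotVector p n ξ) : i < n := by
  by_contra! hle
  exact hi.2.ne (by rw [h.eq_one i hle (by have := hi.1; omega), h.eq_one (i + 1) (by omega) hi.1])

lemma IsOpenKnotVector.exists_isElement_mem (h : IsOpenKnotVector p n ξ) (hx : x ∈ Ioo 0 1)
    (hoff : OffKnots ξ 0 (n + p) x) : ∃ i, IsElement p n ξ i ∧ x ∈ element ξ i := by
  classical
  have hn : x < ξ n := hx.2.trans_eq (h.eq_one n le_rfl (by omega)).symm
  have hex : ∃ k, x < ξ k := ⟨n, hn⟩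
  have hle : Nat.find hex ≤ n := Nat.find_min' hex hn
  obtain ⟨i, hi⟩ : ∃ i, Nat.find hex = i + 1 := Nat.exists_eq_succ_of_ne_zero fun hzero =>
    ((Nat.find_eq_zero hex).1 hzero).not_gt ((h.eq_zero 0 p.zero_le).trans_lt hx.1)
  have hright : x < ξ (i + 1) := hi ▸ Nat.find_spec hex
  have hleft : ξ i < x := (not_lt.1 (Nat.find_min hex (by omega))).lt_of_ne
    (hoff.ne i.zero_le (by omega)).symm
  exact ⟨i, ⟨by omega, hleft.trans hright⟩, hleft, hright⟩

lemma IsOpenKnotVector.supportExtension_subset (h : IsOpenKnotVector p n ξ) (hi : i < n) :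
    supportExtension ξ p i ⊆ Ioo 0 1 :=
  Ioo_subset_Ioo (h.nonneg (by omega)) (h.le_one (by omega))

lemma IsOpenKnotVector.element_subset (h : IsOpenKnotVector p n ξ) (hi : i < n) :
    element ξ i ⊆ supportExtension ξ p i :=
  Ioo_subset_Ioo (h.mono _ _ (by omega) (by omega)) (h.mono _ _ (by omega) (by omega))

lemma IsOpenKnotVector.support_subset (h : IsOpenKnotVector p n ξ) (hi : i < n)
    (hj : j ∈ Finset.Icc (i - p) i) :
    Ioo (ξ j) (ξ (j + p + 1)) ⊆ supportExtension ξ p i := by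
  rw [Finset.mem_Icc] at hj
  exact Ioo_subset_Ioo (h.mono _ _ hj.1 (by omega)) (h.mono _ _ (by omega) (by omega))

lemma IsOpenKnotVector.iteratedDeriv_proj_eq_sum (h : IsOpenKnotVector p n ξ) (hi : i < n)
    (hx : x ∈ element ξ i) (l : ℕ) (v : ℝ → ℝ) :
    iteratedDeriv l (proj ξ p n v) x
      = ∑ j ∈ Finset.Icc (i - p) i, dualFunctional ξ p j v * iteratedDeriv l (bspline ξ p j) x := by
  have hsorted := h.sorted (a := 0) le_rfl
  have hoff := hsorted.offKnots_of_mem_Ioo i.zero_le (by omega) hx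
  have hsub : Finset.Icc (i - p) i ⊆ Finset.range n := fun j hj => by
    rw [Finset.mem_Icc] at hj
    exact Finset.mem_range.2 (by omega)
  calc iteratedDeriv l (proj ξ p n v) x
      = ∑ j ∈ Finset.range n, dualFunctional ξ p j v * iteratedDeriv l (bspline ξ p j) x := by
        unfold proj
        rw [iteratedDeriv_fun_sum fun j hj => ?_]
        · exact Finset.sum_congr rfl fun j _ => iteratedDeriv_const_mul_field _ _
        · have hj := Finset.mem_range.1 hj
          exact contDiffAt_const.mul ((contDiffAt_bspline (hoff.mono j.zero_le (by omega))).of_le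
            (by exact_mod_cast le_top))
    _ = _ := (Finset.sum_subset hsub fun j hj hj' => by
        rw [Finset.mem_range] at hj
        rw [Finset.mem_Icc] at hj'
        rw [(hsorted.bspline_eventuallyEq_zero_of_mem_Ioo i.zero_le (by omega) hx j.zero_le
          (by omega) (by omega)).iteratedDeriv_eq, iteratedDeriv_fun_const_zero, mul_zero]).symm

lemma IsOpenKnotVector.proj_polynomial (h : IsOpenKnotVector p n ξ) (hr : HasRegularity p n ξ r)
    (hr1 : -1 ≤ r) {q : ℝ[X]} (hq : q.natDegree ≤ p) :
    EqOn (proj ξ p n fun y => q.eval y) (fun y => q.eval y) (Ico 0 1) := by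
  obtain ⟨c, hc⟩ := exists_spline_eq_eval (h.sorted le_rfl) hq
  rw [h.eq_zero p le_rfl, h.eq_one n le_rfl (by omega)] at hc
  have hproj : proj ξ p n (fun y => q.eval y) = proj ξ p n (spline ξ p n c) := by
    funext x
    refine Finset.sum_congr rfl fun j hj => ?_
    rw [Finset.mem_range] at hj
    rw [dualFunctional_congr (h.mono _ _ (by omega) (by omega)) (ae_of_all _ fun y hy => (hc y
      ⟨(h.nonneg (by omega)).trans hy.1.le, hy.2.trans_le (h.le_one (by omega))⟩).symm)]
  intro x hx
  rw [hproj, h.proj_spline hr hr1, hc x hx]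

/-- Two functions with the same weak derivative of order `l ≤ p + 1` on the support extension differ
there by a polynomial of degree less than `l`, which the projection reproduces. -/
lemma IsOpenKnotVector.iteratedDeriv_proj_eq_of_hasWeakDeriv (h : IsOpenKnotVector p n ξ)
    (hr : HasRegularity p n ξ r) (hr1 : -1 ≤ r) (hi : i < n) (hl : l ≤ p + 1)
    (hv : HasWeakDeriv (supportExtension ξ p i) l v g)
    (hw : HasWeakDeriv (supportExtension ξ p i) l w g)
    (hwi : IntegrableOn w (supportExtension ξ p i)) (hx : x ∈ element ξ i) :
    iteratedDeriv l (proj ξ p n v) x = iteratedDeriv l (proj ξ p n w) x := by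
  have hx_ext := h.element_subset hi hx
  obtain ⟨q, hq, hvw⟩ := hv.exists_eq_add_polynomial (hx_ext.1.trans hx_ext.2) hw
  have hqp : q.natDegree ≤ p := natDegree_le_iff_coeff_eq_zero.2 fun m hm =>
    (degree_lt_iff_coeff_zero q l).1 hq m (by omega)
  have hdual : ∀ j ∈ Finset.Icc (i - p) i, dualFunctional ξ p j v
      = dualFunctional ξ p j w + dualFunctional ξ p j fun y => q.eval y := by
    intro j hj
    have hsub := h.support_subset hi hj
    rw [Finset.mem_Icc] at hj
    have hj_lt := h.lt_support hr hr1 (by omega : j < n)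
    rw [dualFunctional_congr hj_lt.le (hvw.mono fun y hy hmem => hy (hsub hmem)),
      dualFunctional_add (h.sorted (by omega)) hj_lt
        ((intervalIntegrable_iff_integrableOn_Ioo_of_le hj_lt.le).2 (hwi.mono_set hsub))
        (q.continuous.intervalIntegrable _ _)]
  have hpoly : iteratedDeriv l (proj ξ p n fun y => q.eval y) x = 0 := by
    have hnear : proj ξ p n (fun y => q.eval y) =ᶠ[𝓝 x] fun y => q.eval y :=
      (h.proj_polynomial hr hr1 hqp).eventuallyEq_of_mem <| mem_of_superset
        (isOpen_Ioo.mem_nhds (h.supportExtension_subset hi hx_ext)) Ioo_subset_Ico_self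
    rw [hnear.iteratedDeriv_eq, iteratedDeriv_polynomial_eval,
      iterate_derivative_eq_zero_of_degree_lt hq]
    exact eval_zero
  calc iteratedDeriv l (proj ξ p n v) x
      = iteratedDeriv l (proj ξ p n w) x + iteratedDeriv l (proj ξ p n fun y => q.eval y) x := by
        simp only [h.iteratedDeriv_proj_eq_sum hi hx, ← Finset.sum_add_distrib, ← add_mul]
        exact Finset.sum_congr rfl fun j hj => by rw [hdual j hj]
    _ = iteratedDeriv l (proj ξ p n w) x := by rw [hpoly, add_zero]

end Element

/-! ### The commuting projections -/

section CommutingProjection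

variable {ξ : ℕ → ℝ} {p n k l : ℕ} {r : ℤ} {v g gk t : ℝ → ℝ} {x : ℝ}

lemma iteratedDeriv_iteratedDeriv (k l : ℕ) (f : ℝ → ℝ) :
    iteratedDeriv l (iteratedDeriv k f) = iteratedDeriv (k + l) f := by
  rw [iteratedDeriv_eq_iterate, iteratedDeriv_eq_iterate, iteratedDeriv_eq_iterate, add_comm,
    Function.iterate_add_apply]

/-- The projection `Π^{c,k}_{p-k}`: the derivative of order `k` of the projection of the `k`-fold
primitive. The cases `k = 0, 1, 2` are `proj`, `projC1` and `projC2`. -/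
noncomputable def projC (k : ℕ) (ξ : ℕ → ℝ) (p n : ℕ) (v : ℝ → ℝ) : ℝ → ℝ :=
  iteratedDeriv k (proj ξ p n ((primitive 0)^[k] v))

lemma projC_zero : projC 0 ξ p n v = proj ξ p n v := iteratedDeriv_zero

lemma projC_one : projC 1 ξ p n v = projC1 ξ p n v := iteratedDeriv_one

lemma projC_two : projC 2 ξ p n v = projC2 ξ p n v := by
  rw [projC, iteratedDeriv_succ, iteratedDeriv_one]
  rfl

lemma IsOpenKnotVector.projC_eq_iteratedDeriv_proj (h : IsOpenKnotVector p n ξ)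
    (hr : HasRegularity p n ξ r) (hr1 : -1 ≤ r) (hk : k ≤ p + 1)
    (hv : HasWeakDeriv (Ioo 0 1) k v g) (hg : IntegrableOn g (Ioo 0 1)) (hx : x ∈ Ioo 0 1)
    (hoff : OffKnots ξ 0 (n + p) x) :
    projC k ξ p n g x = iteratedDeriv k (proj ξ p n v) x := by
  obtain ⟨i, hi, hxi⟩ := h.exists_isElement_mem hx hoff
  have hin := hi.lt h
  have hsub := h.supportExtension_subset hin
  exact (h.iteratedDeriv_proj_eq_of_hasWeakDeriv hr hr1 hin hk (hv.mono hsub)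
    ((hasWeakDeriv_iterate_primitive zero_le_one hg k).mono hsub)
    ((integrableOn_iterate_primitive zero_le_one hg k).mono_set hsub) hxi).symm

lemma IsOpenKnotVector.projC_ae_eq_iteratedDeriv_proj (h : IsOpenKnotVector p n ξ)
    (hr : HasRegularity p n ξ r) (hr1 : -1 ≤ r) (hk : k ≤ p + 1)
    (hv : HasWeakDeriv (Ioo 0 1) k v g) (hg : IntegrableOn g (Ioo 0 1)) :
    projC k ξ p n g =ᵐ[volume.restrict (Ioo 0 1)] iteratedDeriv k (proj ξ p n v) :=
  ae_restrict_of_offKnots measurableSet_Ioo fun _ hx hoff =>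
    h.projC_eq_iteratedDeriv_proj hr hr1 hk hv hg hx hoff

lemma IsOpenKnotVector.projC_ae_eq_iteratedDeriv_projC (h : IsOpenKnotVector p n ξ)
    (hr : HasRegularity p n ξ r) (hr1 : -1 ≤ r) (hkl : k + l ≤ p + 1)
    (hvk : HasWeakDeriv (Ioo 0 1) k v gk) (hgk : IntegrableOn gk (Ioo 0 1))
    (hv : HasWeakDeriv (Ioo 0 1) (k + l) v g) (hg : IntegrableOn g (Ioo 0 1)) :
    projC (k + l) ξ p n g =ᵐ[volume.restrict (Ioo 0 1)] iteratedDeriv l (projC k ξ p n gk) := by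
  refine ae_restrict_of_offKnots measurableSet_Ioo fun x hx
    (hoff : OffKnots ξ 0 (n + p) x) => ?_
  have hnear : projC k ξ p n gk =ᶠ[𝓝 x] iteratedDeriv k (proj ξ p n v) := by
    filter_upwards [isOpen_Ioo.mem_nhds hx, hoff.eventually] with y hy hy_off
    exact h.projC_eq_iteratedDeriv_proj hr hr1 (by omega) hvk hgk hy hy_off
  rw [h.projC_eq_iteratedDeriv_proj hr hr1 hkl hv hg hx hoff, hnear.iteratedDeriv_eq,
    iteratedDeriv_iteratedDeriv]

lemma IsOpenKnotVector.hasWeakDeriv_projC (h : IsOpenKnotVector p n ξ)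
    (hr : HasRegularity p n ξ r) (hklr : (k : ℤ) + l ≤ r + 1) (hkl : k + l ≤ p)
    (hvk : HasWeakDeriv (Ioo 0 1) k v gk) (hgk : IntegrableOn gk (Ioo 0 1))
    (hv : HasWeakDeriv (Ioo 0 1) (k + l) v g) (hg : IntegrableOn g (Ioo 0 1)) :
    HasWeakDeriv (Ioo 0 1) l (projC k ξ p n gk) (projC (k + l) ξ p n g) :=
  (h.hasWeakDeriv_iteratedDeriv hr hklr hkl (spline_mem_splineSpace _)).congr
    (h.projC_ae_eq_iteratedDeriv_proj hr (by omega) (by omega) hvk hgk).symm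
    (h.projC_ae_eq_iteratedDeriv_proj hr (by omega) (by omega) hv hg).symm

lemma IsOpenKnotVector.exists_projC_ae_eq (h : IsOpenKnotVector p n ξ) (hk : k ≤ p) (v : ℝ → ℝ) :
    ∃ s ∈ reducedSplineSpace k ξ p n, projC k ξ p n v =ᵐ[volume.restrict (Ioo 0 1)] s := by
  obtain ⟨s, hs, heq⟩ := h.exists_iteratedDeriv_eq hk (spline_mem_splineSpace _)
  exact ⟨s, hs, ae_restrict_of_offKnots measurableSet_Ioo fun x _ hx => heq x hx⟩

lemma IsOpenKnotVector.projC_ae_eq_self (h : IsOpenKnotVector p n ξ) (hr : HasRegularity p n ξ r)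
    (hkr : (k : ℤ) ≤ r + 1) (hk : k ≤ p) (ht : t ∈ reducedSplineSpace k ξ p n) :
    projC k ξ p n t =ᵐ[volume.restrict (Ioo 0 1)] t := by
  obtain ⟨s, hs, hst⟩ := h.exists_eq_iteratedDeriv hr hkr hk ht
  have hst_ae : iteratedDeriv k s =ᵐ[volume.restrict (Ioo 0 1)] t :=
    ae_restrict_of_offKnots measurableSet_Ioo fun x _ hx => hst x hx
  have hweak : HasWeakDeriv (Ioo 0 1) k s t := by
    have hs_weak := h.hasWeakDeriv_iteratedDeriv (k := 0) hr (l := k) (by simpa using hkr)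
      (by omega) hs
    rw [zero_add, iteratedDeriv_zero] at hs_weak
    exact hs_weak.congr (ae_eq_refl s) hst_ae
  have ht_int : IntegrableOn t (Ioo 0 1) := by
    obtain ⟨c, rfl⟩ := mem_reducedSplineSpace_iff.1 ht
    exact (integrable_spline ((h.shift hk).sorted le_rfl) c).integrableOn
  have hcomm := h.projC_ae_eq_iteratedDeriv_proj hr (by omega) (by omega) hweak ht_int
  rw [h.proj_eq_self hr (by omega) hs] at hcomm
  exact hcomm.trans hst_ae

lemma MemSobolev.memLp {Ω : Set ℝ} (hv : MemSobolev Ω l v) (hΩ : IsOpen Ω) (hk : k ≤ l)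
    (hg : HasWeakDeriv Ω k v g) : MemLp g 2 (volume.restrict Ω) := by
  obtain ⟨w, hw, hw_memLp⟩ := hv k hk
  exact hw_memLp.ae_eq (hw.unique hΩ hg)

lemma MemSobolev.integrableOn (hv : MemSobolev (Ioo 0 1) l v) (hk : k ≤ l)
    (hg : HasWeakDeriv (Ioo 0 1) k v g) : IntegrableOn g (Ioo 0 1) :=
  (hv.memLp isOpen_Ioo hk hg).integrable one_le_two

end CommutingProjection

/-! ### Local stability -/

section Stability

variable {ξ : ℕ → ℝ} {p n i l : ℕ}

lemma exists_abs_dualFunctional_mul_le (p : ℕ) : ∃ C, 0 ≤ C ∧ ∀ (ξ : ℕ → ℝ) (j : ℕ),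
    SortedKnots ξ j (j + p + 1) → ξ j < ξ (j + p + 1) → ∀ w : ℝ → ℝ,
    IntegrableOn w (Ioo (ξ j) (ξ (j + p + 1))) →
    |dualFunctional ξ p j w| * (ξ (j + p + 1) - ξ j)
      ≤ C * ∫ x in Ioo (ξ j) (ξ (j + p + 1)), |w x| := by
  obtain ⟨C, hC⟩ := exists_abs_iteratedDeriv_dualKernel_le p
  refine ⟨max C 0, le_max_right C 0, fun ξ j hsorted h w hw => ?_⟩
  have hlen : 0 < ξ (j + p + 1) - ξ j := sub_pos.2 h
  rw [← le_div_iff₀ hlen, dualFunctional, intervalIntegral.integral_of_le h.le,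
    integral_Ioc_eq_integral_Ioo, mul_div_right_comm, ← integral_const_mul]
  refine abs_integral_le_integral_abs.trans <| integral_mono_of_nonneg
    (ae_of_all _ fun x => abs_nonneg _) (hw.abs.const_mul _) (ae_restrict_of_ae ?_)
  filter_upwards [hC ξ j hsorted h] with x hx
  rw [abs_mul, mul_comm]
  gcongr
  exact hx.trans (by gcongr; exact le_max_left C 0)

lemma exists_abs_dualFunctional_mul_sub_le (p : ℕ) : ∃ C, 0 ≤ C ∧
    ∀ (n : ℕ) (ξ : ℕ → ℝ) (r : ℤ), IsOpenKnotVector p n ξ → HasRegularity p n ξ r → -1 ≤ r →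
    ∀ i < n, ∀ j ∈ Finset.Icc (i - p) i, ∀ w : ℝ → ℝ, IntegrableOn w (supportExtension ξ p i) →
    |dualFunctional ξ p j w| * (ξ (i + 1) - ξ i) ≤ C * ∫ y in supportExtension ξ p i, |w y| := by
  obtain ⟨C, hC_nonneg, hC⟩ := exists_abs_dualFunctional_mul_le p
  refine ⟨C, hC_nonneg, fun n ξ r h hr hr1 i hi j hj w hw => ?_⟩
  have hsub := h.support_subset hi hj
  rw [Finset.mem_Icc] at hj
  have hlen : ξ (i + 1) - ξ i ≤ ξ (j + p + 1) - ξ j :=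
    sub_le_sub (h.mono _ _ (by omega) (by omega)) (h.mono _ _ hj.2 (by omega))
  calc |dualFunctional ξ p j w| * (ξ (i + 1) - ξ i)
      ≤ |dualFunctional ξ p j w| * (ξ (j + p + 1) - ξ j) := by gcongr
    _ ≤ C * ∫ y in Ioo (ξ j) (ξ (j + p + 1)), |w y| :=
        hC ξ j (h.sorted (by omega)) (h.lt_support hr hr1 (by omega)) w (hw.mono_set hsub)
    _ ≤ C * ∫ y in supportExtension ξ p i, |w y| := mul_le_mul_of_nonneg_left
        (setIntegral_mono_set hw.abs (ae_of_all _ fun y => abs_nonneg _) hsub.eventuallyLE)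
        hC_nonneg

lemma IsOpenKnotVector.abs_iteratedDeriv_bspline_mul_pow_le (h : IsOpenKnotVector p n ξ)
    (hi : i < n) {j : ℕ} (hj : j ∈ Finset.Icc (i - p) i) {x : ℝ} (hx : x ∈ element ξ i)
    (hl : l ≤ p + 1) :
    |iteratedDeriv l (bspline ξ p j) x| * (ξ (i + 1) - ξ i) ^ l
      ≤ 2 ^ p * (2 * p + 1) ^ (p + 1) := by
  rw [Finset.mem_Icc] at hj
  calc |iteratedDeriv l (bspline ξ p j) x| * (ξ (i + 1) - ξ i) ^ l ≤ 2 ^ p * (2 * p) ^ l :=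
        (h.sorted le_rfl).abs_iteratedDeriv_bspline_mul_pow_le i.zero_le (by omega) hx
          j.zero_le (by omega) l
    _ ≤ 2 ^ p * (2 * p + 1) ^ l := by gcongr; linarith
    _ ≤ 2 ^ p * (2 * p + 1) ^ (p + 1) := by gcongr; linarith [p.cast_nonneg (α := ℝ)]

lemma exists_abs_iteratedDeriv_proj_mul_pow_le (p : ℕ) : ∃ C, 0 ≤ C ∧
    ∀ (n : ℕ) (ξ : ℕ → ℝ) (r : ℤ), IsOpenKnotVector p n ξ → HasRegularity p n ξ r → -1 ≤ r →
    ∀ i < n, ∀ l ≤ p + 1, ∀ w : ℝ → ℝ, IntegrableOn w (supportExtension ξ p i) →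
    ∀ x ∈ element ξ i, |iteratedDeriv l (proj ξ p n w) x| * (ξ (i + 1) - ξ i) ^ (l + 1)
      ≤ C * ∫ y in supportExtension ξ p i, |w y| := by
  obtain ⟨C, hC_nonneg, hC⟩ := exists_abs_dualFunctional_mul_sub_le p
  refine ⟨(p + 1) * (C * (2 ^ p * (2 * p + 1) ^ (p + 1))), by positivity,
    fun n ξ r h hr hr1 i hi l hl w hw x hx => ?_⟩
  set δ := ξ (i + 1) - ξ i
  set N := ∫ y in supportExtension ξ p i, |w y|
  have hδ : 0 < δ := sub_pos.2 (hx.1.trans hx.2)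
  have hN : 0 ≤ N := integral_nonneg fun _ => abs_nonneg _
  have hcard : (Finset.Icc (i - p) i).card ≤ p + 1 := by rw [Nat.card_Icc]; omega
  rw [h.iteratedDeriv_proj_eq_sum hi hx]
  calc |∑ j ∈ Finset.Icc (i - p) i, dualFunctional ξ p j w * iteratedDeriv l (bspline ξ p j) x|
        * δ ^ (l + 1)
      ≤ (∑ j ∈ Finset.Icc (i - p) i,
          |dualFunctional ξ p j w * iteratedDeriv l (bspline ξ p j) x|) * δ ^ (l + 1) := by
        gcongr
        exact Finset.abs_sum_le_sum_abs _ _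
    _ = ∑ j ∈ Finset.Icc (i - p) i, |dualFunctional ξ p j w| * δ
          * (|iteratedDeriv l (bspline ξ p j) x| * δ ^ l) := by
        rw [Finset.sum_mul]
        exact Finset.sum_congr rfl fun j _ => by rw [abs_mul]; ring
    _ ≤ ∑ _j ∈ Finset.Icc (i - p) i, C * N * (2 ^ p * (2 * p + 1) ^ (p + 1)) :=
        Finset.sum_le_sum fun j hj => mul_le_mul (hC n ξ r h hr hr1 i hi j hj w hw)
          (h.abs_iteratedDeriv_bspline_mul_pow_le hi hj hx hl) (by positivity)
          (mul_nonneg hC_nonneg hN)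
    _ ≤ (p + 1) * (C * N * (2 ^ p * (2 * p + 1) ^ (p + 1))) := by
        rw [Finset.sum_const, nsmul_eq_mul]
        gcongr
        exact_mod_cast hcard
    _ = _ := by ring

lemma exists_abs_iteratedDeriv_proj_mul_pow_le_of_hasWeakDeriv (p : ℕ) : ∃ C, 0 ≤ C ∧
    ∀ (n : ℕ) (ξ : ℕ → ℝ) (r : ℤ), IsOpenKnotVector p n ξ → HasRegularity p n ξ r → -1 ≤ r →
    ∀ i < n, ∀ l ≤ p + 1, ∀ v g : ℝ → ℝ, HasWeakDeriv (supportExtension ξ p i) l v g →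
    IntegrableOn g (supportExtension ξ p i) → ∀ x ∈ element ξ i,
    |iteratedDeriv l (proj ξ p n v) x| * (ξ (i + 1) - ξ i) ^ (l + 1)
      ≤ C * ((ξ (i + p + 1) - ξ (i - p)) ^ l * ∫ y in supportExtension ξ p i, |g y|) := by
  obtain ⟨C, hC_nonneg, hC⟩ := exists_abs_iteratedDeriv_proj_mul_pow_le p
  refine ⟨C, hC_nonneg, fun n ξ r h hr hr1 i hi l hl v g hv hg x hx => ?_⟩
  have hle : ξ (i - p) ≤ ξ (i + p + 1) := h.mono _ _ (by omega) (by omega)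
  have hw := integrableOn_iterate_primitive hle hg l
  rw [h.iteratedDeriv_proj_eq_of_hasWeakDeriv hr hr1 hi hl hv
    (hasWeakDeriv_iterate_primitive hle hg l) hw hx]
  exact (hC n ξ r h hr hr1 i hi l hl _ hw x hx).trans
    (mul_le_mul_of_nonneg_left (integral_abs_iterate_primitive_le hle hg l) hC_nonneg)

lemma sub_le_mul_meshSize {a m : ℕ} (hm : a + m ≤ n + p) :
    ξ (a + m) - ξ a ≤ m * meshSize p n ξ := by
  induction m with
  | zero => simp
  | succ m ih =>
    have hstep : ξ (a + m + 1) - ξ (a + m) ≤ meshSize p n ξ :=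
      le_ciSup (f := fun k : Fin (n + p) => ξ (k + 1) - ξ k) (finite_range _).bddAbove
        ⟨a + m, by omega⟩
    push_cast
    rw [← add_assoc]
    linarith [ih (by omega)]

lemma IsRegularMesh.supportExtension_le {c : ℝ} (hc : IsRegularMesh c p n ξ)
    (h : IsOpenKnotVector p n ξ) (hi : IsElement p n ξ i) :
    ξ (i + p + 1) - ξ (i - p) ≤ (2 * p + 1) * c * (ξ (i + 1) - ξ i) := by
  have hpi := hi.le h
  have hin := hi.lt h
  calc ξ (i + p + 1) - ξ (i - p) = ξ (i - p + (2 * p + 1)) - ξ (i - p) := by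
        rw [show i - p + (2 * p + 1) = i + p + 1 by omega]
    _ ≤ ((2 * p + 1 : ℕ) : ℝ) * meshSize p n ξ := sub_le_mul_meshSize (by omega)
    _ ≤ (2 * p + 1) * (c * (ξ (i + 1) - ξ i)) := by
        push_cast
        gcongr
        exact hc i hi
    _ = _ := by ring

lemma ofReal_integral_abs_le_eLpNorm_two {α : Type*} {m : MeasurableSpace α} {μ : Measure α}
    {g : α → ℝ} (hg : Integrable g μ) :
    ENNReal.ofReal (∫ x, |g x| ∂μ) ≤ eLpNorm g 2 μ * μ univ ^ (2⁻¹ : ℝ) := by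
  have hHölder := eLpNorm_le_eLpNorm_mul_rpow_measure_univ (p := 1) (q := 2) one_le_two
    hg.aestronglyMeasurable
  rw [eLpNorm_one_eq_lintegral_enorm, ← ofReal_integral_norm_eq_lintegral_enorm hg] at hHölder
  norm_num at hHölder ⊢
  exact hHölder

lemma eLpNorm_two_restrict_le_of_abs_le_mul_integral {α : Type*} {m : MeasurableSpace α}
    {μ : Measure α} {s t : Set α} (hs : MeasurableSet s) (hst : s ⊆ t) {f g : α → ℝ} {M : ℝ}
    (hM : 0 ≤ M) (hg : IntegrableOn g t μ) (hf : ∀ x ∈ s, |f x| ≤ M * ∫ y in t, |g y| ∂μ) :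
    eLpNorm f 2 (μ.restrict s) ≤ ENNReal.ofReal M * μ t * eLpNorm g 2 (μ.restrict t) := by
  have hbound : ∀ᵐ x ∂μ.restrict s, ‖f x‖ ≤ M * ∫ y in t, |g y| ∂μ :=
    ae_restrict_of_forall_mem hs hf
  have hsup := eLpNorm_le_of_ae_bound (p := 2) hbound
  rw [Measure.restrict_apply_univ, ENNReal.toReal_ofNat, ENNReal.ofReal_mul hM] at hsup
  have hint := ofReal_integral_abs_le_eLpNorm_two hg
  rw [Measure.restrict_apply_univ] at hint
  calc eLpNorm f 2 (μ.restrict s)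
      ≤ μ s ^ (2⁻¹ : ℝ) * (ENNReal.ofReal M * ENNReal.ofReal (∫ y in t, |g y| ∂μ)) := hsup
    _ ≤ μ t ^ (2⁻¹ : ℝ) * (ENNReal.ofReal M * (eLpNorm g 2 (μ.restrict t) * μ t ^ (2⁻¹ : ℝ))) := by
        gcongr
    _ = ENNReal.ofReal M * (μ t ^ (2⁻¹ : ℝ) * μ t ^ (2⁻¹ : ℝ)) * eLpNorm g 2 (μ.restrict t) := by
        ring
    _ = ENNReal.ofReal M * μ t * eLpNorm g 2 (μ.restrict t) := by
        rw [← ENNReal.rpow_add_of_nonneg _ _ (by norm_num) (by norm_num),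
          show (2⁻¹ : ℝ) + 2⁻¹ = 1 by norm_num, ENNReal.rpow_one]

lemma exists_eLpNorm_iteratedDeriv_proj_le (p : ℕ) (c : ℝ) : ∃ C : ℝ≥0,
    ∀ (n : ℕ) (ξ : ℕ → ℝ) (r : ℤ), IsOpenKnotVector p n ξ → HasRegularity p n ξ r → -1 ≤ r →
    IsRegularMesh c p n ξ → ∀ i, IsElement p n ξ i → ∀ l ≤ p + 1, ∀ v g : ℝ → ℝ,
    HasWeakDeriv (supportExtension ξ p i) l v g → IntegrableOn g (supportExtension ξ p i) →
    eLpNorm (iteratedDeriv l (proj ξ p n v)) 2 (volume.restrict (element ξ i))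
      ≤ C * eLpNorm g 2 (volume.restrict (supportExtension ξ p i)) := by
  obtain ⟨C, hC_nonneg, hC⟩ := exists_abs_iteratedDeriv_proj_mul_pow_le_of_hasWeakDeriv p
  refine ⟨(C * max 1 ((2 * p + 1) * c) ^ (p + 2)).toNNReal,
    fun n ξ r h hr hr1 hc i hi l hl v g hv hg => ?_⟩
  have hin := hi.lt h
  set δ := ξ (i + 1) - ξ i
  set H := ξ (i + p + 1) - ξ (i - p)
  have hδ : 0 < δ := sub_pos.2 hi.2
  have hH : 0 ≤ H := sub_nonneg.2 (h.mono _ _ (by omega) (by omega))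
  have hratio : H / δ ≤ max 1 ((2 * p + 1) * c) :=
    ((div_le_iff₀ hδ).2 (hc.supportExtension_le h hi)).trans (le_max_right _ _)
  have hconst : C * H ^ l / δ ^ (l + 1) * H ≤ C * max 1 ((2 * p + 1) * c) ^ (p + 2) :=
    calc C * H ^ l / δ ^ (l + 1) * H = C * (H / δ) ^ (l + 1) := by rw [div_pow]; ring
      _ ≤ C * max 1 ((2 * p + 1) * c) ^ (l + 1) := by gcongr
      _ ≤ C * max 1 ((2 * p + 1) * c) ^ (p + 2) := mul_le_mul_of_nonneg_left
          (pow_le_pow_right₀ (le_max_left _ _) (by omega)) hC_nonneg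
  have hpointwise : ∀ x ∈ element ξ i, |iteratedDeriv l (proj ξ p n v) x|
      ≤ C * H ^ l / δ ^ (l + 1) * ∫ y in supportExtension ξ p i, |g y| := by
    intro x hx
    rw [div_mul_eq_mul_div, le_div_iff₀ (by positivity), mul_assoc C]
    exact hC n ξ r h hr hr1 i hin l hl v g hv hg x hx
  refine (eLpNorm_two_restrict_le_of_abs_le_mul_integral measurableSet_Ioo (h.element_subset hin)
    (by positivity) hg hpointwise).trans ?_
  rw [supportExtension, Real.volume_Ioo, ← ENNReal.ofReal_mul (by positivity)]
  gcongr
  exact ENNReal.ofReal_le_ofReal hconst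

lemma contDiffAt_iteratedDeriv {f : ℝ → ℝ} {x : ℝ} (hf : ContDiffAt ℝ ∞ f x) (k : ℕ) :
    ContDiffAt ℝ ∞ (iteratedDeriv k f) x := by
  induction k with
  | zero => rwa [iteratedDeriv_zero]
  | succ k ih =>
    rw [iteratedDeriv_succ]
    exact (ih.fderiv_right (m := ∞) le_rfl).clm_apply contDiffAt_const

lemma exists_sobolevSeminorm_projC_le (p : ℕ) (c : ℝ) : ∃ C : ℝ≥0,
    ∀ (n : ℕ) (ξ : ℕ → ℝ) (r : ℤ), IsOpenKnotVector p n ξ → HasRegularity p n ξ r → -1 ≤ r →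
    IsRegularMesh c p n ξ → ∀ i, IsElement p n ξ i → ∀ k l, k + l ≤ p + 1 → ∀ v,
    MemSobolev (Ioo 0 1) l v → sobolevSeminorm (element ξ i) l (projC k ξ p n v)
      ≤ C * sobolevSeminorm (supportExtension ξ p i) l v := by
  obtain ⟨C, hC⟩ := exists_eLpNorm_iteratedDeriv_proj_le p c
  refine ⟨C, fun n ξ r h hr hr1 hc i hi k l hkl v hv => ?_⟩
  have hin := hi.lt h
  have hsub := h.supportExtension_subset hin
  obtain ⟨g, hg, -⟩ := hv l le_rfl
  have hv_int : IntegrableOn v (Ioo 0 1) := hv.integrableOn l.zero_le (hasWeakDeriv_zero hg.1)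
  have hsmooth : ∀ x ∈ element ξ i, ContDiffAt ℝ ∞ (projC k ξ p n v) x := fun x hx =>
    contDiffAt_iteratedDeriv (contDiffAt_spline _
      ((h.sorted le_rfl).offKnots_of_mem_Ioo i.zero_le (by omega) hx)) k
  have hopen : IsOpen (supportExtension ξ p i) := isOpen_Ioo
  have hopen_element : IsOpen (element ξ i) := isOpen_Ioo
  rw [(hg.mono hsub).sobolevSeminorm_eq hopen,
    (hasWeakDeriv_iteratedDeriv hopen_element hsmooth l).sobolevSeminorm_eq hopen_element,
    projC, iteratedDeriv_iteratedDeriv, add_comm k l]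
  exact hC n ξ r h hr hr1 hc i hi (l + k) (by omega) _ g
    ((hg.iterate_primitive zero_le_one hv_int k).mono hsub)
    ((hv.integrableOn le_rfl hg).mono_set hsub)

end Stability

theorem mainTheorem4_general (p : ℕ) (r : ℤ) (hr : -1 ≤ r) :
    (∀ (n : ℕ) (ξ : ℕ → ℝ), IsOpenKnotVector p n ξ → HasRegularity p n ξ r →
      (∀ v, IntegrableOn v (Ioo 0 1) → proj ξ p n v ∈ splineSpace ξ p n) ∧
      (∀ s ∈ splineSpace ξ p n, proj ξ p n s = s) ∧
      (∀ k ≤ p, (k : ℤ) ≤ r + 1 →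
        (∀ v, IntegrableOn v (Ioo 0 1) → ∃ s ∈ reducedSplineSpace k ξ p n,
          projC k ξ p n v =ᵐ[volume.restrict (Ioo 0 1)] s) ∧
        (∀ s ∈ reducedSplineSpace k ξ p n, projC k ξ p n s =ᵐ[volume.restrict (Ioo 0 1)] s)) ∧
      (∀ k l, k + l ≤ p → (k : ℤ) + l ≤ r + 1 → ∀ v gk g : ℝ → ℝ,
        HasWeakDeriv (Ioo 0 1) k v gk → IntegrableOn gk (Ioo 0 1) →
        HasWeakDeriv (Ioo 0 1) (k + l) v g → IntegrableOn g (Ioo 0 1) →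
        projC (k + l) ξ p n g =ᵐ[volume.restrict (Ioo 0 1)] iteratedDeriv l (projC k ξ p n gk) ∧
        HasWeakDeriv (Ioo 0 1) l (projC k ξ p n gk) (projC (k + l) ξ p n g))) ∧
    (∀ c : ℝ, ∃ C : ℝ≥0, ∀ (n : ℕ) (ξ : ℕ → ℝ), IsOpenKnotVector p n ξ → HasRegularity p n ξ r →
      IsRegularMesh c p n ξ → ∀ i, IsElement p n ξ i → ∀ k l, k + l ≤ p + 1 → ∀ v,
      MemSobolev (Ioo 0 1) l v → sobolevSeminorm (element ξ i) l (projC k ξ p n v)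
        ≤ C * sobolevSeminorm (supportExtension ξ p i) l v) := by
  refine ⟨fun n ξ h hreg => ⟨fun _ _ => spline_mem_splineSpace _,
    fun s hs => h.proj_eq_self hreg hr hs, fun k hk hkr => ⟨fun v _ => h.exists_projC_ae_eq hk v,
      fun s hs => h.projC_ae_eq_self hreg hkr hk hs⟩,
    fun k l hkl hklr v gk g hvk hgk hv hg => ⟨?_, ?_⟩⟩, fun c => ?_⟩
  · exact h.projC_ae_eq_iteratedDeriv_projC hreg hr (by omega) hvk hgk hv hg
  · exact h.hasWeakDeriv_projC hreg hklr hkl hvk hgk hv hg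
  · obtain ⟨C, hC⟩ := exists_sobolevSeminorm_projC_le p c
    exact ⟨C, fun n ξ h hreg => hC n ξ r h hreg hr⟩

end UnivariateSpline

open UnivariateSpline in
theorem mainTheorem4 (p : ℕ) (r : ℤ) (hr : -1 ≤ r) (hrp : r ≤ (p : ℤ) - 1) :
    -- spline preservation and commutation, for every knot vector
    (∀ (n : ℕ) (ξ : ℕ → ℝ), IsOpenKnotVector p n ξ → HasRegularity p n ξ r →
      ((∀ v, MemLp v 2 (volume.restrict (Ioo 0 1)) → proj ξ p n v ∈ splineSpace ξ p n) ∧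
        (∀ s ∈ splineSpace ξ p n, proj ξ p n s = s)) ∧
      (0 ≤ r →
        (∀ v, MemLp v 2 (volume.restrict (Ioo 0 1)) → ∃ s ∈ reducedSplineSpace 1 ξ p n,
          projC1 ξ p n v =ᵐ[volume.restrict (Ioo 0 1)] s) ∧
        (∀ s ∈ reducedSplineSpace 1 ξ p n,
          projC1 ξ p n s =ᵐ[volume.restrict (Ioo 0 1)] s) ∧
        (∀ v v' : ℝ → ℝ, MemSobolev (Ioo 0 1) 1 v → HasWeakDeriv (Ioo 0 1) 1 v v' →
          projC1 ξ p n v' =ᵐ[volume.restrict (Ioo 0 1)] deriv (proj ξ p n v) ∧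
          HasWeakDeriv (Ioo 0 1) 1 (proj ξ p n v) (projC1 ξ p n v'))) ∧
      (1 ≤ r →
        (∀ v, MemLp v 2 (volume.restrict (Ioo 0 1)) → ∃ s ∈ reducedSplineSpace 2 ξ p n,
          projC2 ξ p n v =ᵐ[volume.restrict (Ioo 0 1)] s) ∧
        (∀ s ∈ reducedSplineSpace 2 ξ p n,
          projC2 ξ p n s =ᵐ[volume.restrict (Ioo 0 1)] s) ∧
        (∀ v v' v'' : ℝ → ℝ, MemSobolev (Ioo 0 1) 2 v → HasWeakDeriv (Ioo 0 1) 1 v v' →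
          HasWeakDeriv (Ioo 0 1) 2 v v'' →
          projC2 ξ p n v'' =ᵐ[volume.restrict (Ioo 0 1)] deriv (deriv (proj ξ p n v)) ∧
          projC2 ξ p n v'' =ᵐ[volume.restrict (Ioo 0 1)] deriv (projC1 ξ p n v') ∧
          HasWeakDeriv (Ioo 0 1) 2 (proj ξ p n v) (projC2 ξ p n v'') ∧
          HasWeakDeriv (Ioo 0 1) 1 (projC1 ξ p n v') (projC2 ξ p n v'')))) ∧
    -- local stability, with a constant that does not depend on the mesh
    (∀ c : ℝ, ∃ C : ℝ≥0, ∀ (n : ℕ) (ξ : ℕ → ℝ), IsOpenKnotVector p n ξ → HasRegularity p n ξ r →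
      IsRegularMesh c p n ξ → ∀ i, IsElement p n ξ i →
      (∀ l ≤ p + 1, ∀ v, MemSobolev (Ioo 0 1) l v →
        sobolevSeminorm (element ξ i) l (proj ξ p n v)
          ≤ C * sobolevSeminorm (supportExtension ξ p i) l v) ∧
      (0 ≤ r → ∀ l ≤ p, ∀ v, MemSobolev (Ioo 0 1) l v →
        sobolevSeminorm (element ξ i) l (projC1 ξ p n v)
          ≤ C * sobolevSeminorm (supportExtension ξ p i) l v) ∧
      (1 ≤ r → ∀ l ≤ p - 1, ∀ v, MemSobolev (Ioo 0 1) l v →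
        sobolevSeminorm (element ξ i) l (projC2 ξ p n v)
          ≤ C * sobolevSeminorm (supportExtension ξ p i) l v)) := by
  obtain ⟨hspline, hstable⟩ := mainTheorem4_general p r hr
  refine ⟨fun n ξ h hreg => ?_, fun c => (hstable c).imp fun C hC n ξ h hreg hc i hi => ?_⟩
  · obtain ⟨hmem, hself, hprojC, hcomm⟩ := hspline n ξ h hreg
    refine ⟨⟨fun v hv => hmem v (hv.integrable one_le_two), hself⟩,
      fun hr0 => ?_, fun hr1 => ?_⟩ <;>
      simp only [← projC_zero, ← projC_one, ← projC_two, ← iteratedDeriv_one,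
        iteratedDeriv_iteratedDeriv]
    · obtain ⟨hmem1, hself1⟩ := hprojC 1 (by omega) (by omega)
      exact ⟨fun v hv => hmem1 v (hv.integrable one_le_two), hself1, fun v v' hv hv' =>
        hcomm 0 1 (by omega) (by omega) v v v' (hasWeakDeriv_zero hv'.1)
          (hv.integrableOn zero_le_one (hasWeakDeriv_zero hv'.1)) hv' (hv.integrableOn le_rfl hv')⟩
    · obtain ⟨hmem2, hself2⟩ := hprojC 2 (by omega) (by omega)
      refine ⟨fun v hv => hmem2 v (hv.integrable one_le_two), hself2,
        fun v v' v'' hv hv' hv'' => ?_⟩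
      have hv_zero := hasWeakDeriv_zero hv'.1
      have hv''_int := hv.integrableOn le_rfl hv''
      obtain ⟨heq, hweak⟩ := hcomm 0 2 (by omega) (by omega) v v v'' hv_zero
        (hv.integrableOn zero_le_two hv_zero) hv'' hv''_int
      obtain ⟨heq1, hweak1⟩ := hcomm 1 1 (by omega) (by omega) v v' v'' hv'
        (hv.integrableOn one_le_two hv') hv'' hv''_int
      exact ⟨heq, heq1, hweak, hweak1⟩
  · simp only [← projC_zero, ← projC_one, ← projC_two]
    exact ⟨fun l hl => hC n ξ h hreg hc i hi 0 l (by omega),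
      fun _ l hl => hC n ξ h hreg hc i hi 1 l (by omega),
      fun hr1 l hl => hC n ξ h hreg hc i hi 2 l (by omega)⟩
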